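/- **Conventions.** Let $B$ be a scheme. Let $\mathbf H^\bullet(B)$ be the pointed Morel–Voevodsky motivic homotopy category: pointed simplicial presheaves on the category $\mathrm{Sm}_B$ of smooth $B$-schemes with the Nisnevich topology, with the weak equivalences of the left Bousfield localization of the Nisnevich-local (stalkwise) simplicial weak equivalences at the projections $(\mathbb A^1\times U)_+\to U_+$, $U\in \mathrm{Sm}_B$, inverted. Here Nisnevich coverings are the families of étale morphisms for which each point lifts with the same residue field. For $f\colon X\to B$ smooth and $z\in X$ let $\overline z$ be the closure of $z$, let $X_z=\operatorname{Spec}\mathcal O_{X,z}$, and let $\overline z_x=\overline z\times_X X_x$ for $x\in\overline z$, where $\overline z$ carries its reduced structure. For points $x,y\in X$ write $$X_x/(X_x-x)=\text{“}\lim\text{”}_{U\ni x}\,U/(U-\overline x),\qquad (X_x-x)/(X_x-\overline y_x)=\text{“}\lim\text{”}_{U\ni x}\,(U-\overline x)/(U-\overline x-\overline y)$$ for the pro-objects in $\mathbf H^\bullet(B)$ indexed by the open neighbourhoods $U$ of $x$ in $X$. If $x\in\overline y$ and $y\ne x$, there are a connecting morphism and an excision morphism of pro-objects $$\delta_{x,y}\colon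 X_x/(X_x-x)\to (X_x-x)/(X_x-\overline y_x)\wedge S^1,\qquad \varepsilon_{x,y}\colon X_y/(X_y-y)\to (X_x-x)/(X_x-\overline y_x).$$ The first is given by the connecting morphisms of the triples $U-\overline x-\overline y\subset U-\overline x\subset U$. The second is given by the inclusions of the open neighbourhoods $U-\overline x$ of $y$ into $X$. When $\varepsilon_{x,y}$ is an isomorphism, the boundary morphism is $$\partial_{x,y}=(\varepsilon_{x,y}^{-1}\wedge S^1)\circ\delta_{x,y}\colon X_x/(X_x-x)\to X_y/(X_y-y)\wedge S^1 .$$ **Corollary.** Let $p\colon X\to B$ and $p'\colon X'\to B$ be smooth morphisms of schemes, and let $x\in X$, $x'\in X'$ be points such that $X$ and $X'$ have the same relative dimension over $B$ at $x$ and $x'$, and such that $\operatorname{Spec}\kappa(x)\cong\operatorname{Spec}\kappa(x')$ as $B$-schemes. 1. There is an isomorphism $X_x/(X_x-x)\simeq X'_{x'}/(X'_{x'}-x')$ of pro-objects in $\mathbf H^\bullet(B)$. 2. Let moreover $y\in X$ and $y'\in X'$ be points such that $x\in\overline y$, $x\neq y$, $\dim X_x=\dim X_y+1$, and $x'\in\overline{y'}$,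 $x'\ne y'$, $\dim X'_{x'}=\dim X'_{y'}+1$, and such that $\overline y_x\cong\overline{y'}_{x'}$ as $B$-schemes. Then there are isomorphisms of pro-objects in $\mathbf H^\bullet(B)$ $$\varphi_x\colon X_x/(X_x-x)\simeq X'_{x'}/(X'_{x'}-x'),\qquad \varphi_y\colon X_y/(X_y-y)\simeq X'_{y'}/(X'_{y'}-y'),$$ $$\psi\colon (X_x-x)/(X_x-\overline y_x)\simeq (X'_{x'}-x')/(X'_{x'}-\overline{y'}_{x'})$$ such that $\psi\circ\varepsilon_{x,y}=\varepsilon_{x',y'}\circ\varphi_y$ and $(\psi\wedge S^1)\circ\delta_{x,y}=\delta_{x',y'}\circ\varphi_x$. If $\varepsilon_{x,y}$ and $\varepsilon_{x',y'}$ are isomorphisms, which is always the case when $B$ is locally noetherian, then the square of boundary morphisms commutes: $$(\varphi_y\wedge S^1)\circ\partial_{x,y}=\partial_{x',y'}\circ\varphi_x .$$ -/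

import Mathlib

open CategoryTheory Limits Opposite Simplicial
universe w v u
noncomputable section
namespace MotivicPairs

/-! ## Pointed sets -/

/-- The relation on a pointed set which collapses a subset to the base point. -/
def collapse {X : Type w} (S : Set X) : Setoid X where
  r a b := a = b ∨ (a ∈ S ∧ b ∈ S)
  iseqv :=
    { refl := fun _ => Or.inl rfl
      symm := by rintro a b (h | h); exacts [Or.inl h.symm, Or.inr h.symm]
      trans := by
        rintro a b c (rfl | h) (rfl | h')
        exacts [Or.inl rfl, Or.inr h', Or.inr h, Or.inr ⟨h.1, h'.2⟩] }

/-- The cofiber `X / A` of a map of pointed sets `A ⟶ X`: the image of `A` is collapsed to the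
base point. -/
def cofiberObj (f : Arrow Pointed.{w}) : Pointed.{w} :=
  ⟨Quotient (collapse (Set.range f.hom.toFun)), Quotient.mk _ f.right.point⟩

def cofiberProj (f : Arrow Pointed.{w}) : f.right ⟶ cofiberObj f :=
  ⟨fun x => Quotient.mk _ x, rfl⟩

lemma mk_collapse_eq {X : Type w} {S : Set X} {a b : X} :
    (Quotient.mk (collapse S) a = Quotient.mk (collapse S) b) ↔ a = b ∨ (a ∈ S ∧ b ∈ S) :=
  ⟨fun h => Quotient.exact h, fun h => Quotient.sound h⟩

lemma point_mem_range {A X : Pointed.{w}} (f : A ⟶ X) : X.point ∈ Set.range f.toFun :=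
  ⟨A.point, f.map_point⟩

/-- The cofiber as a functor on arrows of pointed sets. -/
def cofiber₀ : Arrow Pointed.{w} ⥤ Pointed.{w} where
  obj f := cofiberObj f
  map {f g} φ := ⟨Quotient.map φ.right.toFun (by
      rintro a b (rfl | ⟨⟨a, rfl⟩, ⟨b, rfl⟩⟩)
      · exact Or.inl rfl
      · have h : ∀ c, φ.right.toFun (f.hom.toFun c) = g.hom.toFun (φ.left.toFun c) := fun c =>
          (congrFun (congrArg Pointed.Hom.toFun φ.w) c).symm
        exact Or.inr ⟨⟨_, (h a).symm⟩, ⟨_, (h b).symm⟩⟩),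
    congrArg (Quotient.mk _) φ.right.map_point⟩
  map_id f := by
    apply Pointed.Hom.ext; funext x; induction x using Quotient.inductionOn; rfl
  map_comp f g := by
    apply Pointed.Hom.ext; funext x; induction x using Quotient.inductionOn; rfl

/-- The wedge `X ∨ K`, as a subset of `X × K`. -/
def axes (X K : Pointed.{w}) : Set (X.X × K.X) :=
  Set.ofPred fun p => p.1 = X.point ∨ p.2 = K.point

/-- The smash product `X ∧ K = (X × K) / (X ∨ K)` of two pointed sets. -/
def smashObj (X K : Pointed.{w}) : Pointed.{w} :=
  ⟨Quotient (collapse (axes X K)), Quotient.mk _ (X.point, K.point)⟩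

def smashMap {X Y K L : Pointed.{w}} (f : X ⟶ Y) (g : K ⟶ L) : smashObj X K ⟶ smashObj Y L :=
  ⟨Quotient.map (fun p => (f.toFun p.1, g.toFun p.2)) (by
      have key : ∀ p : X.X × K.X, (p.1 = X.point ∨ p.2 = K.point) →
          (f.toFun p.1 = Y.point ∨ g.toFun p.2 = L.point) := by
        rintro p (h | h)
        · exact Or.inl (by rw [h]; exact f.map_point)
        · exact Or.inr (by rw [h]; exact g.map_point)
      rintro a b (rfl | ⟨ha, hb⟩)
      · exact Or.inl rfl
      · exact Or.inr ⟨key _ ha, key _ hb⟩),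
    congrArg (Quotient.mk _) (Prod.ext f.map_point g.map_point)⟩

@[simp] lemma smashMap_id (X K : Pointed.{w}) : smashMap (𝟙 X) (𝟙 K) = 𝟙 _ := by
  apply Pointed.Hom.ext; funext x; induction x using Quotient.inductionOn; rfl

lemma smashMap_comp {X Y Z K L M : Pointed.{w}} (f : X ⟶ Y) (f' : Y ⟶ Z) (g : K ⟶ L)
    (g' : L ⟶ M) : smashMap (f ≫ f') (g ≫ g') = smashMap f g ≫ smashMap f' g' := by
  apply Pointed.Hom.ext; funext x; induction x using Quotient.inductionOn; rfl

/-- The one-point pointed set. -/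
def pt₀ : Pointed.{w} := ⟨PUnit, PUnit.unit⟩

def toPt₀ (X : Pointed.{w}) : X ⟶ pt₀ := ⟨fun _ => PUnit.unit, rfl⟩

def fromPt₀ (X : Pointed.{w}) : pt₀ ⟶ X := ⟨fun _ => X.point, rfl⟩

lemma cofiber_isPushout₀ {A X : Pointed.{w}} (f : A ⟶ X) :
    IsPushout f (toPt₀ A) (cofiberProj (Arrow.mk f)) (fromPt₀ _) := by
  refine ⟨⟨?_⟩, ⟨PushoutCocone.IsColimit.mk _ (fun s => ⟨Quotient.lift s.inl.toFun ?_, ?_⟩)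
    ?_ ?_ ?_⟩⟩
  · apply Pointed.Hom.ext; funext a
    exact Quotient.sound (Or.inr ⟨⟨a, rfl⟩, point_mem_range f⟩)
  · have h : ∀ a, s.inl.toFun (f.toFun a) = s.pt.point := fun a =>
      (congrFun (congrArg Pointed.Hom.toFun s.condition) a).trans s.inr.map_point
    rintro _ _ (rfl | ⟨⟨a, rfl⟩, ⟨b, rfl⟩⟩)
    · rfl
    · exact (h a).trans (h b).symm
  · exact s.inl.map_point
  · intro s; rfl
  · intro s; apply Pointed.Hom.ext; funext x; exact s.inl.map_point.trans s.inr.map_point.symm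
  · intro s m h1 h2
    apply Pointed.Hom.ext; funext x; induction x using Quotient.inductionOn with | h x =>
    exact congrFun (congrArg Pointed.Hom.toFun h1) x

lemma smash_isPushout₀ (X : Pointed.{w}) {A K : Pointed.{w}} (f : A ⟶ K) :
    IsPushout (smashMap (𝟙 X) f) (toPt₀ _) (smashMap (𝟙 X) (cofiberProj (Arrow.mk f)))
      (fromPt₀ _) := by
  refine ⟨⟨?_⟩, ⟨PushoutCocone.IsColimit.mk _ (fun s => ⟨Quotient.lift
    (fun p => Quotient.lift (fun k => s.inl.toFun (Quotient.mk _ (p.1, k))) ?_ p.2) ?_, ?_⟩)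
    ?_ ?_ ?_⟩⟩
  · apply Pointed.Hom.ext; funext a; induction a using Quotient.inductionOn with | h a =>
    exact Quotient.sound (Or.inr ⟨Or.inr (Quotient.sound (Or.inr ⟨⟨_, rfl⟩, point_mem_range f⟩)),
      Or.inl rfl⟩)
  · have h : ∀ x a, s.inl.toFun (Quotient.mk _ (x, f.toFun a)) = s.pt.point := fun x a =>
      (congrFun (congrArg Pointed.Hom.toFun s.condition) (Quotient.mk _ (x, a))).trans
        s.inr.map_point
    rintro _ _ (rfl | ⟨⟨a, rfl⟩, ⟨b, rfl⟩⟩)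
    · rfl
    · exact (h _ a).trans (h _ b).symm
  · have h : ∀ x a, s.inl.toFun (Quotient.mk _ (x, f.toFun a)) = s.pt.point := fun x a =>
      (congrFun (congrArg Pointed.Hom.toFun s.condition) (Quotient.mk _ (x, a))).trans
        s.inr.map_point
    have key : ∀ (x : X) (k : K), (x = X.point ∨ Quotient.mk (collapse (Set.range f.toFun)) k =
        Quotient.mk _ K.point) → s.inl.toFun (Quotient.mk _ (x, k)) = s.pt.point := by
      rintro x k (rfl | hk)
      · refine Eq.trans (congrArg s.inl.toFun ?_) s.inl.map_point
        exact Quotient.sound (Or.inr ⟨Or.inl rfl, Or.inl rfl⟩)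
      · rcases mk_collapse_eq.1 hk with rfl | ⟨⟨a, rfl⟩, -⟩
        · refine Eq.trans (congrArg s.inl.toFun ?_) s.inl.map_point
          exact Quotient.sound (Or.inr ⟨Or.inr rfl, Or.inl rfl⟩)
        · exact h x a
    rintro ⟨x, k⟩ ⟨x', k'⟩ (hh | ⟨ha, hb⟩)
    · cases hh; rfl
    · induction k using Quotient.inductionOn with | h k =>
      induction k' using Quotient.inductionOn with | h k' =>
      exact (key x k ha).trans (key x' k' hb).symm
  · exact s.inl.map_point
  · intro s; apply Pointed.Hom.ext; funext x; induction x using Quotient.inductionOn; rfl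
  · intro s; apply Pointed.Hom.ext; funext x; exact s.inl.map_point.trans s.inr.map_point.symm
  · intro s m h1 h2
    apply Pointed.Hom.ext; funext x; induction x using Quotient.inductionOn with | h x =>
    obtain ⟨x, k⟩ := x
    induction k using Quotient.inductionOn with | h k =>
    exact congrFun (congrArg Pointed.Hom.toFun h1) (Quotient.mk _ (x, k))

lemma smash_injective (X : Pointed.{w}) {A K : Pointed.{w}} (f : A ⟶ K)
    (hf : Function.Injective f.toFun) : Function.Injective (smashMap (𝟙 X) f).toFun := by
  intro a b hab
  induction a using Quotient.inductionOn with | h a =>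
  induction b using Quotient.inductionOn with | h b =>
  obtain ⟨x, a⟩ := a
  obtain ⟨y, b⟩ := b
  have hp : ∀ c, f.toFun c = K.point → c = A.point := fun c hc => hf (hc.trans f.map_point.symm)
  rcases mk_collapse_eq.1 hab with h | ⟨h1, h2⟩
  · have h1 : x = y := congrArg Prod.fst h
    have h2 : a = b := hf (congrArg Prod.snd h)
    rw [h1, h2]
  · exact Quotient.sound (Or.inr ⟨h1.imp id (hp _), h2.imp id (hp _)⟩)

instance : HasPushouts Pointed.{w} := by
  apply +allowSynthFailures hasPushouts_of_hasColimit_span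
  intro A X Y f g
  let S : X ⊕ Y → X ⊕ Y → Prop := fun a b =>
    (∃ c, a = Sum.inl (f.toFun c) ∧ b = Sum.inr (g.toFun c))
  let Q : Pointed.{w} := ⟨Quot S, Quot.mk _ (Sum.inl X.point)⟩
  have hQ : Quot.mk S (Sum.inl X.point) = Quot.mk S (Sum.inr Y.point) :=
    Quot.sound ⟨A.point, by rw [f.map_point], by rw [g.map_point]⟩
  let i : X ⟶ Q := ⟨fun x => Quot.mk _ (Sum.inl x), rfl⟩
  let j : Y ⟶ Q := ⟨fun y => Quot.mk _ (Sum.inr y), hQ.symm⟩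
  have w : f ≫ i = g ≫ j := by
    apply Pointed.Hom.ext; funext c
    exact Quot.sound ⟨c, rfl, rfl⟩
  refine ⟨⟨⟨PushoutCocone.mk i j w, PushoutCocone.IsColimit.mk _ (fun s =>
    ⟨Quot.lift (Sum.elim s.inl.toFun s.inr.toFun) ?_, s.inl.map_point⟩) ?_ ?_ ?_⟩⟩⟩
  · rintro _ _ ⟨c, rfl, rfl⟩
    exact congrFun (congrArg Pointed.Hom.toFun s.condition) c
  · intro s; rfl
  · intro s; rfl
  · intro s m h1 h2
    apply Pointed.Hom.ext; funext x
    induction x using Quot.inductionOn with | h x =>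
    rcases x with x | x
    · exact congrFun (congrArg Pointed.Hom.toFun h1) x
    · exact congrFun (congrArg Pointed.Hom.toFun h2) x

/-! ## Pointed simplicial sets and pointed simplicial presheaves -/

/-- Pointed simplicial sets, as simplicial pointed sets. -/
abbrev PtSSet : Type (w + 1) := SimplexCategoryᵒᵖ ⥤ Pointed.{w}

/-- The category of pointed simplicial presheaves on `C`. -/
abbrev PtSPre (C : Type u) [Category.{v} C] := Cᵒᵖ ⥤ PtSSet.{w}

section Levelwise

variable {C : Type u} [Category.{v} C] {E : Type*} [Category* E]

/-- A construction on arrows of `E`, applied objectwise to arrows of functors with values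
in `E`. -/
@[simps]
def objectwise (Φ : Arrow E ⥤ E) : Arrow (C ⥤ E) ⥤ (C ⥤ E) where
  obj f :=
    { obj c := Φ.obj (Arrow.mk (f.hom.app c))
      map {c d} a := Φ.map (Arrow.homMk (u := f.left.map a) (v := f.right.map a)
        (f.hom.naturality a))
      map_id c := by
        rw [← Φ.map_id]; congr 1; ext <;> simp
      map_comp a b := by
        rw [← Φ.map_comp]; congr 1; ext <;> simp }
  map {f g} φ :=
    { app c := Φ.map (Arrow.homMk (u := φ.left.app c) (v := φ.right.app c)
        (congrArg (fun t => NatTrans.app t c) φ.w))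
      naturality c d a := by
        refine (Φ.map_comp _ _).symm.trans (Eq.trans ?_ (Φ.map_comp _ _))
        congr 1
        ext
        · exact φ.left.naturality a
        · exact φ.right.naturality a }
  map_id f := by
    ext c
    refine Eq.trans ?_ (Φ.map_id _); dsimp only; congr 1
  map_comp f g := by
    ext c
    refine Eq.trans ?_ (Φ.map_comp _ _); dsimp only; congr 1

end Levelwise

/-- The smash product with a pointed simplicial set `K`, `(X ∧ K)ₙ = Xₙ ∧ Kₙ`. -/
@[simps]
def smashSSet (K : PtSSet.{w}) : PtSSet.{w} ⥤ PtSSet.{w} where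
  obj X :=
    { obj n := smashObj (X.obj n) (K.obj n)
      map a := smashMap (X.map a) (K.map a)
      map_id n := by simp
      map_comp a b := by simp [smashMap_comp] }
  map f :=
    { app n := smashMap (f.app n) (𝟙 _)
      naturality m n a := by simp [← smashMap_comp] }
  map_comp f g := by
    apply NatTrans.ext; funext n
    exact smashMap_comp (f.app n) (g.app n) (𝟙 (K.obj n)) (𝟙 (K.obj n))

@[simps]
def smashSSetMap {K L : PtSSet.{w}} (g : K ⟶ L) : smashSSet K ⟶ smashSSet L where
  app X :=
    { app n := smashMap (𝟙 (X.obj n)) (g.app n)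
      naturality m n a := by
        refine (smashMap_comp _ _ _ _).symm.trans (Eq.trans ?_ (smashMap_comp _ _ _ _))
        rw [g.naturality, Category.comp_id, Category.id_comp] }
  naturality X Y f := by
    apply NatTrans.ext; funext n
    refine (smashMap_comp _ _ _ _).symm.trans (Eq.trans ?_ (smashMap_comp _ _ _ _))
    simp

/-- The pointed simplicial set `Δ[n]₊`. In particular `stdPlus 0` is the zero sphere. -/
abbrev stdPlus (n : ℕ) : PtSSet.{w} := SSet.stdSimplex.{w}.obj ⦋n⦌ ⋙ typeToPointed

abbrev stdPlusMap {m n : ℕ} (f : (⦋m⦌ : SimplexCategory) ⟶ ⦋n⦌) :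
    stdPlus.{w} m ⟶ stdPlus n :=
  Functor.whiskerRight (SSet.stdSimplex.map f) typeToPointed

def cofiberSSet : Arrow PtSSet.{w} ⥤ PtSSet.{w} := objectwise cofiber₀

def cofiberSSetProj (f : Arrow PtSSet.{w}) : f.right ⟶ cofiberSSet.obj f where
  app n := cofiberProj (Arrow.mk (f.hom.app n))
  naturality m n a := by rfl

/-- The interval `Δ[1]`, pointed at the vertex `1`. -/
def interval : PtSSet.{w} :=
  cofiberSSet.obj (Arrow.mk (stdPlusMap (SimplexCategory.δ (n := 0) 0)))

def toInterval : stdPlus.{w} 1 ⟶ interval :=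
  cofiberSSetProj (Arrow.mk (stdPlusMap (SimplexCategory.δ (n := 0) 0)))

/-- The inclusion of the zero sphere `{0, 1}` into the interval. -/
def endpoints : stdPlus.{w} 0 ⟶ interval.{w} :=
  stdPlusMap (SimplexCategory.δ (n := 0) 1) ≫ toInterval

/-- The simplicial circle `S¹ = Δ[1] / {0, 1}`. -/
def circle : PtSSet.{w} := cofiberSSet.obj (Arrow.mk endpoints)

def intervalToCircle : interval.{w} ⟶ circle := cofiberSSetProj (Arrow.mk endpoints)

instance (n : SimplexCategoryᵒᵖ) : Subsingleton ((SSet.stdSimplex.{w}.obj ⦋0⦌).obj n) := by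
  refine ⟨fun a b => SSet.stdSimplex.objEquiv.injective ?_⟩
  ext i : 3
  exact Subsingleton.elim (α := Fin 1) _ _

lemma endpoints_injective (n : SimplexCategoryᵒᵖ) :
    Function.Injective (endpoints.{w}.app n).toFun := by
  have key : ∀ v : (SSet.stdSimplex.{w}.obj ⦋0⦌).obj n,
      (some ((SSet.stdSimplex.map (SimplexCategory.δ (n := 0) 1)).app n v) : Option _) ∉
        Set.range (Option.map ((SSet.stdSimplex.map (SimplexCategory.δ (n := 0) 0)).app n)) := by
    rintro v ⟨_ | c, hc⟩
    · cases hc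
    · have h1 := Option.some.inj hc
      have h2 := congrArg (fun t => SSet.stdSimplex.objEquiv t) h1
      have h3 := congrArg (fun t : n.unop ⟶ ⦋1⦌ => t.toOrderHom 0) h2
      have h0 : SSet.stdSimplex.objEquiv c = SSet.stdSimplex.objEquiv v :=
        congrArg _ (Subsingleton.elim c v)
      change (SimplexCategory.δ (n := 0) 0).toOrderHom ((SSet.stdSimplex.objEquiv c).toOrderHom 0) =
        (SimplexCategory.δ (n := 0) 1).toOrderHom ((SSet.stdSimplex.objEquiv v).toOrderHom 0) at h3
      have h4 : (SSet.stdSimplex.objEquiv c).toOrderHom 0 = (0 : Fin 1) :=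
        Subsingleton.elim (α := Fin 1) _ _
      have h5 : (SSet.stdSimplex.objEquiv v).toOrderHom 0 = (0 : Fin 1) :=
        Subsingleton.elim (α := Fin 1) _ _
      rw [h4, h5] at h3
      exact absurd h3 (by decide)
  rintro (_ | a) (_ | b) hab
  · rfl
  · rcases mk_collapse_eq.1 hab with h | ⟨-, h⟩
    · cases h
    · exact (key b h).elim
  · rcases mk_collapse_eq.1 hab with h | ⟨h, -⟩
    · cases h
    · exact (key a h).elim
  · rw [Subsingleton.elim a b]

section Presheaves

variable (C : Type u) [Category.{v} C]

/-- `X ↦ X ∧ K` on pointed simplicial presheaves, for `K` a pointed simplicial set. -/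
abbrev smash (K : PtSSet.{w}) : PtSPre.{w} C ⥤ PtSPre.{w} C :=
  (Functor.whiskeringRight _ _ _).obj (smashSSet K)

abbrev smashMapRight {K L : PtSSet.{w}} (g : K ⟶ L) : smash C K ⟶ smash C L :=
  (Functor.whiskeringRight _ _ _).map (smashSSetMap g)

/-- The suspension `X ↦ X ∧ S¹`. -/
abbrev susp : PtSPre.{w} C ⥤ PtSPre.{w} C := smash C circle

/-- The reduced cone `X ↦ X ∧ Δ[1]`. -/
abbrev cone : PtSPre.{w} C ⥤ PtSPre.{w} C := smash C interval

/-- The canonical isomorphism from `X` to `X ∧ S⁰`. -/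
def toSmashSphere : 𝟭 (PtSPre.{w} C) ⟶ smash C (stdPlus 0) where
  app X :=
    { app U :=
        { app n := ⟨fun x => Quotient.mk _ (x, some (SSet.stdSimplex.objEquiv.symm
            (SimplexCategory.const n.unop ⦋0⦌ 0))), Quotient.sound (Or.inr ⟨Or.inl rfl, Or.inl rfl⟩)⟩
          naturality m n a := by
            apply Pointed.Hom.ext; funext x
            exact congrArg (Quotient.mk _) (Prod.ext rfl (congrArg some (Subsingleton.elim _ _))) }
      naturality U V a := by rfl }
  naturality X Y f := by rfl

lemma isIso_of_bijective {X Y : Pointed.{w}} (f : X ⟶ Y) (hf : Function.Bijective f.toFun) :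
    IsIso f :=
  (Pointed.Iso.mk (Equiv.ofBijective _ hf) f.map_point).isIso_hom

instance : IsIso (toSmashSphere.{w} C) := by
  apply +allowSynthFailures NatIso.isIso_of_isIso_app
  intro X
  apply +allowSynthFailures NatIso.isIso_of_isIso_app
  intro U
  apply +allowSynthFailures NatIso.isIso_of_isIso_app
  intro n
  apply isIso_of_bijective
  constructor
  · intro x y hxy
    rcases mk_collapse_eq.1 hxy with h | ⟨h | h, h' | h'⟩
    · exact congrArg Prod.fst h
    · exact h.trans h'.symm
    · cases h'
    · cases h
    · cases h
  · intro z
    induction z using Quotient.inductionOn with | h z =>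
    obtain ⟨x, _ | k⟩ := z
    · exact ⟨((X.obj U).obj n).point, Quotient.sound (Or.inr ⟨Or.inl rfl, Or.inr rfl⟩)⟩
    · exact ⟨x, congrArg (Quotient.mk _) (Prod.ext rfl (congrArg some (Subsingleton.elim _ _)))⟩

/-- The inclusion of `X` as the base of the cone. -/
def coneBase : 𝟭 (PtSPre.{w} C) ⟶ cone C := toSmashSphere C ≫ smashMapRight C endpoints

def coneToSusp : cone.{w} C ⟶ susp C := smashMapRight C intervalToCircle

/-- The one-point presheaf. -/
def pt : PtSPre.{w} C := (Functor.const _).obj ((Functor.const _).obj pt₀)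

variable {C}

def toPt (X : PtSPre.{w} C) : X ⟶ pt C where
  app U := { app n := toPt₀ _ }

def fromPt (X : PtSPre.{w} C) : pt C ⟶ X where
  app U :=
    { app n := fromPt₀ _
      naturality m n a := by
        apply Pointed.Hom.ext; funext x; exact ((X.obj U).map a).map_point.symm }
  naturality U V a := by
    apply NatTrans.ext; funext n
    apply Pointed.Hom.ext; funext x; exact ((X.map a).app n).map_point.symm

variable (C)

/-- The cofiber `X / A` of a morphism `A ⟶ X` of pointed simplicial presheaves. -/
def cofiber : Arrow (PtSPre.{w} C) ⥤ PtSPre.{w} C := objectwise cofiberSSet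

/-- The projection `X ⟶ X / A`. -/
def toCofiber : Arrow.rightFunc ⟶ cofiber.{w} C where
  app f :=
    { app U := cofiberSSetProj (Arrow.mk (f.hom.app U))
      naturality U V a := by rfl }
  naturality f g φ := by rfl

variable {C}

lemma cofiber_isPushout (f : Arrow (PtSPre.{w} C)) :
    IsPushout f.hom (toPt _) ((toCofiber C).app f) (fromPt _) :=
  .of_forall_isPushout_app fun U => .of_forall_isPushout_app fun n =>
    cofiber_isPushout₀ ((f.hom.app U).app n)

lemma smash_isPushout (X : PtSPre.{w} C) {A K : PtSSet.{w}} (f : A ⟶ K) :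
    IsPushout ((smashMapRight C f).app X) (toPt _)
      ((smashMapRight C (cofiberSSetProj (Arrow.mk f))).app X) (fromPt _) :=
  .of_forall_isPushout_app fun U => .of_forall_isPushout_app fun n =>
    smash_isPushout₀ ((X.obj U).obj n) (f.app n)

lemma mono_of_injective {X Y : PtSPre.{w} C} (f : X ⟶ Y)
    (hf : ∀ U n, Function.Injective ((f.app U).app n).toFun) : Mono f := by
  constructor
  intro Z g h e
  apply NatTrans.ext; funext U
  apply NatTrans.ext; funext n
  apply Pointed.Hom.ext; funext x
  exact hf U n (congrFun (congrArg (fun t : Z ⟶ Y => ((t.app U).app n).toFun) e) x)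

end Presheaves

/-! ## Weak equivalences and homotopy categories -/

/-- Weak equivalences of simplicial sets: the maps which induce bijections on homotopy classes
of maps to all Kan complexes. -/
def IsSSetEquiv {X Y : SSet.{w}} (f : X ⟶ Y) : Prop :=
  ∀ (K : SSet.{w}) [SSet.KanComplex K],
    (∀ g : X ⟶ K, ∃ h : Y ⟶ K, Nonempty (SSet.Homotopy (f ≫ h) g)) ∧
    (∀ h h' : Y ⟶ K, Nonempty (SSet.Homotopy (f ≫ h) (f ≫ h')) → Nonempty (SSet.Homotopy h h'))

section HomotopyTheory

variable {C : Type u} [Category.{v} C]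

/-- The functor forgetting base points. -/
abbrev forgetPoints (C : Type u) [Category.{v} C] : PtSPre.{w} C ⥤ (Cᵒᵖ ⥤ SSet.{w}) :=
  (Functor.whiskeringRight _ _ _).obj
    ((Functor.whiskeringRight SimplexCategoryᵒᵖ _ _).obj (forget Pointed.{w}))

/-- The simplicial (local) weak equivalences of pointed simplicial presheaves on a site with
enough points: the maps which are weak equivalences on all stalks. -/
def simplicialEquiv (J : GrothendieckTopology C) : MorphismProperty (PtSPre.{w} C) :=
  fun _ _ f => ∀ Φ : GrothendieckTopology.Point.{w} J,
    IsSSetEquiv (Φ.presheafFiber.map ((forgetPoints C).map f))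

/-- Classes of morphisms of pointed simplicial presheaves which contain the simplicial weak
equivalences and the class `S`, and which have the closure properties of the weak equivalences
of a left Bousfield localization. -/
structure IsLocalizingClass (J : GrothendieckTopology C) (S W : MorphismProperty (PtSPre.{w} C)) :
    Prop where
  simplicial : simplicialEquiv J ≤ W
  le : S ≤ W
  twoOutOfThree : W.HasTwoOutOfThreeProperty
  /-- The projections `X ∧ Δ[1]₊ ⟶ X ∧ S⁰ = X` of cylinders. (These are simplicial homotopy
  equivalences, so in particular simplicial weak equivalences.) -/
  cylinder (X : PtSPre.{w} C) :
    W ((smashMapRight C (stdPlusMap (SimplexCategory.σ (n := 0) 0))).app X)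
  /-- The gluing lemma: stability under homotopy pushouts. -/
  gluing {X₁ X₂ X₃ X₄ Y₁ Y₂ Y₃ Y₄ : PtSPre.{w} C}
    {i : X₁ ⟶ X₂} {f : X₁ ⟶ X₃} {f' : X₂ ⟶ X₄} {i' : X₃ ⟶ X₄}
    {j : Y₁ ⟶ Y₂} {g : Y₁ ⟶ Y₃} {g' : Y₂ ⟶ Y₄} {j' : Y₃ ⟶ Y₄}
    (hX : IsPushout i f f' i') (hY : IsPushout j g g' j') (hi : Mono i) (hj : Mono j)
    {w₁ : X₁ ⟶ Y₁} {w₂ : X₂ ⟶ Y₂} {w₃ : X₃ ⟶ Y₃} {w₄ : X₄ ⟶ Y₄}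
    (h₁₂ : i ≫ w₂ = w₁ ≫ j) (h₁₃ : f ≫ w₃ = w₁ ≫ g)
    (h₂₄ : f' ≫ w₄ = w₂ ≫ g') (h₃₄ : i' ≫ w₄ = w₃ ≫ j')
    (h₁ : W w₁) (h₂ : W w₂) (h₃ : W w₃) : W w₄
  filteredColimits : MorphismProperty.IsStableUnderFilteredColimits.{w, w} W
  coproducts : MorphismProperty.IsStableUnderCoproducts.{w} W

/-- The weak equivalences of the left Bousfield localization at `S` of the local homotopy theory
of pointed simplicial presheaves on the site `(C, J)`: the smallest class as above. -/
def localizedEquiv (J : GrothendieckTopology C) (S : MorphismProperty (PtSPre.{w} C)) :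
    MorphismProperty (PtSPre.{w} C) :=
  fun _ _ f => ∀ W : MorphismProperty (PtSPre.{w} C), IsLocalizingClass J S W → W f

variable (J : GrothendieckTopology C) (S : MorphismProperty (PtSPre.{w} C))

lemma localizedEquiv_isLocalizingClass : IsLocalizingClass J S (localizedEquiv J S) where
  simplicial _ _ f hf _ hW := hW.simplicial f hf
  le _ _ f hf _ hW := hW.le f hf
  twoOutOfThree :=
    { comp_mem := fun f g hf hg W hW =>
        have := hW.twoOutOfThree; W.comp_mem f g (hf W hW) (hg W hW)
      of_postcomp := fun f g hg hfg W hW =>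
        have := hW.twoOutOfThree; W.of_postcomp f g (hg W hW) (hfg W hW)
      of_precomp := fun f g hf hfg W hW =>
        have := hW.twoOutOfThree; W.of_precomp f g (hf W hW) (hfg W hW) }
  cylinder X _ hW := hW.cylinder X
  gluing hX hY hi hj _ _ _ _ e₁ e₂ e₃ e₄ h₁ h₂ h₃ W hW :=
    hW.gluing hX hY hi hj e₁ e₂ e₃ e₄ (h₁ W hW) (h₂ W hW) (h₃ W hW)
  filteredColimits := ⟨fun _ _ _ => ⟨fun X₁ X₂ c₁ c₂ h₁ h₂ f hf φ hφ W hW =>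
    have := hW.filteredColimits
    MorphismProperty.IsStableUnderColimitsOfShape.condition X₁ X₂ c₁ c₂ h₁ h₂ f
      (fun j => hf j W hW) φ hφ⟩⟩
  coproducts := ⟨fun _ => ⟨fun X₁ X₂ c₁ c₂ h₁ h₂ f hf φ hφ W hW =>
    have := hW.coproducts
    MorphismProperty.IsStableUnderColimitsOfShape.condition X₁ X₂ c₁ c₂ h₁ h₂ f
      (fun j => hf j W hW) φ hφ⟩⟩

/-- The pointed homotopy category: weak equivalences are inverted. -/
abbrev Ho := (localizedEquiv J S).Localization

/-- The functor from pointed simplicial presheaves to the pointed homotopy category. -/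
abbrev toHo : PtSPre.{w} C ⥤ Ho J S := (localizedEquiv J S).Q

lemma isSSetEquiv_of_isIso {X Y : SSet.{w}} (f : X ⟶ Y) [IsIso f] : IsSSetEquiv f := by
  intro K _
  refine ⟨fun g => ⟨inv f ≫ g, ⟨SSet.RelativeMorphism.Homotopy.ofEq (by simp)⟩⟩, ?_⟩
  rintro h h' ⟨H⟩
  have H' : SSet.Homotopy (inv f ≫ f ≫ h) (inv f ≫ f ≫ h') :=
    SSet.RelativeMorphism.Homotopy.precomp H (SSet.RelativeMorphism.botEquiv.symm (inv f))
      (Limits.IsInitial.hom_ext SSet.Subcomplex.isInitialBot _ _)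
  rw [IsIso.inv_hom_id_assoc, IsIso.inv_hom_id_assoc] at H'
  exact ⟨H'⟩

lemma toPt_unique {X : PtSPre.{w} C} (f g : X ⟶ pt C) : f = g := by
  apply NatTrans.ext; funext U
  apply NatTrans.ext; funext n
  apply Pointed.Hom.ext; funext x
  exact Subsingleton.elim (α := PUnit) _ _

lemma fromPt_unique {X : PtSPre.{w} C} (f g : pt C ⟶ X) : f = g := by
  apply NatTrans.ext; funext U
  apply NatTrans.ext; funext n
  apply Pointed.Hom.ext; funext x
  exact ((f.app U).app n).map_point.trans ((g.app U).app n).map_point.symm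

instance (X : PtSPre.{w} C) : Mono ((coneBase C).app X) := by
  change Mono ((toSmashSphere C).app X ≫ (smashMapRight C endpoints).app X)
  have : Mono ((smashMapRight C endpoints.{w}).app X) :=
    mono_of_injective _ fun U n => smash_injective _ _ (endpoints_injective n)
  infer_instance

lemma vertex_injective (n : SimplexCategoryᵒᵖ) : Function.Injective
    ((stdPlusMap.{w} (SimplexCategory.δ (n := 0) 0)).app n).toFun :=
  Option.map_injective fun a b _ => Subsingleton.elim a b

/-- The homotopy cofiber `X ∪ (A ∧ Δ[1])` of a morphism `A ⟶ X`. -/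
def hocofibObj (f : Arrow (PtSPre.{w} C)) : PtSPre.{w} C :=
  pushout f.hom ((coneBase C).app f.left)

def hocofibInl (f : Arrow (PtSPre.{w} C)) : f.right ⟶ hocofibObj f := pushout.inl _ _

def hocofibInr (f : Arrow (PtSPre.{w} C)) : (cone C).obj f.left ⟶ hocofibObj f := pushout.inr _ _

lemma hocofib_isPushout (f : Arrow (PtSPre.{w} C)) :
    IsPushout f.hom ((coneBase C).app f.left) (hocofibInl f) (hocofibInr f) :=
  IsPushout.of_hasPushout _ _

/-- The homotopy cofiber as a functor on arrows. -/
def hocofib (C : Type u) [Category.{v} C] : Arrow (PtSPre.{w} C) ⥤ PtSPre.{w} C where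
  obj f := hocofibObj f
  map {f g} φ := (hocofib_isPushout f).desc (φ.right ≫ hocofibInl g)
    ((cone C).map φ.left ≫ hocofibInr g) (by
      have h1 : φ.left ≫ (coneBase C).app g.left = (coneBase C).app f.left ≫ (cone C).map φ.left :=
        (coneBase C).naturality φ.left
      have h2 : φ.left ≫ g.hom = f.hom ≫ φ.right := φ.w
      rw [← Category.assoc, ← Category.assoc, ← h1, ← h2, Category.assoc, Category.assoc,
        (hocofib_isPushout g).w])
  map_id f := by
    apply (hocofib_isPushout f).hom_ext
    · rw [IsPushout.inl_desc, Category.comp_id]; exact Category.id_comp _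
    · rw [IsPushout.inr_desc, Category.comp_id]
      refine (congrArg (· ≫ hocofibInr f) ((cone C).map_id f.left)).trans (Category.id_comp _)
  map_comp f g := by
    apply (hocofib_isPushout _).hom_ext
    · rw [IsPushout.inl_desc, IsPushout.inl_desc_assoc, Category.assoc, IsPushout.inl_desc]
      exact Category.assoc _ _ _
    · rw [IsPushout.inr_desc, IsPushout.inr_desc_assoc, Category.assoc, IsPushout.inr_desc]
      refine (congrArg (· ≫ hocofibInr _) ((cone C).map_comp f.left g.left)).trans
        (Category.assoc _ _ _)

lemma hocofib_map_desc {f g : Arrow (PtSPre.{w} C)} (φ : f ⟶ g) {T T' : PtSPre.{w} C} (t : T ⟶ T')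
    {a : f.right ⟶ T} {b : (cone C).obj f.left ⟶ T} (h : f.hom ≫ a = (coneBase C).app f.left ≫ b)
    {a' : g.right ⟶ T'} {b' : (cone C).obj g.left ⟶ T'}
    (h' : g.hom ≫ a' = (coneBase C).app g.left ≫ b')
    (ha : φ.right ≫ a' = a ≫ t) (hb : (cone C).map φ.left ≫ b' = b ≫ t) :
    (hocofib C).map φ ≫ (hocofib_isPushout g).desc a' b' h' =
      (hocofib_isPushout f).desc a b h ≫ t := by
  apply (hocofib_isPushout _).hom_ext
  · dsimp only [hocofib]
    rw [IsPushout.inl_desc_assoc, Category.assoc, IsPushout.inl_desc, IsPushout.inl_desc_assoc, ha]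
  · dsimp only [hocofib]
    rw [IsPushout.inr_desc_assoc, Category.assoc, IsPushout.inr_desc, IsPushout.inr_desc_assoc, hb]

lemma comp_toPt_fromPt {X Y Z T : PtSPre.{w} C} (f : X ⟶ Y) (g : Z ⟶ T) :
    f ≫ toPt Y ≫ fromPt T = (toPt X ≫ fromPt Z) ≫ g := by
  rw [← Category.assoc, toPt_unique (f ≫ toPt Y) (toPt X), Category.assoc,
    fromPt_unique (fromPt Z ≫ g) (fromPt T)]

/-- The map from the homotopy cofiber to the cofiber which collapses the cone. -/
def hocofibToCofiber (C : Type u) [Category.{v} C] : hocofib.{w} C ⟶ cofiber C where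
  app f := (hocofib_isPushout f).desc (W := (cofiber C).obj f) ((toCofiber C).app f)
    (toPt _ ≫ fromPt _) (by
      rw [(cofiber_isPushout f).w]
      rfl)
  naturality f g φ := hocofib_map_desc φ _ _ _ ((toCofiber C).naturality φ)
    (comp_toPt_fromPt _ _)

/-- The map from the homotopy cofiber of `A ⟶ X` to `A ∧ S¹` which collapses `X`. -/
def hocofibToSusp (C : Type u) [Category.{v} C] :
    hocofib.{w} C ⟶ Arrow.leftFunc ⋙ susp C where
  app f := (hocofib_isPushout f).desc (W := (susp C).obj f.left) (toPt _ ≫ fromPt _)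
    ((coneToSusp C).app f.left) (by
      have := (smash_isPushout f.left endpoints.{w}).w
      dsimp only [coneBase, NatTrans.comp_app]
      refine Eq.trans ?_ ((congrArg ((toSmashSphere C).app f.left ≫ ·) this.symm).trans
        (Category.assoc _ _ _).symm)
      rfl)
  naturality f g φ := hocofib_map_desc φ _ _ _ (comp_toPt_fromPt _ _)
    ((coneToSusp C).naturality φ.left)

variable {J S}

lemma IsLocalizingClass.of_isIso {W : MorphismProperty (PtSPre.{w} C)}
    (hW : IsLocalizingClass J S W) {X Y : PtSPre.{w} C} (f : X ⟶ Y) [IsIso f] : W f :=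
  hW.simplicial _ fun _ => isSSetEquiv_of_isIso _

lemma IsLocalizingClass.cone_contractible {W : MorphismProperty (PtSPre.{w} C)}
    (hW : IsLocalizingClass J S W) (X : PtSPre.{w} C) : W (toPt ((cone C).obj X)) := by
  refine hW.gluing (smash_isPushout X (stdPlusMap (SimplexCategory.δ (n := 0) 0)))
    (IsPushout.of_horiz_isIso (f := 𝟙 ((smash C (stdPlus 0)).obj X)) (g := toPt _) (inl := toPt _)
      (inr := 𝟙 (pt C)) ⟨toPt_unique _ _⟩)
    (mono_of_injective _ fun U n => smash_injective _ _ (vertex_injective n)) inferInstance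
    (w₁ := 𝟙 _) (w₂ := (smashMapRight C (stdPlusMap (SimplexCategory.σ (n := 0) 0))).app X)
    (w₃ := 𝟙 _) ?_ (toPt_unique _ _) (toPt_unique _ _) (toPt_unique _ _)
    (hW.of_isIso _) (hW.cylinder X) (hW.of_isIso _)
  apply NatTrans.ext; funext U
  apply NatTrans.ext; funext n
  apply Pointed.Hom.ext; funext x
  induction x using Quotient.inductionOn with | h x =>
  obtain ⟨x, _ | k⟩ := x
  · rfl
  · exact congrArg (Quotient.mk _) (Prod.ext rfl (congrArg some (Subsingleton.elim _ _)))

lemma IsLocalizingClass.cone_map {W : MorphismProperty (PtSPre.{w} C)}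
    (hW : IsLocalizingClass J S W) {X Y : PtSPre.{w} C} (f : X ⟶ Y) : W ((cone C).map f) := by
  have := hW.twoOutOfThree
  refine W.of_postcomp _ (toPt _) (hW.cone_contractible Y) ?_
  rw [toPt_unique ((cone C).map f ≫ toPt _) (toPt _)]
  exact hW.cone_contractible X

lemma IsLocalizingClass.susp_map {W : MorphismProperty (PtSPre.{w} C)}
    (hW : IsLocalizingClass J S W) {X Y : PtSPre.{w} C} (f : X ⟶ Y) (hf : W f) :
    W ((susp C).map f) := by
  have := hW.twoOutOfThree
  have hS : W ((smash C (stdPlus 0)).map f) := by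
    refine W.of_precomp ((toSmashSphere C).app X) _ (hW.of_isIso _) ?_
    rw [← (toSmashSphere C).naturality f]
    exact W.comp_mem _ _ hf (hW.of_isIso _)
  have hm : ∀ Z : PtSPre.{w} C, Mono ((smashMapRight C endpoints.{w}).app Z) := fun Z =>
    mono_of_injective _ fun U n => smash_injective _ _ (endpoints_injective n)
  exact hW.gluing (smash_isPushout X endpoints) (smash_isPushout Y endpoints) (hm X) (hm Y)
    (w₁ := (smash C (stdPlus 0)).map f) (w₂ := (cone C).map f) (w₃ := 𝟙 _)
    ((smashMapRight C endpoints).naturality f).symm (toPt_unique _ _)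
    ((smashMapRight C intervalToCircle).naturality f).symm (fromPt_unique _ _)
    hS (hW.cone_map f) (hW.of_isIso _)

lemma IsLocalizingClass.hocofibToCofiber {W : MorphismProperty (PtSPre.{w} C)}
    (hW : IsLocalizingClass J S W) (f : Arrow (PtSPre.{w} C)) (hf : Mono f.hom) :
    W ((hocofibToCofiber C).app f) :=
  hW.gluing (hocofib_isPushout f) (cofiber_isPushout f) hf hf
    (w₁ := 𝟙 _) (w₂ := 𝟙 _) (w₃ := toPt _) (by simp) (toPt_unique _ _)
    (((hocofib_isPushout f).inl_desc _ _ _).trans (Category.id_comp _).symm)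
    ((hocofib_isPushout f).inr_desc _ _ _)
    (hW.of_isIso _) (hW.of_isIso _) (hW.cone_contractible _)

variable (J S)

/-- The suspension `- ∧ S¹` on the pointed homotopy category. -/
def suspHo : Ho J S ⥤ Ho J S :=
  Localization.Construction.lift (susp C ⋙ toHo J S) fun _ _ f hf =>
    (localizedEquiv J S).Q_inverts _ ((localizedEquiv_isLocalizingClass J S).susp_map f hf)

/-- Suspension of pointed simplicial presheaves induces the suspension on the homotopy
category. -/
def suspHoIso : susp C ⋙ toHo J S ≅ toHo J S ⋙ suspHo J S :=
  eqToIso (Localization.Construction.fac _ _).symm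

end HomotopyTheory

/-! ## Pro-objects -/

/-- A pro-object of `H`: a small cofiltered diagram. -/
structure Pro (H : Type u) [Category.{v} H] : Type (max u v (w + 1)) where
  index : Type w
  [smallCategory : SmallCategory index]
  [isCofiltered : IsCofiltered index]
  diagram : index ⥤ H

namespace Pro

attribute [instance] smallCategory isCofiltered

variable {H : Type u} [Category.{v} H]

/-- The colimit over `i` of the sets of morphisms from `P i` to `T`. -/
def Germ (P : Pro.{w} H) (T : H) : Type (max w v) :=
  Quot fun (a b : Σ i, P.diagram.obj i ⟶ T) =>
    ∃ g : b.1 ⟶ a.1, b.2 = P.diagram.map g ≫ a.2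

namespace Germ

variable {P : Pro.{w} H}

def mk {T : H} (i : P.index) (f : P.diagram.obj i ⟶ T) : P.Germ T := Quot.mk _ ⟨i, f⟩

lemma mk_map {T : H} {i j : P.index} (g : j ⟶ i) (f : P.diagram.obj i ⟶ T) :
    mk j (P.diagram.map g ≫ f) = mk i f :=
  (Quot.sound ⟨g, rfl⟩).symm

lemma ind {T : H} {p : P.Germ T → Prop} (h : ∀ i f, p (mk i f)) (x : P.Germ T) : p x :=
  Quot.ind (fun a => h a.1 a.2) x

/-- Composition of a germ with a morphism. -/
def postcomp {T T' : H} (x : P.Germ T) (h : T ⟶ T') : P.Germ T' :=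
  Quot.map (fun a => ⟨a.1, a.2 ≫ h⟩)
    (by rintro a b ⟨g, hg⟩; exact ⟨g, by rw [hg, Category.assoc]⟩) x

@[simp] lemma postcomp_mk {T T' : H} (i : P.index) (f : P.diagram.obj i ⟶ T) (h : T ⟶ T') :
    (mk i f).postcomp h = mk i (f ≫ h) := rfl

lemma postcomp_id {T : H} (x : P.Germ T) : x.postcomp (𝟙 T) = x := by
  induction x using ind with | h i f => simp

lemma postcomp_comp {T T' T'' : H} (x : P.Germ T) (h : T ⟶ T') (h' : T' ⟶ T'') :
    x.postcomp (h ≫ h') = (x.postcomp h).postcomp h' := by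
  induction x using ind with | h i f => simp

end Germ

/-- A morphism of pro-objects `P ⟶ Q`: an element of `lim_j colim_i Hom (P i, Q j)`. -/
@[ext]
structure Hom (P Q : Pro.{w} H) : Type (max w v) where
  germ (j : Q.index) : P.Germ (Q.diagram.obj j)
  germ_map {j j' : Q.index} (g : j ⟶ j') : (germ j).postcomp (Q.diagram.map g) = germ j'

/-- The composition of a morphism of pro-objects with a germ. -/
def Hom.precomp {P Q : Pro.{w} H} (φ : Hom P Q) {T : H} (x : Q.Germ T) : P.Germ T :=
  Quot.lift (fun a => (φ.germ a.1).postcomp a.2) (by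
    rintro a b ⟨g, hg⟩
    rw [hg, Germ.postcomp_comp, φ.germ_map]) x

@[simp] lemma Hom.precomp_mk {P Q : Pro.{w} H} (φ : Hom P Q) {T : H} (j : Q.index)
    (f : Q.diagram.obj j ⟶ T) : φ.precomp (Germ.mk j f) = (φ.germ j).postcomp f := rfl

lemma Hom.precomp_postcomp {P Q : Pro.{w} H} (φ : Hom P Q) {T T' : H} (x : Q.Germ T)
    (h : T ⟶ T') : φ.precomp (x.postcomp h) = (φ.precomp x).postcomp h := by
  induction x using Germ.ind with | h j f => simp [Germ.postcomp_comp]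

instance : Category (Pro.{w} H) where
  Hom := Hom
  id P :=
    { germ j := Germ.mk j (𝟙 _)
      germ_map g := by simpa using Germ.mk_map g (𝟙 _) }
  comp φ ψ :=
    { germ k := φ.precomp (ψ.germ k)
      germ_map g := by rw [← Hom.precomp_postcomp, ψ.germ_map] }
  id_comp φ := by
    ext k
    dsimp only
    generalize φ.germ k = x
    induction x using Germ.ind with | h j f => simp
  comp_id φ := by
    ext k
    simp [Germ.postcomp_id]
  assoc φ ψ χ := by
    ext k
    dsimp only
    generalize χ.germ k = x
    induction x using Germ.ind with | h j f => simp [Hom.precomp_postcomp]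

lemma id_germ (P : Pro.{w} H) (j : P.index) : Hom.germ (𝟙 P) j = Germ.mk j (𝟙 _) := rfl

lemma comp_germ {P Q R : Pro.{w} H} (φ : P ⟶ Q) (ψ : Q ⟶ R) (k : R.index) :
    Hom.germ (φ ≫ ψ) k = φ.precomp (ψ.germ k) := rfl

lemma hom_ext {P Q : Pro.{w} H} {φ ψ : P ⟶ Q} (h : ∀ j, Hom.germ φ j = Hom.germ ψ j) : φ = ψ :=
  Hom.ext (funext h)

/-- A diagram as a pro-object. -/
abbrev of {I : Type w} [SmallCategory I] [IsCofiltered I] (F : I ⥤ H) : Pro.{w} H where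
  index := I
  diagram := F

section Level

variable {I : Type w} [SmallCategory I] [IsCofiltered I]

/-- The morphism of pro-objects given by a natural transformation. -/
def ofNatTrans {F G : I ⥤ H} (α : F ⟶ G) : of F ⟶ of G :=
  Hom.mk (P := of F) (Q := of G) (fun i => Germ.mk (P := of F) i (α.app i)) (by
    intro i j g
    have h := Germ.mk_map (P := of F) g (α.app j)
    simpa using h)

/-- The canonical morphism of pro-objects from a diagram to its restriction along a functor. -/
def reindex {I' : Type w} [SmallCategory I'] [IsCofiltered I'] (r : I' ⥤ I) (F : I ⥤ H) :
    of F ⟶ of (r ⋙ F) :=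
  Hom.mk (P := of F) (Q := of (r ⋙ F)) (fun i => Germ.mk (P := of F) (r.obj i) (𝟙 _)) (by
    intro i j g
    have h := Germ.mk_map (P := of F) (r.map g) (𝟙 _)
    simpa using h)

end Level

section Map

variable {H' : Type*} [Category* H'] (Φ : H ⥤ H')

def Germ.map {P : Pro.{w} H} {T : H} (x : P.Germ T) : (of (P.diagram ⋙ Φ)).Germ (Φ.obj T) :=
  Quot.map (fun a => ⟨a.1, Φ.map a.2⟩)
    (by rintro a b ⟨g, hg⟩; exact ⟨g, by rw [hg, Φ.map_comp]; rfl⟩) x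

lemma Germ.map_postcomp {P : Pro.{w} H} {T T' : H} (x : P.Germ T) (h : T ⟶ T') :
    (x.postcomp h).map Φ = (x.map Φ).postcomp (Φ.map h) := by
  induction x using Germ.ind with | h i f =>
  exact congrArg (Germ.mk (P := of (P.diagram ⋙ Φ)) i) (Φ.map_comp _ _)

/-- The functor on pro-objects induced by a functor. -/
def map : Pro.{w} H ⥤ Pro.{w} H' where
  obj P := of (P.diagram ⋙ Φ)
  map {P Q} φ := Hom.mk (P := of (P.diagram ⋙ Φ)) (Q := of (Q.diagram ⋙ Φ))
    (fun j => (φ.germ j).map Φ) (fun {i j} g => by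
      rw [← φ.germ_map g]
      exact (Germ.map_postcomp Φ _ _).symm)
  map_id P := by
    apply hom_ext
    intro j
    exact congrArg (Germ.mk (P := of (P.diagram ⋙ Φ)) j) (Φ.map_id _)
  map_comp {P Q R} φ ψ := by
    apply hom_ext
    intro k
    rw [comp_germ]
    dsimp only
    rw [comp_germ]
    generalize ψ.germ k = x
    induction x using Germ.ind with | h j f =>
    exact Germ.map_postcomp Φ _ _

end Map

end Pro

/-! ## The motivic homotopy category -/

open AlgebraicGeometry TopologicalSpace

section Motivic

/-- The category `Sm_B` of smooth `B`-schemes. -/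
abbrev Sm (B : Scheme.{u}) :=
  ObjectProperty.FullSubcategory fun U : Over B => Smooth U.hom

/-- The underlying scheme of a smooth `B`-scheme. -/
abbrev Sm.scheme {B : Scheme.{u}} (U : Sm B) : Scheme.{u} := U.obj.left

/-- The underlying morphism of schemes of a morphism of smooth `B`-schemes. -/
abbrev Sm.schemeHom {B : Scheme.{u}} {U V : Sm B} (f : U ⟶ V) : U.scheme ⟶ V.scheme := f.hom.left

/-- A smooth morphism `U ⟶ B` as an object of `Sm_B`. -/
abbrev Sm.mk {B U : Scheme.{u}} (f : U ⟶ B) (hf : Smooth f) : Sm B := ⟨Over.mk f, hf⟩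

/-- A morphism in `Sm_B`, from a morphism of schemes over `B`. -/
abbrev Sm.homMk {B : Scheme.{u}} {U V : Sm B} (f : U.scheme ⟶ V.scheme)
    (w : f ≫ V.obj.hom = U.obj.hom) : U ⟶ V := ObjectProperty.homMk (Over.homMk f w)

/-- The Nisnevich coverings of a smooth `B`-scheme `U`: the families of étale morphisms `V ⟶ U`
such that each point of `U` lifts to a point of some `V` with the same residue field. -/
def nisnevichPrecoverage (B : Scheme.{u}) : Precoverage (Sm B) where
  coverings U := Set.ofPred fun R : Presieve U =>
    (∀ ⦃V : Sm B⦄ (f : V ⟶ U), R f → Etale (Sm.schemeHom f)) ∧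
    ∀ x : U.scheme, ∃ (V : Sm B) (f : V ⟶ U) (_ : R f) (v : V.scheme),
      Sm.schemeHom f v = x ∧ IsIso ((Sm.schemeHom f).residueFieldMap v)

/-- The Nisnevich topology on `Sm_B`. -/
def nisnevich (B : Scheme.{u}) : GrothendieckTopology (Sm B) :=
  (nisnevichPrecoverage B).toGrothendieck

/-- The pointed presheaf `U₊` represented by a smooth `B`-scheme `U`, as a discrete pointed
simplicial presheaf. -/
def plus (B : Scheme.{u}) : Sm B ⥤ PtSPre.{u + 1} (Sm B) :=
  uliftYoneda.{u + 1} ⋙ (Functor.whiskeringRight _ _ _).obj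
    (typeToPointed ⋙ Functor.const SimplexCategoryᵒᵖ)

instance affineSpace_smooth (U : Scheme.{u}) : Smooth (𝔸(PUnit.{u + 1}; U) ↘ U) := by
  have h0 : Smooth (terminal.from
      (Spec (CommRingCat.of (MvPolynomial PUnit.{u + 1} (ULift.{u} ℤ))))) := by
    have := isIso_of_isTerminal specULiftZIsTerminal.{u} terminalIsTerminal (terminal.from _)
    have h1 : Algebra.Smooth (ULift.{u} ℤ) (MvPolynomial PUnit.{u + 1} (ULift.{u} ℤ)) :=
      ⟨inferInstance, inferInstance⟩
    have h2 : Smooth (Spec.map (CommRingCat.ofHom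
        (MvPolynomial.C (σ := PUnit.{u + 1}) (R := ULift.{u} ℤ)))) :=
      (HasRingHomProperty.Spec_iff (P := @Smooth)).2 (RingHom.smooth_algebraMap.2 h1)
    rw [← terminal.comp_from (Spec.map (CommRingCat.ofHom MvPolynomial.C))]
    infer_instance
  exact inferInstanceAs (Smooth (pullback.fst (terminal.from U) (terminal.from
    (Spec (CommRingCat.of (MvPolynomial PUnit.{u + 1} (ULift.{u} ℤ)))))))

/-- The affine line over a smooth `B`-scheme `U`. -/
def affineLine {B : Scheme.{u}} (U : Sm B) : Sm B :=
  Sm.mk ((𝔸(PUnit.{u + 1}; U.scheme) ↘ U.scheme) ≫ U.obj.hom)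
    (have : Smooth U.obj.hom := U.property; inferInstance)

/-- The projection of the affine line. -/
def affineLineProj {B : Scheme.{u}} (U : Sm B) : affineLine U ⟶ U :=
  Sm.homMk (𝔸(PUnit.{u + 1}; U.scheme) ↘ U.scheme) rfl

/-- The projections `(𝔸¹ × U)₊ ⟶ U₊`. -/
def affineLineProjections (B : Scheme.{u}) : MorphismProperty (PtSPre.{u + 1} (Sm B)) :=
  MorphismProperty.ofHoms fun U : Sm B => (plus B).map (affineLineProj U)

/-- The pointed motivic homotopy category of Morel and Voevodsky over `B`. -/
abbrev MotivicHo (B : Scheme.{u}) := Ho (nisnevich B) (affineLineProjections B)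

abbrev toMotivicHo (B : Scheme.{u}) : PtSPre.{u + 1} (Sm B) ⥤ MotivicHo B :=
  toHo (nisnevich B) (affineLineProjections B)

/-- The functor `- ∧ S¹` on the pointed motivic homotopy category. -/
abbrev motivicSusp (B : Scheme.{u}) : MotivicHo B ⥤ MotivicHo B :=
  suspHo (nisnevich B) (affineLineProjections B)

end Motivic

/-! ## Local schemes modulo punctured local schemes, and boundary maps -/

section Local

variable {B X : Scheme.{u}} (p : X ⟶ B) [Smooth p]

/-- The open subschemes of a smooth `B`-scheme, as smooth `B`-schemes. -/
def openSm : X.Opens ⥤ Sm B where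
  obj U := Sm.mk (U.ι ≫ p) inferInstance
  map {U V} i := Sm.homMk (X.homOfLE i.le) (by
    change X.homOfLE i.le ≫ V.ι ≫ p = U.ι ≫ p
    rw [← Category.assoc, X.homOfLE_ι])
  map_id U := by
    apply ObjectProperty.hom_ext
    apply Over.OverMorphism.ext
    exact X.homOfLE_rfl U
  map_comp {U V W} i j := by
    apply ObjectProperty.hom_ext
    apply Over.OverMorphism.ext
    exact (X.homOfLE_homOfLE i.le j.le).symm

/-- The open complement `U - \overline{z}` of the closure of a point, for `U` open. -/
def minus (z : X) : X.Opens ⥤ X.Opens where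
  obj U := U ⊓ (Closeds.closure {z}).compl
  map i := homOfLE (inf_le_inf_right _ i.le)

/-- The functor sending an open subset `U` of `X` to the arrow `(U - \overline{z})₊ ⟶ U₊`. -/
def complementPair (z : X) : X.Opens ⥤ Arrow (PtSPre.{u + 1} (Sm B)) where
  obj U := Arrow.mk ((plus B).map ((openSm p).map (homOfLE inf_le_left : (minus z).obj U ⟶ U)))
  map {U V} i := Arrow.homMk (u := (plus B).map ((openSm p).map ((minus z).map i)))
    (v := (plus B).map ((openSm p).map i)) (by
      dsimp only [Arrow.mk_hom]
      rw [← Functor.map_comp, ← Functor.map_comp, ← Functor.map_comp, ← Functor.map_comp]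
      rfl)
  map_id U := by
    ext1
    · exact (congrArg _ ((openSm p).map_id _)).trans ((plus B).map_id _)
    · exact (congrArg _ ((openSm p).map_id _)).trans ((plus B).map_id _)
  map_comp i j := by
    ext1
    · exact (congrArg _ ((openSm p).map_comp _ _)).trans ((plus B).map_comp _ _)
    · exact (congrArg _ ((openSm p).map_comp _ _)).trans ((plus B).map_comp _ _)

/-- The quotients `U / (U - \overline{z})`, for `U` open in `X`. -/
def quot (z : X) : X.Opens ⥤ PtSPre.{u + 1} (Sm B) := complementPair p z ⋙ cofiber _

lemma complementPair_mono (z : X) (U : X.Opens) : Mono ((complementPair p z).obj U).hom := by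
  refine mono_of_injective _ fun V _ => Option.map_injective fun a b hab => ?_
  have hab' := congrArg (fun t => (ULift.down t).hom.left) hab
  apply ULift.ext
  apply ObjectProperty.hom_ext
  apply Over.OverMorphism.ext
  exact (cancel_mono (X.homOfLE (inf_le_left : (minus z).obj U ≤ U))).1 hab'

/-- The pro-object `X_x / (X_x - x)` of the motivic homotopy category: the diagram of the quotients
`U / (U - \overline{x})`, where `U` runs through the open neighbourhoods of `x`. -/
def localQuot (x : X) : Pro.{u} (MotivicHo B) :=
  Pro.of (OpenNhds.inclusion x ⋙ quot p x ⋙ toMotivicHo B)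

/-- The pro-object `(X_x - x) / (X_x - \overline{y}_x)`: the diagram of the quotients
`(U - \overline{x}) / (U - \overline{x} - \overline{y})`, where `U` runs through the open
neighbourhoods of `x`. -/
def puncturedQuot (x y : X) : Pro.{u} (MotivicHo B) :=
  Pro.of (OpenNhds.inclusion x ⋙ minus x ⋙ quot p y ⋙ toMotivicHo B)

/-- The maps `U ∪ Cone (U - \overline{x}) ⟶ (U - \overline{x}) ∧ S¹ ⟶
(U - \overline{x}) / (U - \overline{x} - \overline{y}) ∧ S¹`. -/
def preConnecting (x y : X) :
    complementPair p x ⋙ hocofib _ ⟶ minus x ⋙ quot p y ⋙ susp (Sm B) :=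
  (Functor.whiskerLeft (complementPair p x) (hocofibToSusp (Sm B)) :
    complementPair p x ⋙ hocofib _ ⟶ complementPair p x ⋙ Arrow.leftFunc ⋙ susp (Sm B)) ≫
  (Functor.whiskerRight (Functor.whiskerLeft (minus x ⋙ complementPair p y) (toCofiber (Sm B)))
    (susp (Sm B)) :
    (minus x ⋙ complementPair p y ⋙ Arrow.rightFunc) ⋙ susp (Sm B) ⟶
      (minus x ⋙ quot p y) ⋙ susp (Sm B))

/-- In the homotopy category, the homotopy cofiber of `U - \overline{x} ⟶ U` is the cofiber. -/
def collapseHo (x : X) : (complementPair p x ⋙ hocofib _) ⋙ toMotivicHo B ⟶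
    quot p x ⋙ toMotivicHo B :=
  Functor.whiskerRight (Functor.whiskerLeft (complementPair p x) (hocofibToCofiber (Sm B)))
    (toMotivicHo B)

instance (x : X) : IsIso (collapseHo p x) := by
  apply +allowSynthFailures NatIso.isIso_of_isIso_app
  intro U
  exact (localizedEquiv _ _).Q_inverts _ ((localizedEquiv_isLocalizingClass _ _).hocofibToCofiber
    ((complementPair p x).obj U) (complementPair_mono p x U))

/-- The connecting morphisms `U / (U - \overline{x}) ⟶
(U - \overline{x}) / (U - \overline{x} - \overline{y}) ∧ S¹` of the triples
`U - \overline{x} - \overline{y} ⊆ U - \overline{x} ⊆ U`. -/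
def connectingHo (x y : X) : quot p x ⋙ toMotivicHo B ⟶
    (minus x ⋙ quot p y ⋙ toMotivicHo B) ⋙ motivicSusp B :=
  inv (collapseHo p x) ≫ Functor.whiskerRight (preConnecting p x y) (toMotivicHo B) ≫
    Functor.whiskerLeft (minus x ⋙ quot p y)
      (suspHoIso (nisnevich B) (affineLineProjections B)).hom

/-- The connecting morphism `X_x / (X_x - x) ⟶ (X_x - x) / (X_x - \overline{y}_x) ∧ S¹`. -/
def connecting (x y : X) :
    localQuot p x ⟶ (Pro.map (motivicSusp B)).obj (puncturedQuot p x y) :=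
  Pro.ofNatTrans (Functor.whiskerLeft (OpenNhds.inclusion x) (connectingHo p x y))

lemma notMem_closure {x y : X} (h : y ⤳ x) (hne : y ≠ x) : y ∉ closure {x} := fun h' =>
  hne (h.antisymm (specializes_iff_mem_closure.2 h')).eq

/-- For `y` outside of the closure of `x`, the functor `U ↦ U - \overline{x}` from open
neighbourhoods of `x` to open neighbourhoods of `y`, provided that `y` specializes to `x`. -/
def punctured {x y : X} (h : y ⤳ x) (hne : y ≠ x) : OpenNhds x ⥤ OpenNhds y where
  obj U := ⟨(minus x).obj U.1, h.mem_open U.1.isOpen U.2, notMem_closure h hne⟩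
  map i := homOfLE ((minus x).map ((OpenNhds.inclusion x).map i)).le

/-- The excision morphism `X_y / (X_y - y) ⟶ (X_x - x) / (X_x - \overline{y}_x)`. -/
def excision {x y : X} (h : y ⤳ x) (hne : y ≠ x) : localQuot p y ⟶ puncturedQuot p x y :=
  Pro.reindex (punctured h hne) (OpenNhds.inclusion y ⋙ quot p y ⋙ toMotivicHo B)

/-- The boundary morphism `X_x / (X_x - x) ⟶ X_y / (X_y - y) ∧ S¹`. -/
def boundary {x y : X} (h : y ⤳ x) (hne : y ≠ x) [IsIso (excision p h hne)] :
    localQuot p x ⟶ (Pro.map (motivicSusp B)).obj (localQuot p y) :=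
  connecting p x y ≫ (Pro.map (motivicSusp B)).map (inv (excision p h hne))

end Local

section Hypotheses

variable {B X : Scheme.{u}} (p : X ⟶ B)

/-- `X` is smooth over `B` of relative dimension `n` at `x`. -/
def HasRelativeDimensionAt (x : X) (n : ℕ) : Prop :=
  ∃ U : X.Opens, x ∈ U ∧ SmoothOfRelativeDimension n (U.ι ≫ p)

/-- The point `x`, that is the spectrum of its residue field, as a `B`-scheme. -/
def pointScheme (x : X) : Over B := Over.mk (X.fromSpecResidueField x ≫ p)

/-- The prime ideal of the local ring at `x` which corresponds to a generization `y` of `x`. -/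
def generizationIdeal {x y : X} (h : y ⤳ x) : Ideal (X.presheaf.stalk x) :=
  RingHom.ker (X.presheaf.stalkSpecializes h ≫ X.residue y).hom

/-- The local scheme `\overline{y}_x` at `x` of the closure of `y` with its reduced structure, as a
`B`-scheme: the spectrum of the quotient of the local ring of `X` at `x` by the prime ideal
corresponding to `y`. -/
def closureLocalScheme {x y : X} (h : y ⤳ x) : Over B :=
  Over.mk (Spec.map (CommRingCat.ofHom (Ideal.Quotient.mk (generizationIdeal h))) ≫
    X.fromSpecStalk x ≫ p)

end Hypotheses

end MotivicPairs

end

/-!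
# Invariance of local schemes modulo punctured local schemes, and of their boundary maps

The idea is that the pro-objects `X_x / (X_x - x)` and `(X_x - x) / (X_x - \overline{y}_x)` only
depend on a *Nisnevich neighbourhood* of the closed subset whose complement is collapsed (`x`,
respectively `\overline{y}_x`), and that `X` and `X'` have a common such neighbourhood.

*Excision.* Let `φ : V ⟶ X` be étale, and such that the field-valued points outside of an open
subscheme `A` of `X` lift uniquely to `V`. Then `V / φ⁻¹ A ⟶ X / A` is a Nisnevich-local
isomorphism, already of presheaves of pointed sets: surjectivity uses the Nisnevich covering by `A`
and `V`, and injectivity holds because two sections of an étale morphism which agree at a point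
agree near it (`localizedEquiv_cofiber_map`). Hence, for `IsNisnevichNbhd π y` with `π : V ⟶ X`, the
pro-objects at points of `V` above `y` and above its specializations in the image agree with those
of `X`, compatibly with the connecting and excision morphisms (`IsNisnevichNbhd.exists_isos`).
Cofinality is no problem since étale morphisms are open: the images of the neighbourhoods in `V` are
a basis of neighbourhoods in `X`.

*Common Nisnevich neighbourhoods.* Let `O` be the local ring of `\overline{y}` at `x` (or the
residue field `κ(x)`), so that `Spec O` maps to `X` and to `X'` over `B`, surjectively on stalks.
Choose affine charts of `X` and `X'` with coordinate rings `A` and `A'`, standard smooth of relative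
dimension `n`. The coordinate ring `C` of their fibre product is smooth of relative dimension `n`
over `A` and over `A'`, and it has a homomorphism to `O`. As every element of `O` is a fraction of
elements of `A`, the differentials relative to `A` of the functions in the kernel `J` of `C ⟶ O`
generate the cotangent space at the closed point (`span_differentialAt`), and likewise for `A'`.
Since a group is not the union of two proper subgroups, `n` elements of `J` can be chosen whose
differentials are independent for both (`exists_linearIndependent_pair`); this works over arbitrary,
also finite, residue fields. Near the closed point they cut out a scheme which is étale over both
`X` and `X'` and through which `Spec O` factors (`exists_etale_factorization`). Finally, a section
of an étale algebra is the inclusion of an open and closed subscheme, given by an idempotent, so one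
can remove the other points which lie over the closure of `Spec O` (`exists_isolating_element`). The
result is `exists_common_nisnevichNbhd`.

*Locally noetherian bases.* If `dim X_x = dim X_y + 1`, no point lies strictly between `y` and `x`.
Given a neighbourhood `W` of `y`, the closed subset `\overline{y} - W` has finitely many irreducible
components near `x`, and away from the components avoiding `x` it is therefore contained in
`\overline{x}`. So `W` contains `\overline{y} ∩ U - \overline{x}` for small `U`, and the excision
morphism is an isomorphism (`isIso_excision`).
-/

namespace MotivicPairs

/-! ### Isomorphisms of pro-objects -/

namespace Pro

section

variable {H : Type u} [Category.{v} H]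

/-- Two representatives define the same germ if and only if they agree at a common refinement of
their indices. -/
lemma Germ.mk_eq_iff {P : Pro.{w} H} {T : H} {i j : P.index} {f : P.diagram.obj i ⟶ T}
    {g : P.diagram.obj j ⟶ T} :
    Germ.mk i f = Germ.mk j g ↔ ∃ (k : P.index) (a : k ⟶ i) (b : k ⟶ j),
      P.diagram.map a ≫ f = P.diagram.map b ≫ g := by
  constructor
  · intro h
    have h' := Quot.eqvGen_exact h
    have key : ∀ s t : (Σ i, P.diagram.obj i ⟶ T),
        Relation.EqvGen (fun (a b : Σ i, P.diagram.obj i ⟶ T) =>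
          ∃ g : b.1 ⟶ a.1, b.2 = P.diagram.map g ≫ a.2) s t →
        ∃ (k : P.index) (a : k ⟶ s.1) (b : k ⟶ t.1),
          P.diagram.map a ≫ s.2 = P.diagram.map b ≫ t.2 := by
      intro s t hst
      induction hst with
      | rel s t h =>
        obtain ⟨g, hg⟩ := h
        exact ⟨t.1, g, 𝟙 _, by simp [hg]⟩
      | refl s => exact ⟨s.1, 𝟙 _, 𝟙 _, rfl⟩
      | symm s t _ ih =>
        obtain ⟨k, a, b, e⟩ := ih
        exact ⟨k, b, a, e.symm⟩
      | trans r s t _ _ ih₁ ih₂ =>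
        obtain ⟨k, a, b, e⟩ := ih₁
        obtain ⟨l, c, d, e'⟩ := ih₂
        obtain ⟨m, m₁, m₂, hm⟩ := IsCofiltered.cospan b c
        refine ⟨m, m₁ ≫ a, m₂ ≫ d, ?_⟩
        rw [Functor.map_comp, Functor.map_comp, Category.assoc, Category.assoc, e, ← e',
          ← Category.assoc, ← Category.assoc, ← Functor.map_comp, ← Functor.map_comp, hm]
    exact key _ _ h'
  · rintro ⟨k, a, b, h⟩
    rw [← Germ.mk_map a f, ← Germ.mk_map b g, h]

/-- A morphism of pro-objects is an isomorphism as soon as it induces bijections on morphisms to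
the objects of the category. -/
lemma isIso_of_precomp_bijective {P Q : Pro.{w} H} (φ : P ⟶ Q)
    (h : ∀ T : H, Function.Bijective (φ.precomp : Q.Germ T → P.Germ T)) : IsIso φ := by
  -- the germs of the inverse at `i` are the preimages of the germs of `𝟙 P`
  choose s hs using fun i : P.index => (h (P.diagram.obj i)).2 (Germ.mk i (𝟙 _))
  have hinv : ∀ {i j : P.index} (g : i ⟶ j), (s i).postcomp (P.diagram.map g) = s j := by
    intro i j g
    apply (h _).1
    rw [Hom.precomp_postcomp, hs, hs, Germ.postcomp_mk, Category.id_comp, ← Germ.mk_map g (𝟙 _),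
      Category.comp_id]
  let ψ : Q ⟶ P := Hom.mk (P := Q) (Q := P) s hinv
  have h1 : φ ≫ ψ = 𝟙 P := hom_ext hs
  have h2 : ψ ≫ φ = 𝟙 Q := by
    apply hom_ext
    intro j
    apply (h _).1
    have e : φ.precomp (Hom.germ (ψ ≫ φ) j) = Hom.germ (φ ≫ ψ ≫ φ) j := rfl
    rw [e, ← Category.assoc, h1, Category.id_comp, id_germ, Hom.precomp_mk, Germ.postcomp_id]
  exact ⟨ψ, h1, h2⟩

variable {I : Type w} [SmallCategory I] [IsCofiltered I]

lemma reindex_precomp_mk {I' : Type w} [SmallCategory I'] [IsCofiltered I'] (r : I' ⥤ I)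
    (F : I ⥤ H) {T : H} (j : I') (f : F.obj (r.obj j) ⟶ T) :
    (reindex r F).precomp (Germ.mk (P := of (r ⋙ F)) j f) = Germ.mk (P := of F) (r.obj j) f :=
  congrArg (Germ.mk (P := of F) (r.obj j)) (Category.id_comp f)

/-- Restriction of a diagram along a functor `r` does not change the pro-object, if each index `i`
has refinements whose values are also values of the diagram at sufficiently small objects
`r.obj j`. -/
lemma isIso_reindex [Quiver.IsThin I] {I' : Type w} [SmallCategory I'] [IsCofiltered I']
    (r : I' ⥤ I) (F : I ⥤ H)
    (h : ∀ i : I, ∃ j : I', ∀ j₂ : I', (j₂ ⟶ j) → ∃ (k : I) (_ : k ⟶ i) (b : k ⟶ r.obj j₂),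
      IsIso (F.map b)) :
    IsIso (reindex r F) := by
  apply isIso_of_precomp_bijective
  intro T
  constructor
  · intro x y hxy
    induction x using Germ.ind with | h j f =>
    induction y using Germ.ind with | h j' f' =>
    rw [reindex_precomp_mk, reindex_precomp_mk, Germ.mk_eq_iff] at hxy
    obtain ⟨i, a, b, e⟩ := hxy
    obtain ⟨j₀, hj₀⟩ := h i
    let m : I' := IsCofiltered.min j j'
    let j₂ : I' := IsCofiltered.min j₀ m
    obtain ⟨k, ki, kr, hk⟩ := hj₀ j₂ (IsCofiltered.minToLeft _ _)
    let c : j₂ ⟶ j := IsCofiltered.minToRight _ _ ≫ IsCofiltered.minToLeft _ _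
    let c' : j₂ ⟶ j' := IsCofiltered.minToRight _ _ ≫ IsCofiltered.minToRight _ _
    rw [Germ.mk_eq_iff]
    refine ⟨j₂, c, c', ?_⟩
    change F.map (r.map c) ≫ f = F.map (r.map c') ≫ f'
    rw [← cancel_epi (F.map kr), ← Category.assoc, ← Category.assoc, ← F.map_comp, ← F.map_comp,
      Subsingleton.elim (kr ≫ r.map c) (ki ≫ a), Subsingleton.elim (kr ≫ r.map c') (ki ≫ b),
      F.map_comp, F.map_comp, Category.assoc, Category.assoc]
    exact congrArg (F.map ki ≫ ·) e
  · intro y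
    induction y using Germ.ind with | h i f =>
    obtain ⟨j, hj⟩ := h i
    obtain ⟨k, ki, kr, hk⟩ := hj j (𝟙 j)
    refine ⟨Germ.mk (P := of (r ⋙ F)) j (inv (F.map kr) ≫ F.map ki ≫ f), ?_⟩
    rw [reindex_precomp_mk, Germ.mk_eq_iff]
    refine ⟨k, kr, ki, ?_⟩
    change F.map kr ≫ inv (F.map kr) ≫ F.map ki ≫ f = F.map ki ≫ f
    rw [IsIso.hom_inv_id_assoc]

/-- Restriction along a cofinal functor of thin categories does not change a pro-object. -/
lemma isIso_reindex_of_cofinal [Quiver.IsThin I] {I' : Type w} [SmallCategory I'] [IsCofiltered I']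
    (r : I' ⥤ I) (F : I ⥤ H) (h : ∀ i : I, ∃ j : I', Nonempty (r.obj j ⟶ i)) :
    IsIso (reindex r F) := by
  apply isIso_reindex
  intro i
  obtain ⟨j, ⟨g⟩⟩ := h i
  refine ⟨j, fun j₂ c => ⟨r.obj j₂, r.map c ≫ g, 𝟙 _, ?_⟩⟩
  rw [F.map_id]
  infer_instance

lemma ofNatTrans_id (F : I ⥤ H) : ofNatTrans (𝟙 F) = 𝟙 (of F) := rfl

lemma ofNatTrans_comp {F G K : I ⥤ H} (α : F ⟶ G) (β : G ⟶ K) :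
    ofNatTrans (α ≫ β) = ofNatTrans α ≫ ofNatTrans β := rfl

instance {F G : I ⥤ H} (α : F ⟶ G) [IsIso α] : IsIso (ofNatTrans α) :=
  ⟨ofNatTrans (inv α), by rw [← ofNatTrans_comp, IsIso.hom_inv_id, ofNatTrans_id],
    by rw [← ofNatTrans_comp, IsIso.inv_hom_id, ofNatTrans_id]⟩

section Reindex

variable {I' : Type w} [SmallCategory I'] [IsCofiltered I'] (r : I' ⥤ I)

lemma map_reindex {H' : Type*} [Category* H'] (Φ : H ⥤ H') (F : I ⥤ H) :
    (Pro.map Φ).map (reindex r F) = reindex r (F ⋙ Φ) := by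
  apply hom_ext
  intro j
  exact congrArg (Germ.mk (P := of (F ⋙ Φ)) (r.obj j)) (Φ.map_id _)

lemma reindex_naturality {F G : I ⥤ H} (α : F ⟶ G) :
    ofNatTrans α ≫ reindex r G = reindex r F ≫ ofNatTrans (Functor.whiskerLeft r α) := by
  apply hom_ext
  intro j
  refine congrArg (Germ.mk (P := of F) (r.obj j)) ?_
  exact (Category.comp_id _).trans (Category.id_comp _).symm

lemma reindex_comp {I'' : Type w} [SmallCategory I''] [IsCofiltered I''] (s : I'' ⥤ I')
    (F : I ⥤ H) : reindex r F ≫ reindex s (r ⋙ F) = reindex (s ⋙ r) F := by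
  apply hom_ext
  intro j
  exact congrArg (Germ.mk (P := of F) (r.obj (s.obj j))) (Category.id_comp _)

/-- Restrictions along two functors `r` and `s` agree up to the comparison morphisms given by a
natural transformation `r ⟶ s`. -/
lemma reindex_ofNatTrans {s : I' ⥤ I} (t : r ⟶ s) (F : I ⥤ H) :
    reindex r F ≫ ofNatTrans (Functor.whiskerRight t F) = reindex s F := by
  apply hom_ext
  intro j
  have h := Germ.mk_map (P := of F) (t.app j) (𝟙 (F.obj (s.obj j)))
  refine Eq.trans ?_ h
  refine congrArg (Germ.mk (P := of F) (r.obj j)) ?_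
  exact (Category.id_comp _).trans (Category.comp_id _).symm

end Reindex

end

end Pro

end MotivicPairs

namespace MotivicPairs

/-! ### Locally bijective morphisms of simplicial presheaves -/

section LocalIsomorphisms

variable {C : Type u} [Category.{v} C] [LocallySmall.{w} C]

/-- The presheaf of `n`-simplices of a pointed simplicial presheaf. -/
abbrev simplices (C : Type u) [Category.{v} C] (n : SimplexCategoryᵒᵖ) :
    PtSPre.{w} C ⥤ (Cᵒᵖ ⥤ Type w) :=
  forgetPoints C ⋙ (Functor.whiskeringRight _ _ _).obj ((evaluation _ _).obj n)

/-- A morphism of pointed simplicial presheaves which is a local isomorphism of presheaves of sets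
in each simplicial degree is a simplicial weak equivalence: it induces isomorphisms on stalks. -/
lemma simplicialEquiv_of_locallyBijective (J : GrothendieckTopology C) {X Y : PtSPre.{w} C}
    (f : X ⟶ Y) (hi : ∀ n, Presheaf.IsLocallyInjective J ((simplices C n).map f))
    (hs : ∀ n, Presheaf.IsLocallySurjective J ((simplices C n).map f)) :
    simplicialEquiv J f := by
  intro Φ
  apply +allowSynthFailures isSSetEquiv_of_isIso
  apply +allowSynthFailures NatIso.isIso_of_isIso_app
  intro n
  have := hi n
  have := hs n
  have hb := Φ.toPresheafFiber_map_bijective ((simplices C n).map f)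
  have h1 : IsIso (Φ.presheafFiber.map ((simplices C n).map f)) :=
    (isIso_iff_bijective _).2 hb
  -- the simplices of the stalk are the stalks of the presheaves of simplices
  have e := (Φ.presheafFiberCompIso ((evaluation SimplexCategoryᵒᵖ (Type w)).obj n)).hom.naturality
    ((forgetPoints C).map f)
  have h2 : IsIso ((Φ.presheafFiber ⋙ (evaluation SimplexCategoryᵒᵖ (Type w)).obj n).map
      ((forgetPoints C).map f)) := by
    rw [← IsIso.inv_comp_eq] at e
    rw [← e]
    have : IsIso (((Functor.whiskeringRight Cᵒᵖ _ _).obj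
        ((evaluation SimplexCategoryᵒᵖ (Type w)).obj n) ⋙ Φ.presheafFiber).map
          ((forgetPoints C).map f)) := h1
    infer_instance
  exact h2

end LocalIsomorphisms

end MotivicPairs

namespace MotivicPairs

open AlgebraicGeometry TopologicalSpace

/-! ### Nisnevich coverings and Nisnevich excision -/

section NisnevichCoverings

/-- A field-valued point factors through the residue field of its image. -/
lemma exists_residueField_factorization (K : Type u) [Field K] {V : Scheme.{u}}
    (b : Spec (.of K) ⟶ V) :
    ∃ (v : V) (c : V.residueField v ⟶ .of K), Spec.map c ≫ V.fromSpecResidueField v = b :=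
  ⟨_, _, Scheme.descResidueField_stalkClosedPointTo_fromSpecResidueField K V b⟩

/-- If the spectrum of the residue field of `u` lifts along `f`, then it does so through the
residue field of a point over `u` with the same residue field. -/
lemma exists_isIso_residueFieldMap {V U : Scheme.{u}} (f : V ⟶ U) (u : U)
    (b : Spec (U.residueField u) ⟶ V) (hb : b ≫ f = U.fromSpecResidueField u) :
    ∃ v : V, f v = u ∧ IsIso (f.residueFieldMap v) := by
  have aux : ∀ (v : V) (u : U) (_ : f v = u) (c : V.residueField v ⟶ U.residueField u),
      Spec.map c ≫ V.fromSpecResidueField v ≫ f = U.fromSpecResidueField u →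
      IsIso (f.residueFieldMap v) := by
    rintro v _ rfl c hc
    rw [← Scheme.Hom.SpecMap_residueFieldMap_fromSpecResidueField, ← Category.assoc,
      ← Spec.map_comp] at hc
    have h1 : f.residueFieldMap v ≫ c = 𝟙 _ := by
      apply Spec.map_injective
      rw [← cancel_mono (U.fromSpecResidueField (f v)), hc, Spec.map_id, Category.id_comp]
    -- it is enough to check this after applying `c`, which is injective as a map of fields
    have h2 : c ≫ f.residueFieldMap v = 𝟙 _ := by
      ext x
      apply c.hom.injective
      exact congrArg (fun t => t.hom (c.hom x)) h1
    exact ⟨c, h1, h2⟩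
  obtain ⟨v, c, hc⟩ := exists_residueField_factorization (U.residueField u) b
  have hp : f v = u := by
    have t : Spec (U.residueField u) := IsLocalRing.closedPoint (U.residueField u)
    have h := congrArg (fun g : Spec (U.residueField u) ⟶ U => g t) hb
    rw [Scheme.fromSpecResidueField_apply] at h
    rw [← h]
    simp only [← hc, Scheme.Hom.comp_apply, Scheme.fromSpecResidueField_apply]
  refine ⟨v, hp, aux _ u hp c ?_⟩
  rw [← hb, ← hc, Category.assoc]

/-- A sieve is a Nisnevich covering if the spectrum of each residue field lifts to an étale
morphism in the sieve. -/
lemma mem_nisnevich {B : Scheme.{u}} {U : Sm B} (S : Sieve U)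
    (h : ∀ u : U.scheme, ∃ (V : Sm B) (f : V ⟶ U), S f ∧ Etale (Sm.schemeHom f) ∧
      ∃ b : Spec (U.scheme.residueField u) ⟶ V.scheme,
        b ≫ Sm.schemeHom f = U.scheme.fromSpecResidueField u) :
    S ∈ nisnevich B U := by
  let R : Presieve U := fun V f => S f ∧ Etale (Sm.schemeHom f)
  have hR : R ∈ nisnevichPrecoverage B U := by
    refine ⟨fun V f hf => hf.2, fun u => ?_⟩
    obtain ⟨V, f, hf, he, b, hb⟩ := h u
    obtain ⟨v, hv, hi⟩ := exists_isIso_residueFieldMap _ u b hb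
    exact ⟨V, f, ⟨hf, he⟩, v, hv, hi⟩
  refine (nisnevich B).superset_covering ?_ (Precoverage.generate_mem_toGrothendieck hR)
  rw [Sieve.generate_le_iff]
  exact fun V f hf => hf.1

end NisnevichCoverings

section Excision

variable {B : Scheme.{u}}

lemma Sm.hom_ext {U V : Sm B} {f g : U ⟶ V} (h : Sm.schemeHom f = Sm.schemeHom g) : f = g :=
  ObjectProperty.hom_ext _ (Over.OverMorphism.ext h)

lemma Sm.schemeHom_comp {U V W : Sm B} (f : U ⟶ V) (g : V ⟶ W) :
    Sm.schemeHom (f ≫ g) = Sm.schemeHom f ≫ Sm.schemeHom g := rfl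

lemma Sm.w {U V : Sm B} (f : U ⟶ V) : Sm.schemeHom f ≫ V.obj.hom = U.obj.hom := Over.w f.hom

/-- A morphism whose image is contained in an open subscheme factors through it. -/
lemma Sm.exists_lift {U A X : Sm B} (f : U ⟶ X) (j : A ⟶ X) [IsOpenImmersion (Sm.schemeHom j)]
    (h : ∀ u : U.scheme, Sm.schemeHom f u ∈ Set.range (Sm.schemeHom j)) :
    ∃ g : U ⟶ A, g ≫ j = f := by
  have h' : Set.range (Sm.schemeHom f) ⊆ Set.range (Sm.schemeHom j) := by
    rintro _ ⟨u, rfl⟩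
    exact h u
  have e := IsOpenImmersion.lift_fac (Sm.schemeHom j) (Sm.schemeHom f) h'
  refine ⟨Sm.homMk (IsOpenImmersion.lift (Sm.schemeHom j) (Sm.schemeHom f) h') ?_, Sm.hom_ext e⟩
  rw [← Sm.w j, ← Category.assoc, e, Sm.w]

/-- An étale scheme over a smooth scheme, as a smooth scheme. -/
abbrev Sm.ofEtale (U : Sm B) {W : Scheme.{u}} (f : W ⟶ U.scheme) [Etale f] : Sm B :=
  Sm.mk (f ≫ U.obj.hom) (have : Smooth U.obj.hom := U.property; inferInstance)

/-- The structure morphism of an étale scheme over a smooth scheme, as a morphism in `Sm B`. -/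
abbrev Sm.ofEtaleHom (U : Sm B) {W : Scheme.{u}} (f : W ⟶ U.scheme) [Etale f] :
    Sm.ofEtale U f ⟶ U :=
  Sm.homMk f rfl

instance (U : Sm B) {W : Scheme.{u}} (f : W ⟶ U.scheme) [Etale f] :
    Etale (Sm.schemeHom (Sm.ofEtaleHom U f)) :=
  inferInstanceAs (Etale f)

/-- The section of `X / A` over `U` given by a morphism to `X`, or by the base point `none`. The
quotients are constant in the simplicial direction, so the same description holds in each
degree `n`. -/
abbrev quotSection {A X : Sm B} (j : A ⟶ X) (U : Sm B) (n : SimplexCategoryᵒᵖ)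
    (o : Option (ULift.{u + 1} (U ⟶ X))) :
    ((simplices (Sm B) n).obj ((cofiber (Sm B)).obj (Arrow.mk ((plus B).map j)))).obj (op U) :=
  Quotient.mk _ o

lemma quotSection_surjective {A X : Sm B} {j : A ⟶ X} {U : Sm B} {n : SimplexCategoryᵒᵖ}
    (s : ((simplices (Sm B) n).obj ((cofiber (Sm B)).obj (Arrow.mk ((plus B).map j)))).obj
      (op U)) : ∃ o, quotSection j U n o = s := by
  induction s using Quotient.inductionOn with | h a => exact ⟨a, rfl⟩

/-- Two sections of `X / A` agree if and only if they are equal or both factor through `A₊`. -/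
lemma quotSection_eq_iff {A X : Sm B} {j : A ⟶ X} {U : Sm B} {n : SimplexCategoryᵒᵖ}
    {o o' : Option (ULift.{u + 1} (U ⟶ X))} :
    quotSection j U n o = quotSection j U n o' ↔ o = o' ∨
      ((∀ f, o = some ⟨f⟩ → ∃ g : U ⟶ A, g ≫ j = f) ∧
        (∀ f, o' = some ⟨f⟩ → ∃ g : U ⟶ A, g ≫ j = f)) := by
  have key : ∀ o : Option (ULift.{u + 1} (U ⟶ X)),
      o ∈ Set.range ((((plus B).map j).app (op U)).app n).toFun ↔
        ∀ f, o = some ⟨f⟩ → ∃ g : U ⟶ A, g ≫ j = f := by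
    intro o
    constructor
    · rintro ⟨a, ha⟩ f rfl
      rcases a with _ | g
      · cases ha
      · exact ⟨(show ULift.{u + 1} (U ⟶ A) from g).down,
          congrArg ULift.down (Option.some.inj ha)⟩
    · intro h
      rcases o with _ | f
      · exact ⟨none, rfl⟩
      · obtain ⟨f⟩ : ULift.{u + 1} (U ⟶ X) := f
        obtain ⟨g, rfl⟩ := h f rfl
        exact ⟨some ⟨g⟩, rfl⟩
  refine mk_collapse_eq.trans ?_
  exact or_congr Iff.rfl (and_congr (key _) (key _))

/-- **Nisnevich excision**: for `φ : V ⟶ X` étale and open subschemes `A ⊆ X` and `φ⁻¹ A ⊆ V`, if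
all field-valued points of `X` outside of `A` lift uniquely to `V`, then `V / φ⁻¹ A ⟶ X / A` is a
weak equivalence. It is in fact a local isomorphism of presheaves of pointed sets. -/
lemma localizedEquiv_cofiber_map {A' V A X : Sm B} {i : A' ⟶ V} {j : A ⟶ X} (φ : V ⟶ X)
    (φ₀ : A' ⟶ A) (w : i ≫ φ = φ₀ ≫ j) [IsOpenImmersion (Sm.schemeHom i)]
    [IsOpenImmersion (Sm.schemeHom j)] [Etale (Sm.schemeHom φ)]
    (hr : ∀ v : V.scheme, Sm.schemeHom φ v ∈ Set.range (Sm.schemeHom j) →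
      v ∈ Set.range (Sm.schemeHom i))
    (hex : ∀ (K : Type u) [Field K] (a : Spec (.of K) ⟶ X.scheme),
      (∀ t, a t ∉ Set.range (Sm.schemeHom j)) →
      ∃ b : Spec (.of K) ⟶ V.scheme, b ≫ Sm.schemeHom φ = a)
    (huniq : ∀ (K : Type u) [Field K] (b b' : Spec (.of K) ⟶ V.scheme),
      (∀ t, (b ≫ Sm.schemeHom φ) t ∉ Set.range (Sm.schemeHom j)) →
      b ≫ Sm.schemeHom φ = b' ≫ Sm.schemeHom φ → b = b')
    (sq : Arrow.mk ((plus B).map i) ⟶ Arrow.mk ((plus B).map j))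
    (hsq : sq.right = (plus B).map φ) (S : MorphismProperty (PtSPre.{u + 1} (Sm B))) :
    localizedEquiv (nisnevich B) S ((cofiber (Sm B)).map sq) := by
  have hmap : ∀ (U : Sm B) (n) (o : Option (ULift.{u + 1} (U ⟶ V))),
      ((simplices (Sm B) n).map ((cofiber (Sm B)).map sq)).app (op U) (quotSection i U n o) =
        quotSection j U n (o.map fun f => ⟨f.down ≫ φ⟩) := by
    intro U n o
    have := congrArg (fun t => ((t.app (op U)).app n).toFun o) hsq
    exact congrArg (quotSection j U n) this
  -- the open part of `U` over which a section of `X` lies in `A`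
  have hopen : ∀ {A X : Sm B} (j : A ⟶ X) [IsOpenImmersion (Sm.schemeHom j)] (U : Sm B)
      (f : U ⟶ X) (u : U.scheme) (_ : Sm.schemeHom f u ∈ Set.range (Sm.schemeHom j)),
      ∃ (W : Sm B) (g : W ⟶ U), Etale (Sm.schemeHom g) ∧
        (∃ b : Spec (U.scheme.residueField u) ⟶ W.scheme,
          b ≫ Sm.schemeHom g = U.scheme.fromSpecResidueField u) ∧
        ∃ k : W ⟶ A, k ≫ j = g ≫ f := by
    intro A X j _ U f u hu
    let O : U.scheme.Opens := (Sm.schemeHom f) ⁻¹ᵁ (Sm.schemeHom j).opensRange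
    refine ⟨Sm.ofEtale U O.ι, Sm.ofEtaleHom U O.ι, inferInstance, ⟨IsOpenImmersion.lift O.ι
      (U.scheme.fromSpecResidueField u) ?_, IsOpenImmersion.lift_fac _ _ _⟩, ?_⟩
    · rintro _ ⟨t, rfl⟩
      rw [Scheme.fromSpecResidueField_apply, Scheme.Opens.range_ι]
      exact hu
    · refine Sm.exists_lift _ j ?_
      intro t
      exact t.2
  intro W hW
  apply hW.simplicial
  apply simplicialEquiv_of_locallyBijective
  · -- local injectivity
    intro n
    refine ⟨?_⟩
    intro U' x y hxy
    induction U' using Opposite.rec with | op U =>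
    obtain ⟨a, rfl⟩ := quotSection_surjective x
    obtain ⟨b, rfl⟩ := quotSection_surjective y
    let F := (simplices (Sm B) n).obj ((cofiber (Sm B)).obj (Arrow.mk ((plus B).map i)))
    have hself : ∀ {x y : F.obj (op U)} (_ : x = y),
        Presheaf.equalizerSieve (F := F) (X := op U) x y ∈ nisnevich B U := by
      rintro x _ rfl
      rw [Presheaf.equalizerSieve_self_eq_top]
      exact (nisnevich B).top_mem U
    change ((simplices (Sm B) n).map ((cofiber (Sm B)).map sq)).app (op U) (quotSection i U n a) =
      ((simplices (Sm B) n).map ((cofiber (Sm B)).map sq)).app (op U) (quotSection i U n b) at hxy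
    rw [hmap, hmap, quotSection_eq_iff] at hxy
    have hlift : ∀ (c : Option (ULift.{u + 1} (U ⟶ V))),
        (∀ f, (c.map fun f => (⟨f.down ≫ φ⟩ : ULift.{u + 1} (U ⟶ X))) = some ⟨f⟩ →
          ∃ g : U ⟶ A, g ≫ j = f) → ∀ f, c = some ⟨f⟩ → ∃ g : U ⟶ A', g ≫ i = f := by
      rintro c hc f rfl
      obtain ⟨g, hg⟩ := hc _ rfl
      refine Sm.exists_lift f i fun u => hr _ ?_
      rw [← Scheme.Hom.comp_apply, ← Sm.schemeHom_comp, ← hg]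
      exact ⟨Sm.schemeHom g u, rfl⟩
    rcases hxy with hxy | ⟨h1, h2⟩
    · rcases a with _ | ⟨⟨f⟩⟩ <;> rcases b with _ | ⟨⟨g⟩⟩
      · exact hself rfl
      · cases hxy
      · cases hxy
      · have hfg : f ≫ φ = g ≫ φ := congrArg ULift.down (Option.some.inj hxy)
        have hfg' : Sm.schemeHom f ≫ Sm.schemeHom φ = Sm.schemeHom g ≫ Sm.schemeHom φ :=
          congrArg Sm.schemeHom hfg
        apply mem_nisnevich
        intro u
        by_cases hu : (Sm.schemeHom f ≫ Sm.schemeHom φ) u ∈ Set.range (Sm.schemeHom j)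
        · obtain ⟨O, t, ht, hb, k, hk⟩ := hopen i U f u (hr _ hu)
          refine ⟨O, t, ?_, ht, hb⟩
          change quotSection i O n _ = quotSection i O n _
          refine quotSection_eq_iff.2 (Or.inr ⟨?_, ?_⟩)
          · intro f' hf'
            obtain rfl : t ≫ f = f' := congrArg ULift.down (Option.some.inj hf')
            exact ⟨k, hk⟩
          · intro f' hf'
            obtain rfl : t ≫ g = f' := congrArg ULift.down (Option.some.inj hf')
            refine Sm.exists_lift _ i fun o => hr _ ?_
            rw [← Scheme.Hom.comp_apply, ← Sm.schemeHom_comp, Category.assoc, ← hfg,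
              ← Category.assoc, ← hk, Category.assoc, w]
            exact ⟨Sm.schemeHom (k ≫ φ₀) o, rfl⟩
        · -- the sections `f` and `g` agree on an open neighbourhood of `u`, because the diagonal
          -- of the étale morphism `φ` is an open immersion
          let d := pullback.lift (Sm.schemeHom f) (Sm.schemeHom g) hfg'
          let q := pullback.fst d (pullback.diagonal (Sm.schemeHom φ))
          have hq1 : q ≫ Sm.schemeHom f = pullback.snd d (pullback.diagonal (Sm.schemeHom φ)) := by
            rw [← pullback.lift_fst (Sm.schemeHom f) (Sm.schemeHom g) hfg', ← Category.assoc,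
              pullback.condition, Category.assoc, pullback.diagonal_fst, Category.comp_id]
          have hq2 : q ≫ Sm.schemeHom g = pullback.snd d (pullback.diagonal (Sm.schemeHom φ)) := by
            rw [← pullback.lift_snd (Sm.schemeHom f) (Sm.schemeHom g) hfg', ← Category.assoc,
              pullback.condition, Category.assoc, pullback.diagonal_snd, Category.comp_id]
          have hqe : q ≫ Sm.schemeHom f = q ≫ Sm.schemeHom g := hq1.trans hq2.symm
          let K := U.scheme.residueField u
          have hb : U.scheme.fromSpecResidueField u ≫ Sm.schemeHom f =
              U.scheme.fromSpecResidueField u ≫ Sm.schemeHom g := by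
            apply huniq K
            · intro t
              rw [Category.assoc, Scheme.Hom.comp_apply, Scheme.fromSpecResidueField_apply]
              exact hu
            · rw [Category.assoc, Category.assoc, hfg']
          refine ⟨Sm.ofEtale U q, Sm.ofEtaleHom U q, ?_, inferInstance, pullback.lift
            (U.scheme.fromSpecResidueField u) (U.scheme.fromSpecResidueField u ≫ Sm.schemeHom f)
            ?_, pullback.lift_fst _ _ _⟩
          · have e : Sm.ofEtaleHom U q ≫ f = Sm.ofEtaleHom U q ≫ g := Sm.hom_ext hqe
            exact congrArg (fun t => quotSection i (Sm.ofEtale U q) n (some ⟨t⟩)) e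
          · apply pullback.hom_ext
            · rw [Category.assoc, Category.assoc, pullback.lift_fst, pullback.diagonal_fst,
                Category.comp_id]
            · rw [Category.assoc, Category.assoc, pullback.lift_snd, pullback.diagonal_snd,
                Category.comp_id, hb]
    · exact hself (quotSection_eq_iff.2 (Or.inr ⟨hlift a h1, hlift b h2⟩))
  · -- local surjectivity
    intro n
    refine ⟨?_⟩
    intro U s
    obtain ⟨a, rfl⟩ := quotSection_surjective s
    rcases a with _ | ⟨⟨f⟩⟩
    · apply (nisnevich B).superset_covering (S := ⊤) _ ((nisnevich B).top_mem U)
      intro O g _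
      exact ⟨quotSection i O n none, hmap O n none⟩
    · apply mem_nisnevich
      intro u
      by_cases hu : Sm.schemeHom f u ∈ Set.range (Sm.schemeHom j)
      · obtain ⟨O, t, ht, hb, k, hk⟩ := hopen j U f u hu
        refine ⟨O, t, ⟨quotSection i O n none, (hmap O n none).trans ?_⟩, ht, hb⟩
        refine quotSection_eq_iff.2 (Or.inr ⟨(by rintro f' ⟨⟩), ?_⟩)
        intro f' hf'
        obtain rfl : t ≫ f = f' := congrArg ULift.down (Option.some.inj hf')
        exact ⟨k, hk⟩
      · -- `f` lifts to `V` over the base change of `V` along `f`, which is étale over `U` and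
        -- has a point above `u` with the same residue field
        let K := U.scheme.residueField u
        obtain ⟨b, hb⟩ := hex K (U.scheme.fromSpecResidueField u ≫ Sm.schemeHom f) (by
          intro t
          rw [Scheme.Hom.comp_apply, Scheme.fromSpecResidueField_apply]
          exact hu)
        let q := pullback.fst (Sm.schemeHom f) (Sm.schemeHom φ)
        let r : Sm.ofEtale U q ⟶ V :=
          Sm.homMk (pullback.snd (Sm.schemeHom f) (Sm.schemeHom φ)) (by
            rw [← Sm.w φ, ← Category.assoc, ← pullback.condition, Category.assoc, Sm.w f]
            rfl)
        refine ⟨Sm.ofEtale U q, Sm.ofEtaleHom U q, ⟨quotSection i _ n (some ⟨r⟩),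
          (hmap _ n _).trans ?_⟩, inferInstance, pullback.lift _ b hb.symm,
          pullback.lift_fst _ _ _⟩
        have e : r ≫ φ = Sm.ofEtaleHom U q ≫ f := Sm.hom_ext pullback.condition.symm
        exact congrArg (fun t => quotSection j (Sm.ofEtale U q) n (some ⟨t⟩)) e

end Excision

end MotivicPairs

noncomputable section

namespace MotivicPairs

open AlgebraicGeometry TopologicalSpace

/-! ### Nisnevich neighbourhoods of closures of points -/

/-- A morphism `π : V ⟶ X` is a Nisnevich neighbourhood of the part of the closure of `y` which is
contained in its image: it is étale, and the field-valued points of this part lift uniquely. The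
image need not contain all of the closure of `y`. -/
structure IsNisnevichNbhd {V X : Scheme.{u}} (π : V ⟶ X) (y : X) : Prop where
  etale : Etale π
  uniq (K : Type u) [Field K] (b b' : Spec (.of K) ⟶ V) (h : ∀ t, y ⤳ (b ≫ π) t)
    (e : b ≫ π = b' ≫ π) : b = b'
  exists_lift (K : Type u) [Field K] (a : Spec (.of K) ⟶ X) (v : V) (ha : ∀ t, a t = π v)
    (h : y ⤳ π v) : ∃ b : Spec (.of K) ⟶ V, b ≫ π = a

namespace IsNisnevichNbhd

variable {V X : Scheme.{u}} {π : V ⟶ X} {y : X}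

protected lemma id (y : X) : IsNisnevichNbhd (𝟙 X) y where
  etale := inferInstance
  uniq K _ b b' _ e := by simpa using e
  exists_lift K _ a _ _ _ := ⟨a, Category.comp_id a⟩

/-- Points of `V` above the closure of `y` are determined by their images. -/
lemma eq_of_apply_eq (h : IsNisnevichNbhd π y) {v v' : V} (e : π v = π v') (hy : y ⤳ π v) :
    v = v' := by
  obtain ⟨b, hb⟩ := h.exists_lift (X.residueField (π v)) (X.fromSpecResidueField (π v)) v
    (fun t => X.fromSpecResidueField_apply _ t) hy
  -- every point above `π v` is the image of the lift `b` of `Spec κ(π v)`, by uniqueness of lifts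
  -- of `Spec κ(v')`
  have key : ∀ v' : V, π v' = π v → ∃ t, b t = v' := by
    intro v' e'
    have h1 : V.fromSpecResidueField v' = (Spec.map (π.residueFieldMap v') ≫
        Spec.map (X.residueFieldCongr e').inv) ≫ b := by
      apply h.uniq (V.residueField v')
      · intro t
        rw [Scheme.Hom.comp_apply, V.fromSpecResidueField_apply, e']
        exact hy
      · rw [Category.assoc, Category.assoc, hb, Scheme.residueFieldCongr_inv,
          Scheme.residueFieldCongr_fromSpecResidueField]
        exact (Scheme.Hom.SpecMap_residueFieldMap_fromSpecResidueField π v').symm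
    let t : Spec (V.residueField v') := IsLocalRing.closedPoint (V.residueField v')
    refine ⟨(Spec.map (π.residueFieldMap v') ≫ Spec.map (X.residueFieldCongr e').inv) t, ?_⟩
    rw [← Scheme.Hom.comp_apply, ← h1, V.fromSpecResidueField_apply]
  obtain ⟨t, ht⟩ := key v rfl
  obtain ⟨t', ht'⟩ := key v' e.symm
  rw [← ht, ← ht', Subsingleton.elim t t']

/-- Over the closure of `y`, specializations lift to `V`. -/
lemma specializes (h : IsNisnevichNbhd π y) {v w : V} (hv : y ⤳ π v) (hw : π v ⤳ π w) :
    v ⤳ w := by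
  have := h.etale
  -- étale morphisms are flat, so generizations lift
  obtain ⟨v', hv', e⟩ := Flat.generalizingMap π hw
  rwa [← h.eq_of_apply_eq e (e ▸ hv)]

end IsNisnevichNbhd

lemma minus_le {X : Scheme.{u}} (z : X) (U : X.Opens) : (minus z).obj U ≤ U := inf_le_left

lemma mem_minus {X : Scheme.{u}} {z w : X} {U : X.Opens} :
    w ∈ (minus z).obj U ↔ w ∈ U ∧ ¬ z ⤳ w := by
  refine and_congr Iff.rfl (not_congr ?_)
  exact specializes_iff_mem_closure.symm

section Opens

variable {B V X : Scheme.{u}} (π : V ⟶ X) {q : V ⟶ B} {p : X ⟶ B} [Smooth q] [Smooth p]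
  (hπ : π ≫ p = q)

/-- The restriction of a morphism of smooth schemes to open subschemes. -/
def openMap {U₀ : V.Opens} {U : X.Opens} (h : U₀ ≤ π ⁻¹ᵁ U) :
    (openSm q).obj U₀ ⟶ (openSm p).obj U :=
  Sm.homMk (π.resLE U U₀ h) (by
    change π.resLE U U₀ h ≫ U.ι ≫ p = U₀.ι ≫ q
    rw [Scheme.Hom.resLE_comp_ι_assoc, hπ])

lemma openMap_comp_map {U₀ : V.Opens} {U U' : X.Opens} (h : U₀ ≤ π ⁻¹ᵁ U) (i : U ⟶ U')
    (h' : U₀ ≤ π ⁻¹ᵁ U') :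
    openMap π hπ h ≫ (openSm p).map i = openMap π hπ h' :=
  Sm.hom_ext (Scheme.Hom.resLE_map π h i.le)

lemma map_comp_openMap {U₀ U₀' : V.Opens} {U : X.Opens} (i : U₀ ⟶ U₀') (h : U₀' ≤ π ⁻¹ᵁ U)
    (h' : U₀ ≤ π ⁻¹ᵁ U) :
    (openSm q).map i ≫ openMap π hπ h = openMap π hπ h' :=
  Sm.hom_ext (Scheme.Hom.map_resLE π h i.le)

lemma minus_le_preimage {v : V} {z : X} (hz : ∀ w, z ⤳ π w → v ⤳ w) {U₀ : V.Opens} {U : X.Opens}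
    (h : U₀ ≤ π ⁻¹ᵁ U) : (minus v).obj U₀ ≤ π ⁻¹ᵁ (minus z).obj U := by
  intro w hw
  rw [mem_minus] at hw
  exact mem_minus.2 ⟨h hw.1, fun h' => hw.2 (hz w h')⟩

variable {v : V} {z : X} (hz : ∀ w, z ⤳ π w → v ⤳ w)

/-- The morphism of pairs `(U₀, U₀ - \overline{v}) ⟶ (U, U - \overline{z})`. -/
def pairMap {U₀ : V.Opens} {U : X.Opens} (h : U₀ ≤ π ⁻¹ᵁ U) :
    (complementPair q v).obj U₀ ⟶ (complementPair p z).obj U :=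
  Arrow.homMk (u := (plus B).map (openMap π hπ (minus_le_preimage π hz h)))
    (v := (plus B).map (openMap π hπ h)) (by
      refine ((plus B).map_comp _ _).symm.trans (Eq.trans (congrArg _ ?_) ((plus B).map_comp _ _))
      exact (openMap_comp_map π hπ _ (homOfLE (minus_le z U)) ((minus_le v U₀).trans h)).trans
        (map_comp_openMap π hπ (homOfLE (minus_le v U₀)) h _).symm)

lemma pairMap_comp_map {U₀ : V.Opens} {U U' : X.Opens} (h : U₀ ≤ π ⁻¹ᵁ U) (i : U ⟶ U')
    (h' : U₀ ≤ π ⁻¹ᵁ U') :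
    pairMap π hπ hz h ≫ (complementPair p z).map i = pairMap π hπ hz h' := by
  ext1
  · refine ((plus B).map_comp _ _).symm.trans (congrArg _ ?_)
    exact openMap_comp_map π hπ _ _ _
  · refine ((plus B).map_comp _ _).symm.trans (congrArg _ ?_)
    exact openMap_comp_map π hπ _ _ _

lemma map_comp_pairMap {U₀ U₀' : V.Opens} {U : X.Opens} (i : U₀ ⟶ U₀') (h : U₀' ≤ π ⁻¹ᵁ U)
    (h' : U₀ ≤ π ⁻¹ᵁ U) :
    (complementPair q v).map i ≫ pairMap π hπ hz h = pairMap π hπ hz h' := by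
  ext1
  · refine ((plus B).map_comp _ _).symm.trans (congrArg _ ?_)
    exact map_comp_openMap π hπ _ _ _
  · refine ((plus B).map_comp _ _).symm.trans (congrArg _ ?_)
    exact map_comp_openMap π hπ _ _ _

/-- The morphism `U₀ / (U₀ - \overline{v}) ⟶ U / (U - \overline{z})`. -/
def quotMap {U₀ : V.Opens} {U : X.Opens} (h : U₀ ≤ π ⁻¹ᵁ U) :
    (quot q v).obj U₀ ⟶ (quot p z).obj U :=
  (cofiber (Sm B)).map (pairMap π hπ hz h)

lemma quotMap_comp_map {U₀ : V.Opens} {U U' : X.Opens} (h : U₀ ≤ π ⁻¹ᵁ U) (i : U ⟶ U')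
    (h' : U₀ ≤ π ⁻¹ᵁ U') :
    quotMap π hπ hz h ≫ (quot p z).map i = quotMap π hπ hz h' :=
  ((cofiber (Sm B)).map_comp _ _).symm.trans (congrArg _ (pairMap_comp_map π hπ hz h i h'))

lemma map_comp_quotMap {U₀ U₀' : V.Opens} {U : X.Opens} (i : U₀ ⟶ U₀') (h : U₀' ≤ π ⁻¹ᵁ U)
    (h' : U₀ ≤ π ⁻¹ᵁ U) :
    (quot q v).map i ≫ quotMap π hπ hz h = quotMap π hπ hz h' :=
  ((cofiber (Sm B)).map_comp _ _).symm.trans (congrArg _ (map_comp_pairMap π hπ hz i h h'))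

lemma range_homOfLE {U U' : X.Opens} (h : U ≤ U') :
    Set.range (X.homOfLE h) = {u | u.1 ∈ U} := by
  ext u
  constructor
  · rintro ⟨t, rfl⟩
    have e := congrArg (fun f => f t) (X.homOfLE_ι h)
    change (X.homOfLE h t).1 ∈ U
    rw [show (X.homOfLE h t).1 = t.1 from e]
    exact t.2
  · intro hu
    refine ⟨⟨u.1, hu⟩, Subtype.ext ?_⟩
    exact congrArg (fun f => f ⟨u.1, hu⟩) (X.homOfLE_ι h)

/-- Excision for restrictions of a Nisnevich neighbourhood to open subschemes. -/
lemma isIso_quotMap {y : X} (hN : IsNisnevichNbhd π y) (hyz : y ⤳ z) (hv : π v = z)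
    {U₀ : V.Opens} {U : X.Opens} (h : U₀ ≤ π ⁻¹ᵁ U)
    (hs : ∀ w ∈ U, z ⤳ w → ∃ w₀ ∈ U₀, π w₀ = w) :
    IsIso ((toMotivicHo B).map (quotMap π hπ hz h)) := by
  have := hN.etale
  apply (localizedEquiv _ _).Q_inverts
  -- points of `U` outside of `U - \overline{z}` are specializations of `z`
  have h1 : ∀ {T : Scheme.{u}} [Subsingleton T] [Nonempty T] (a : T ⟶ U), (∀ t, a t ∉ Set.range
      (Sm.schemeHom ((openSm p).map (homOfLE (minus_le z U))))) →
      ∀ t, z ⤳ (a ≫ U.ι) t := by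
    intro T _ _ a ha t
    by_contra hc
    apply ha t
    refine (range_homOfLE (minus_le z U)).ge ?_
    exact mem_minus.2 ⟨(a t).2, hc⟩
  have : Etale (Sm.schemeHom (openMap π hπ h)) := inferInstanceAs (Etale (π.resLE U U₀ h))
  have : IsOpenImmersion (Sm.schemeHom ((openSm q).map
      (homOfLE (minus_le v U₀)))) :=
    inferInstanceAs (IsOpenImmersion (V.homOfLE (minus_le v U₀)))
  have : IsOpenImmersion (Sm.schemeHom ((openSm p).map
      (homOfLE (minus_le z U)))) :=
    inferInstanceAs (IsOpenImmersion (X.homOfLE (minus_le z U)))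
  refine localizedEquiv_cofiber_map (openMap π hπ h)
    (openMap π hπ (minus_le_preimage π hz h)) ?_ ?_ ?_ ?_ (pairMap π hπ hz h) rfl _
  · exact (map_comp_openMap π hπ (homOfLE (minus_le v U₀)) h ((minus_le v U₀).trans h)).trans
      (openMap_comp_map π hπ _ (homOfLE (minus_le z U)) _).symm
  · intro (u : (U₀ : Scheme.{u})) hu
    refine (range_homOfLE (minus_le v U₀)).ge ?_
    have hu' := (range_homOfLE (minus_le z U)).le hu
    have hu'' : ¬ z ⤳ π u.1 := fun hc => (mem_minus.1 hu').2 (by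
      have e := Scheme.Hom.coe_resLE_apply π h u
      exact hc.trans (specializes_of_eq e.symm))
    refine mem_minus.2 ⟨u.2, fun hc => hu'' ?_⟩
    rw [← hv]
    exact hc.map π.continuous
  · intro K _ a ha
    have hz' := h1 a ha
    let t₀ : Spec (.of K) := IsLocalRing.closedPoint K
    obtain ⟨w₀, hw₀, e₀⟩ := hs ((a ≫ U.ι) t₀) (a t₀).2 (hz' t₀)
    have hpt : ∀ t, (a ≫ U.ι) t = π w₀ := fun t => by rw [e₀, Subsingleton.elim t t₀]
    have hyw : y ⤳ π w₀ := hyz.trans (e₀ ▸ hz' t₀)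
    obtain ⟨b, hb⟩ := hN.exists_lift K (a ≫ U.ι) w₀ hpt hyw
    have hbr : Set.range b ⊆ Set.range U₀.ι := by
      rintro _ ⟨t, rfl⟩
      have : b t = w₀ := by
        have e : π (b t) = π w₀ := by rw [← Scheme.Hom.comp_apply, hb, hpt]
        exact hN.eq_of_apply_eq e (e ▸ hyw)
      rw [this, Scheme.Opens.range_ι]
      exact hw₀
    let b₀ : Spec (.of K) ⟶ (U₀ : Scheme.{u}) := IsOpenImmersion.lift U₀.ι b hbr
    refine ⟨b₀, (cancel_mono U.ι).1 ?_⟩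
    change (b₀ ≫ π.resLE U U₀ h) ≫ U.ι = a ≫ U.ι
    rw [Category.assoc, Scheme.Hom.resLE_comp_ι, IsOpenImmersion.lift_fac_assoc, hb]
  · intro K _ (b : Spec (.of K) ⟶ (U₀ : Scheme.{u})) (b' : Spec (.of K) ⟶ (U₀ : Scheme.{u})) hb e
    have hz' := h1 _ hb
    have e1 : ∀ b : Spec (.of K) ⟶ U₀, (b ≫ Sm.schemeHom (openMap π hπ h)) ≫ U.ι =
        (b ≫ U₀.ι) ≫ π := by
      intro b
      change (b ≫ π.resLE U U₀ h) ≫ U.ι = _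
      rw [Category.assoc, Scheme.Hom.resLE_comp_ι, Category.assoc]
    refine (cancel_mono U₀.ι).1 (hN.uniq K _ _ ?_ ?_)
    · intro t
      rw [← e1]
      exact hyz.trans (hz' t)
    · rw [← e1, ← e1]
      exact congrArg (· ≫ U.ι) e

end Opens

/-- Zariski excision: shrinking `U` without changing its intersection with the closure of `z`. -/
lemma isIso_quot_map {B X : Scheme.{u}} (p : X ⟶ B) [Smooth p] (z : X)
    {U U' : X.Opens} (i : U ⟶ U') (h : ∀ w ∈ U', z ⤳ w → w ∈ U) :
    IsIso ((toMotivicHo B).map ((quot p z).map i)) := by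
  have hz : ∀ w : X, z ⤳ (𝟙 X : X ⟶ X) w → z ⤳ w := fun w hw => hw
  have hle : U ≤ (𝟙 X : X ⟶ X) ⁻¹ᵁ U' := i.le
  have e : (quot p z).map i = quotMap (𝟙 X) (Category.id_comp p) hz hle := by
    refine congrArg (cofiber (Sm B)).map ?_
    ext1
    · refine congrArg (plus B).map (Sm.hom_ext ?_)
      exact (Scheme.Hom.resLE_id _).symm
    · refine congrArg (plus B).map (Sm.hom_ext ?_)
      exact (Scheme.Hom.resLE_id _).symm
  rw [e]
  exact isIso_quotMap _ _ hz (IsNisnevichNbhd.id z) specializes_rfl rfl hle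
    fun w hw hzw => ⟨w, h w hw hzw, rfl⟩

end MotivicPairs

end

noncomputable section

namespace MotivicPairs

open AlgebraicGeometry TopologicalSpace

/-! ### Comparison of the pro-objects along a Nisnevich neighbourhood -/

/-- Two pairs `(ε, δ)` and `(ε', δ')` which both map isomorphically to a third one `(ε₀, δ₀)` are
isomorphic. -/
lemma exists_isos_of_cospans {C : Type*} [Category* C] (S : C ⥤ C) {P P' M Q Q' N R R' O : C}
    {a : P ⟶ M} {a' : P' ⟶ M} {b : Q ⟶ N} {b' : Q' ⟶ N} {c : R ⟶ O} {c' : R' ⟶ O}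
    [IsIso a] [IsIso a'] [IsIso b] [IsIso b'] [IsIso c] [IsIso c']
    {ε : Q ⟶ R} {ε' : Q' ⟶ R'} {ε₀ : N ⟶ O}
    {δ : P ⟶ S.obj R} {δ' : P' ⟶ S.obj R'} {δ₀ : M ⟶ S.obj O}
    (hε : b ≫ ε₀ = ε ≫ c) (hε' : b' ≫ ε₀ = ε' ≫ c')
    (hδ : a ≫ δ₀ = δ ≫ S.map c) (hδ' : a' ≫ δ₀ = δ' ≫ S.map c') :
    ∃ (α : P ≅ P') (β : Q ≅ Q') (γ : R ≅ R'),
      ε ≫ γ.hom = β.hom ≫ ε' ∧ δ ≫ S.map γ.hom = α.hom ≫ δ' := by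
  refine ⟨asIso a ≪≫ (asIso a').symm, asIso b ≪≫ (asIso b').symm, asIso c ≪≫ (asIso c').symm,
    ?_, ?_⟩
  · simp only [Iso.trans_hom, asIso_hom, Iso.symm_hom, asIso_inv]
    rw [← Category.assoc, IsIso.comp_inv_eq, ← hε, Category.assoc, Category.assoc, ← hε',
      IsIso.inv_hom_id_assoc]
  · simp only [Iso.trans_hom, asIso_hom, Iso.symm_hom, asIso_inv, Functor.map_comp,
      Functor.map_inv]
    rw [← Category.assoc, IsIso.comp_inv_eq, ← hδ, Category.assoc, Category.assoc, ← hδ',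
      IsIso.inv_hom_id_assoc]

namespace Pro

universe v₁ u₁

variable {H : Type u₁} [Category.{v₁} H] {I₁ I₂ J₁ J₂ : Type w} [SmallCategory I₁]
  [IsCofiltered I₁] [SmallCategory I₂] [IsCofiltered I₂] [SmallCategory J₁] [IsCofiltered J₁]
  [SmallCategory J₂] [IsCofiltered J₂] [Quiver.IsThin I₁] [Quiver.IsThin I₂]

/-- Compatible comparisons of two diagrams `D ⟶ K ⋙ S` and `F ⟶ K` (the latter over a change of
the index category from `I₂` to `I₁`) with analogous diagrams over `J₁` and `J₂` induce
isomorphisms of pro-objects, as soon as the reindexings are cofinal and the comparison morphisms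
are isomorphisms. -/
lemma exists_isos_of_comparison (S : H ⥤ H) {D K : I₁ ⥤ H} {F : I₂ ⥤ H} {D' K' : J₁ ⥤ H}
    {F' : J₂ ⥤ H} {P : I₁ ⥤ I₂} {P' : J₁ ⥤ J₂} {r₁ : J₁ ⥤ I₁} {r₂ : J₂ ⥤ I₂}
    (hr₁ : ∀ i, ∃ j, Nonempty (r₁.obj j ⟶ i)) (hr₂ : ∀ i, ∃ j, Nonempty (r₂.obj j ⟶ i))
    (t : P' ⋙ r₂ ⟶ r₁ ⋙ P) (κ : P ⋙ F ⟶ K) (κ' : P' ⋙ F' ⟶ K') (c : D ⟶ K ⋙ S)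
    (c' : D' ⟶ K' ⋙ S) (α : D' ⟶ r₁ ⋙ D) (β : F' ⟶ r₂ ⋙ F) (τ : K' ⟶ r₁ ⋙ K)
    [IsIso α] [IsIso β] [IsIso τ]
    (h₁ : ∀ j, κ'.app j ≫ τ.app j = β.app (P'.obj j) ≫ F.map (t.app j) ≫ κ.app (r₁.obj j))
    (h₂ : ∀ j, c'.app j ≫ S.map (τ.app j) = α.app j ≫ c.app (r₁.obj j)) :
    ∃ (φ₁ : of D ≅ of D') (φ₂ : of F ≅ of F') (ψ : of K ≅ of K'),
      (reindex P F ≫ ofNatTrans κ) ≫ ψ.hom = φ₂.hom ≫ reindex P' F' ≫ ofNatTrans κ' ∧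
      (ofNatTrans c : of D ⟶ (Pro.map S).obj (of K)) ≫ (Pro.map S).map ψ.hom =
        φ₁.hom ≫ (ofNatTrans c' : of D' ⟶ (Pro.map S).obj (of K')) := by
  have i₁ : IsIso (reindex r₁ D) := isIso_reindex_of_cofinal _ _ hr₁
  have i₂ : IsIso (reindex r₂ F) := isIso_reindex_of_cofinal _ _ hr₂
  have i₃ : IsIso (reindex r₁ K) := isIso_reindex_of_cofinal _ _ hr₁
  refine exists_isos_of_cospans (Pro.map S) (a := reindex r₁ D) (a' := ofNatTrans α)
    (b := reindex r₂ F) (b' := ofNatTrans β) (c := reindex r₁ K) (c' := ofNatTrans τ)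
    (ε₀ := reindex P' (r₂ ⋙ F) ≫ ofNatTrans (Functor.whiskerRight t F) ≫
      ofNatTrans (Functor.whiskerLeft r₁ κ))
    (δ₀ := ofNatTrans (Functor.whiskerLeft r₁ c)) ?_ ?_ ?_ ?_
  · have e1 : reindex r₂ F ≫ reindex P' (r₂ ⋙ F) = reindex (P' ⋙ r₂) F := reindex_comp _ _ _
    have e2 : reindex (P' ⋙ r₂) F ≫ ofNatTrans (Functor.whiskerRight t F) =
      reindex (r₁ ⋙ P) F := reindex_ofNatTrans _ _ _
    have e3 : reindex P F ≫ reindex r₁ (P ⋙ F) = reindex (r₁ ⋙ P) F := reindex_comp _ _ _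
    have e4 := reindex_naturality r₁ κ
    rw [← Category.assoc, e1, ← Category.assoc, e2, ← e3, Category.assoc, Category.assoc]
    exact congrArg (_ ≫ ·) e4.symm
  · have e1 := reindex_naturality P' β
    have e2 : Functor.whiskerLeft P' β ≫ Functor.whiskerRight t F ≫ Functor.whiskerLeft r₁ κ =
        κ' ≫ τ := by
      ext j
      exact (h₁ j).symm
    have e3 : ofNatTrans (Functor.whiskerLeft P' β) ≫ ofNatTrans (Functor.whiskerRight t F) ≫
        ofNatTrans (Functor.whiskerLeft r₁ κ) = ofNatTrans κ' ≫ ofNatTrans τ :=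
      congrArg ofNatTrans e2
    rw [← Category.assoc, e1, Category.assoc, e3, Category.assoc]
  · have e1 : (Pro.map S).map (reindex r₁ K) = reindex r₁ (K ⋙ S) := map_reindex _ _ _
    rw [e1]
    exact (reindex_naturality r₁ c).symm
  · have e2 : α ≫ Functor.whiskerLeft r₁ c = c' ≫ Functor.whiskerRight τ S := by
      ext j
      exact (h₂ j).symm
    exact congrArg ofNatTrans e2

section Whisker

variable {I O E : Type*} [Category* I] [Category* O] [Category* E]

/-- The natural transformation `A ⋙ Q ⋙ T ⟶ R ⋙ A' ⋙ Q' ⋙ T` induced by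
`A ⋙ Q ⟶ R ⋙ A' ⋙ Q'`. -/
def whisker {J O' : Type*} [Category* J] [Category* O'] {A : I ⥤ O} {Q : O ⥤ E} {R : I ⥤ J}
    {A' : J ⥤ O'} {Q' : O' ⥤ E} (α : A ⋙ Q ⟶ R ⋙ A' ⋙ Q') (T : E ⥤ H) :
    A ⋙ Q ⋙ T ⟶ R ⋙ A' ⋙ Q' ⋙ T :=
  Functor.whiskerRight α T

/-- The natural transformation `P ⋙ A ⋙ G ⟶ A' ⋙ M ⋙ G` induced by `P ⋙ A ⟶ A' ⋙ M`. -/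
def whiskerSquare {J O' : Type*} [Category* J] [Category* O'] {P : I ⥤ J} {A : J ⥤ O}
    {A' : I ⥤ O'} {M : O' ⥤ O} (α : P ⋙ A ⟶ A' ⋙ M) (G : O ⥤ H) :
    P ⋙ A ⋙ G ⟶ A' ⋙ M ⋙ G :=
  Functor.whiskerRight α G

lemma isIso_whisker {J O' : Type*} [Category* J] [Category* O'] {A : I ⥤ O} {Q : O ⥤ E} {R : I ⥤ J}
    {A' : J ⥤ O'} {Q' : O' ⥤ E} (α : A ⋙ Q ⟶ R ⋙ A' ⋙ Q') (T : E ⥤ H)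
    (h : ∀ i, IsIso (T.map (α.app i))) : IsIso (whisker α T) := by
  apply +allowSynthFailures NatIso.isIso_of_isIso_app
  exact h

end Whisker

/-- Diagrams which agree, after localization by `T`, along a cofinal reindexing `r` define
isomorphic pro-objects. -/
lemma nonempty_iso_of_comparison {O O' E : Type*} [Category* O] [Category* O'] [Category* E]
    (T : E ⥤ H) {A : I₁ ⥤ O} {A' : J₁ ⥤ O'} {Q : O ⥤ E} {Q' : O' ⥤ E} {r : J₁ ⥤ I₁}
    (hr : ∀ i, ∃ j, Nonempty (r.obj j ⟶ i)) (α : A' ⋙ Q' ⟶ r ⋙ A ⋙ Q)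
    (hα : ∀ j, IsIso (T.map (α.app j))) :
    Nonempty (of (A ⋙ Q ⋙ T) ≅ of (A' ⋙ Q' ⋙ T)) := by
  have := isIso_whisker α T hα
  have : IsIso (reindex r (A ⋙ Q ⋙ T)) := isIso_reindex_of_cofinal _ _ hr
  exact ⟨asIso (reindex r (A ⋙ Q ⋙ T)) ≪≫ (asIso (ofNatTrans (whisker α T))).symm⟩

/-- The form of `exists_isos_of_comparison` for diagrams which are obtained by applying functors `Q`
to categories `O` of open subsets and a localization functor `T`. -/
lemma exists_isos_of_square_comparison {O O' E : Type*} [Category* O] [Category* O'] [Category* E]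
    (S : H ⥤ H) (T : E ⥤ H)
    {A₁ : I₁ ⥤ O} {A₂ : I₂ ⥤ O} {M : O ⥤ O} {Q₁ Q₂ : O ⥤ E} {P : I₁ ⥤ I₂}
    {B₁ : J₁ ⥤ O'} {B₂ : J₂ ⥤ O'} {N : O' ⥤ O'} {R₁ R₂ : O' ⥤ E} {P' : J₁ ⥤ J₂}
    {r₁ : J₁ ⥤ I₁} {r₂ : J₂ ⥤ I₂}
    (hr₁ : ∀ i, ∃ j, Nonempty (r₁.obj j ⟶ i)) (hr₂ : ∀ i, ∃ j, Nonempty (r₂.obj j ⟶ i))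
    (t : P' ⋙ r₂ ⟶ r₁ ⋙ P) (κ : P ⋙ A₂ ⟶ A₁ ⋙ M) (κ' : P' ⋙ B₂ ⟶ B₁ ⋙ N)
    (c : Q₁ ⋙ T ⟶ (M ⋙ Q₂ ⋙ T) ⋙ S) (c' : R₁ ⋙ T ⟶ (N ⋙ R₂ ⋙ T) ⋙ S)
    (α : B₁ ⋙ R₁ ⟶ r₁ ⋙ A₁ ⋙ Q₁) (β : B₂ ⋙ R₂ ⟶ r₂ ⋙ A₂ ⋙ Q₂)
    (τ : B₁ ⋙ N ⋙ R₂ ⟶ r₁ ⋙ A₁ ⋙ M ⋙ Q₂)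
    (hα : ∀ j, IsIso (T.map (α.app j))) (hβ : ∀ j, IsIso (T.map (β.app j)))
    (hτ : ∀ j, IsIso (T.map (τ.app j)))
    (h₁ : ∀ j, R₂.map (κ'.app j) ≫ τ.app j =
      β.app (P'.obj j) ≫ Q₂.map (A₂.map (t.app j)) ≫ Q₂.map (κ.app (r₁.obj j)))
    (h₂ : ∀ j, c'.app (B₁.obj j) ≫ S.map (T.map (τ.app j)) =
      T.map (α.app j) ≫ c.app (A₁.obj (r₁.obj j))) :
    ∃ (φ₁ : of (A₁ ⋙ Q₁ ⋙ T) ≅ of (B₁ ⋙ R₁ ⋙ T)) (φ₂ : of (A₂ ⋙ Q₂ ⋙ T) ≅ of (B₂ ⋙ R₂ ⋙ T))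
      (ψ : of (A₁ ⋙ M ⋙ Q₂ ⋙ T) ≅ of (B₁ ⋙ N ⋙ R₂ ⋙ T)),
      (reindex P (A₂ ⋙ Q₂ ⋙ T) ≫ ofNatTrans (whiskerSquare κ (Q₂ ⋙ T))) ≫ ψ.hom =
        φ₂.hom ≫ reindex P' (B₂ ⋙ R₂ ⋙ T) ≫ ofNatTrans (whiskerSquare κ' (R₂ ⋙ T)) ∧
      (ofNatTrans (Functor.whiskerLeft A₁ c) :
          of (A₁ ⋙ Q₁ ⋙ T) ⟶ (Pro.map S).obj (of (A₁ ⋙ M ⋙ Q₂ ⋙ T))) ≫ (Pro.map S).map ψ.hom =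
        φ₁.hom ≫ (ofNatTrans (Functor.whiskerLeft B₁ c') :
          of (B₁ ⋙ R₁ ⋙ T) ⟶ (Pro.map S).obj (of (B₁ ⋙ N ⋙ R₂ ⋙ T))) := by
  have := isIso_whisker α T hα
  have := isIso_whisker β T hβ
  have : IsIso (whisker (A := B₁) (Q := N ⋙ R₂) (A' := A₁) (Q' := M ⋙ Q₂) τ T) :=
    isIso_whisker (A := B₁) (Q := N ⋙ R₂) (A' := A₁) (Q' := M ⋙ Q₂) τ T hτ
  refine exists_isos_of_comparison S (D := A₁ ⋙ Q₁ ⋙ T) (K := A₁ ⋙ M ⋙ Q₂ ⋙ T)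
    (F := A₂ ⋙ Q₂ ⋙ T) (D' := B₁ ⋙ R₁ ⋙ T) (K' := B₁ ⋙ N ⋙ R₂ ⋙ T) (F' := B₂ ⋙ R₂ ⋙ T) hr₁ hr₂ t
    (whiskerSquare κ (Q₂ ⋙ T)) (whiskerSquare κ' (R₂ ⋙ T)) (Functor.whiskerLeft A₁ c)
    (Functor.whiskerLeft B₁ c') (whisker α T) (whisker β T)
    (whisker (A := B₁) (Q := N ⋙ R₂) (A' := A₁) (Q' := M ⋙ Q₂) τ T) ?_ h₂
  intro j
  have := congrArg T.map (h₁ j)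
  rw [Functor.map_comp, Functor.map_comp, Functor.map_comp] at this
  exact this

end Pro

section Neighbourhoods

variable {V X : Scheme.{u}} {π : V ⟶ X}

lemma IsNisnevichNbhd.isOpenMap {y : X} (hN : IsNisnevichNbhd π y) : IsOpenMap π :=
  have := hN.etale
  π.isOpenMap

/-- The images in `X` of the open neighbourhoods of `v`. -/
def imageNhds (ho : IsOpenMap π) {v : V} {z : X} (hv : π v = z) : OpenNhds v ⥤ OpenNhds z where
  obj U := ⟨⟨π '' U.1, ho _ U.1.isOpen⟩, ⟨v, U.2, hv⟩⟩
  map i := homOfLE (Set.image_mono i.le)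

lemma imageNhds_cofinal (ho : IsOpenMap π) {v : V} {z : X} (hv : π v = z) (U : OpenNhds z) :
    ∃ U₀ : OpenNhds v, Nonempty ((imageNhds ho hv).obj U₀ ⟶ U) := by
  refine ⟨⟨π ⁻¹ᵁ U.1, ?_⟩, ⟨homOfLE ?_⟩⟩
  · change π v ∈ U.1
    rw [hv]
    exact U.2
  · exact Set.image_preimage_subset π U.1

lemma le_preimage_imageNhds (ho : IsOpenMap π) {v : V} {z : X} (hv : π v = z) (U : OpenNhds v) :
    U.1 ≤ π ⁻¹ᵁ ((imageNhds ho hv).obj U).1 :=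
  Set.subset_preimage_image π U.1

variable {B : Scheme.{u}} {p : X ⟶ B} [Smooth p] {q : V ⟶ B} [Smooth q] (hq : π ≫ p = q)
  (ho : IsOpenMap π)

section Local

variable {z : X} {v : V} (hv : π v = z) (hz : ∀ w, z ⤳ π w → v ⤳ w)

/-- The morphisms `U / (U - \overline{v}) ⟶ π U / (π U - \overline{z})`. -/
def quotTrans : OpenNhds.inclusion v ⋙ quot q v ⟶
    imageNhds ho hv ⋙ OpenNhds.inclusion z ⋙ quot p z where
  app U := quotMap π hq hz (le_preimage_imageNhds ho hv U)
  naturality U U' i := by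
    refine (map_comp_quotMap π hq hz _ _ ?_).trans (quotMap_comp_map π hq hz _ _ _).symm
    exact fun w hw => le_preimage_imageNhds ho hv U' (i.le hw)

lemma isIso_map_quotTrans {y : X} (hN : IsNisnevichNbhd π y) (hyz : y ⤳ z) (U : OpenNhds v) :
    IsIso ((toMotivicHo B).map ((quotTrans hq ho hv hz).app U)) :=
  isIso_quotMap π hq hz hN hyz hv _ fun _ hw _ => hw

end Local

section Punctured

variable {x y : X} {vx vy : V} (hx : π vx = x) (hx' : ∀ w, x ⤳ π w → vx ⤳ w)
  (hy' : ∀ w, y ⤳ π w → vy ⤳ w)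

/-- The morphisms `(U - \overline{x}) / (U - \overline{x} - \overline{y}) ⟶
(π U - \overline{x}) / (π U - \overline{x} - \overline{y})`. -/
def puncturedTrans : OpenNhds.inclusion vx ⋙ minus vx ⋙ quot q vy ⟶
    imageNhds ho hx ⋙ OpenNhds.inclusion x ⋙ minus x ⋙ quot p y where
  app U := quotMap π hq hy' (minus_le_preimage π hx' (le_preimage_imageNhds ho hx U))
  naturality U U' i := by
    refine (map_comp_quotMap π hq hy' _ _ ?_).trans (quotMap_comp_map π hq hy' _ _ _).symm
    exact ((minus vx).map i).le.trans (minus_le_preimage π hx' (le_preimage_imageNhds ho hx U'))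

lemma isIso_map_puncturedTrans (hN : IsNisnevichNbhd π y) (hy : π vy = y) (U : OpenNhds vx) :
    IsIso ((toMotivicHo B).map ((puncturedTrans hq ho hx hx' hy').app U)) := by
  refine isIso_quotMap π hq hy' hN specializes_rfl hy _ ?_
  rintro w hw -
  obtain ⟨⟨w₀, hw₀, rfl⟩, hxw⟩ := mem_minus.1 hw
  refine ⟨w₀, mem_minus.2 ⟨hw₀, fun hc => hxw ?_⟩, rfl⟩
  rw [← hx]
  exact hc.map π.continuous

section Excision

variable (hy : π vy = y) (h : y ⤳ x) (hne : y ≠ x) (hV : vy ⤳ vx) (hneV : vy ≠ vx)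

/-- The inclusions `π (U - \overline{x}) ⊆ π U - \overline{x}`. -/
def puncturedImage :
    punctured hV hneV ⋙ imageNhds ho hy ⟶ imageNhds ho hx ⋙ punctured h hne where
  app U := homOfLE (by
    rintro _ ⟨w, hw, rfl⟩
    obtain ⟨hw, hxw⟩ := mem_minus.1 hw
    exact mem_minus.2 ⟨⟨w, hw, rfl⟩, fun hc => hxw (hx' _ hc)⟩)

end Excision

/-- The connecting morphisms are natural before passing to the homotopy category. -/
lemma hocofib_map_comp_preConnecting {U₀ : V.Opens} {U : X.Opens} (hU : U₀ ≤ π ⁻¹ᵁ U) :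
    (hocofib (Sm B)).map (pairMap π hq hx' hU) ≫ (preConnecting p x y).app U =
      (preConnecting q vx vy).app U₀ ≫
        (susp (Sm B)).map (quotMap π hq hy' (minus_le_preimage π hx' hU)) := by
  have e1 := (hocofibToSusp (Sm B)).naturality (pairMap π hq hx' hU)
  have e2 := (toCofiber (Sm B)).naturality (pairMap π hq hy' (minus_le_preimage π hx' hU))
  have e3 := congrArg (susp (Sm B)).map e2
  rw [Functor.map_comp, Functor.map_comp] at e3
  refine ((Category.assoc _ _ _).symm.trans (congrArg (· ≫ _) e1)).trans ?_
  refine (Category.assoc _ _ _).trans (Eq.trans ?_ (Category.assoc _ _ _).symm)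
  exact congrArg (_ ≫ ·) e3

/-- The connecting morphisms of the triples `U - \overline{x} - \overline{y} ⊆ U - \overline{x} ⊆ U`
are natural. -/
lemma quotMap_comp_connectingHo {U₀ : V.Opens} {U : X.Opens} (hU : U₀ ≤ π ⁻¹ᵁ U) :
    (toMotivicHo B).map (quotMap π hq hx' hU) ≫ (connectingHo p x y).app U =
      (connectingHo q vx vy).app U₀ ≫ (motivicSusp B).map ((toMotivicHo B).map
        (quotMap π hq hy' (minus_le_preimage π hx' hU))) := by
  have e1 : (collapseHo q vx).app U₀ ≫ (toMotivicHo B).map (quotMap π hq hx' hU) =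
      (toMotivicHo B).map ((hocofib (Sm B)).map (pairMap π hq hx' hU)) ≫
        (collapseHo p x).app U := by
    have := congrArg (toMotivicHo B).map
      ((hocofibToCofiber (Sm B)).naturality (pairMap π hq hx' hU))
    rw [Functor.map_comp, Functor.map_comp] at this
    exact this.symm
  have e2 := congrArg (toMotivicHo B).map
    (hocofib_map_comp_preConnecting (y := y) hq hx' hy' hU)
  rw [Functor.map_comp, Functor.map_comp] at e2
  have e3 := (suspHoIso (nisnevich B) (affineLineProjections B)).hom.naturality
    (quotMap π hq hy' (minus_le_preimage π hx' hU))
  have ep : (collapseHo p x).app U ≫ (connectingHo p x y).app U =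
      (toMotivicHo B).map ((preConnecting p x y).app U) ≫
        (suspHoIso (nisnevich B) (affineLineProjections B)).hom.app
          ((quot p y).obj ((minus x).obj U)) := by
    have := congrArg (fun t => NatTrans.app t U)
      (IsIso.hom_inv_id_assoc (collapseHo p x)
        (Functor.whiskerRight (preConnecting p x y) (toMotivicHo B) ≫
          Functor.whiskerLeft (minus x ⋙ quot p y)
            (suspHoIso (nisnevich B) (affineLineProjections B)).hom))
    exact this
  have eq : (collapseHo q vx).app U₀ ≫ (connectingHo q vx vy).app U₀ =
      (toMotivicHo B).map ((preConnecting q vx vy).app U₀) ≫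
        (suspHoIso (nisnevich B) (affineLineProjections B)).hom.app
          ((quot q vy).obj ((minus vx).obj U₀)) := by
    have := congrArg (fun t => NatTrans.app t U₀)
      (IsIso.hom_inv_id_assoc (collapseHo q vx)
        (Functor.whiskerRight (preConnecting q vx vy) (toMotivicHo B) ≫
          Functor.whiskerLeft (minus vx ⋙ quot q vy)
            (suspHoIso (nisnevich B) (affineLineProjections B)).hom))
    exact this
  rw [← cancel_epi ((collapseHo q vx).app U₀), ← Category.assoc, e1, Category.assoc]
  refine (congrArg (_ ≫ ·) ep).trans ?_
  refine ((Category.assoc _ _ _).symm.trans (congrArg (· ≫ _) e2)).trans ?_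
  refine (Category.assoc _ _ _).trans ((congrArg (_ ≫ ·) e3).trans ?_)
  refine (Category.assoc _ _ _).symm.trans ((congrArg (· ≫ _) eq.symm).trans ?_)
  exact Category.assoc _ _ _

end Punctured

/-- The identity, between the two composites which send an open neighbourhood `U` of `x` to the
open subset `U - \overline{x}`. -/
def puncturedInclusion {x y : X} (h : y ⤳ x) (hne : y ≠ x) :
    punctured h hne ⋙ OpenNhds.inclusion y ⟶ OpenNhds.inclusion x ⋙ minus x where
  app U := 𝟙 ((minus x).obj U.1)

lemma reindex_punctured_comp {H : Type*} [Category* H] (G : X.Opens ⥤ H) {x y : X} (h : y ⤳ x)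
    (hne : y ≠ x) :
    Pro.reindex (punctured h hne) (OpenNhds.inclusion y ⋙ G) ≫
      Pro.ofNatTrans (Pro.whiskerSquare (puncturedInclusion h hne) G) =
    Pro.reindex (punctured h hne) (OpenNhds.inclusion y ⋙ G) := by
  have : Pro.whiskerSquare (puncturedInclusion h hne) G =
      𝟙 (punctured h hne ⋙ OpenNhds.inclusion y ⋙ G) := by
    ext U
    exact G.map_id _
  refine (congrArg (fun t : punctured h hne ⋙ OpenNhds.inclusion y ⋙ G ⟶
    punctured h hne ⋙ OpenNhds.inclusion y ⋙ G => _ ≫ Pro.ofNatTrans t) this).trans ?_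
  exact Category.comp_id _

/-- The excision morphism in the form needed for `Pro.exists_isos_of_square_comparison`. -/
lemma excision_eq {x y : X} (h : y ⤳ x) (hne : y ≠ x) :
    excision p h hne = Pro.reindex (punctured h hne) (OpenNhds.inclusion y ⋙ quot p y ⋙
      toMotivicHo B) ≫ Pro.ofNatTrans (Pro.whiskerSquare (puncturedInclusion h hne)
        (quot p y ⋙ toMotivicHo B)) :=
  (reindex_punctured_comp (quot p y ⋙ toMotivicHo B) h hne).symm

/-- Replacing `X` by a Nisnevich neighbourhood does not change the pro-object at a point of this
neighbourhood. -/
lemma IsNisnevichNbhd.nonempty_localQuot_iso {y z : X} {v : V} (hN : IsNisnevichNbhd π y)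
    (hq : π ≫ p = q) (hyz : y ⤳ z) (hv : π v = z) :
    Nonempty (localQuot p z ≅ localQuot q v) := by
  have hz : ∀ w, z ⤳ π w → v ⤳ w := fun w hw =>
    hN.specializes (hv ▸ hyz) (hv ▸ hw)
  exact Pro.nonempty_iso_of_comparison (toMotivicHo B) (imageNhds_cofinal hN.isOpenMap hv)
    (quotTrans hq hN.isOpenMap hv hz) (isIso_map_quotTrans hq hN.isOpenMap hv hz hN hyz)

/-- Replacing `X` by a Nisnevich neighbourhood changes neither the pro-objects at `x` and `y` nor
the excision and connecting morphisms. -/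
lemma IsNisnevichNbhd.exists_isos {x y : X} {vx vy : V} (hN : IsNisnevichNbhd π y)
    (hq : π ≫ p = q) (hx : π vx = x) (hy : π vy = y) (h : y ⤳ x) (hne : y ≠ x) (hV : vy ⤳ vx)
    (hneV : vy ≠ vx) :
    ∃ (φx : localQuot p x ≅ localQuot q vx) (φy : localQuot p y ≅ localQuot q vy)
      (ψ : puncturedQuot p x y ≅ puncturedQuot q vx vy),
      excision p h hne ≫ ψ.hom = φy.hom ≫ excision q hV hneV ∧
      connecting p x y ≫ (Pro.map (motivicSusp B)).map ψ.hom =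
        φx.hom ≫ connecting q vx vy := by
  have hx' : ∀ w, x ⤳ π w → vx ⤳ w := fun w hw => hN.specializes (hx ▸ h) (hx ▸ hw)
  have hy' : ∀ w, y ⤳ π w → vy ⤳ w := fun w hw =>
    hN.specializes (hy ▸ specializes_rfl) (hy ▸ hw)
  have ho := hN.isOpenMap
  rw [excision_eq, excision_eq]
  refine Pro.exists_isos_of_square_comparison (motivicSusp B) (toMotivicHo B)
    (imageNhds_cofinal ho hx) (imageNhds_cofinal ho hy)
    (puncturedImage ho hx hx' hy h hne hV hneV) (puncturedInclusion h hne)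
    (puncturedInclusion hV hneV) (connectingHo p x y) (connectingHo q vx vy)
    (quotTrans hq ho hx hx') (quotTrans hq ho hy hy') (puncturedTrans hq ho hx hx' hy')
    (isIso_map_quotTrans hq ho hx hx' hN h) (isIso_map_quotTrans hq ho hy hy' hN specializes_rfl)
    (isIso_map_puncturedTrans hq ho hx hx' hy' hN hy) ?_ ?_
  · intro U
    have hU := minus_le_preimage π hx' (le_preimage_imageNhds ho hx U)
    refine (map_comp_quotMap π hq hy' (𝟙 ((minus vx).obj U.1)) hU hU).trans ?_
    exact (quotMap_comp_map π hq hy' (le_preimage_imageNhds ho hy ((punctured hV hneV).obj U))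
      _ hU).symm.trans (congrArg (_ ≫ ·) ((quot p y).map_comp _ _))
  · intro U
    exact (quotMap_comp_connectingHo hq hx' hy' (le_preimage_imageNhds ho hx U)).symm

end Neighbourhoods

end MotivicPairs

end

noncomputable section

namespace MotivicPairs

/-! ### Étale algebras cut out by functions -/

section EtaleQuotient

open TensorProduct KaehlerDifferential

variable {A P : Type*} [CommRing A] [CommRing P] [Algebra A P] {n : ℕ} (f : Fin n → P)
  (b : Module.Basis (Fin n) P (Ω[P⁄A]))

/-- The quotient by functions whose differentials form a basis is formally smooth, because the
conormal map `I / I² ⟶ (P ⧸ I) ⊗ Ω[P⁄A]` is a split injection: it is inverted by sending the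
basis element `D (f i)` to the class of `f i`. -/
lemma formallySmooth_quotient_of_basis [Algebra.FormallySmooth A P] (hb : ∀ i, b i = D A P (f i)) :
    Algebra.FormallySmooth A (P ⧸ Ideal.span (Set.range f)) := by
  set I := Ideal.span (Set.range f) with hI
  have hs : Function.Surjective (algebraMap P (P ⧸ I)) := Ideal.Quotient.mk_surjective
  have hk : RingHom.ker (algebraMap P (P ⧸ I)) = I := Ideal.mk_ker
  rw [Algebra.FormallySmooth.iff_split_injection (P := P) hs]
  have hf : ∀ i, f i ∈ RingHom.ker (algebraMap P (P ⧸ I)) := fun i => by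
    rw [hk]
    exact Ideal.subset_span ⟨i, rfl⟩
  let g : Ω[P⁄A] →ₗ[P] (RingHom.ker (algebraMap P (P ⧸ I))).Cotangent :=
    b.constr P fun i => Ideal.toCotangent _ ⟨f i, hf i⟩
  have hg : I • (⊤ : Submodule P (Ω[P⁄A])) ≤ LinearMap.ker g := by
    refine Submodule.smul_le.2 fun r hr m _ => ?_
    rw [LinearMap.mem_ker, map_smul]
    obtain ⟨x, hx⟩ := Ideal.toCotangent_surjective _ (g m)
    rw [← hx, ← map_smul, Ideal.toCotangent_eq_zero, pow_two]
    exact Ideal.mul_mem_mul (hk.ge hr) x.2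
  let l := (Submodule.liftQ _ g hg) ∘ₗ
    (TensorProduct.quotTensorEquivQuotSMul (Ω[P⁄A]) I).toLinearMap
  refine ⟨l, ?_⟩
  have key : ∀ x (hx : x ∈ I), ∀ h', (l ∘ₗ kerCotangentToTensor A P (P ⧸ I))
      (Ideal.toCotangent _ ⟨x, h'⟩) = Ideal.toCotangent _ ⟨x, h'⟩ := by
    intro x hx
    induction hx using Submodule.span_induction with
    | mem x hx =>
      obtain ⟨i, rfl⟩ := hx
      intro h'
      rw [LinearMap.comp_apply, kerCotangentToTensor_toCotangent]
      change Submodule.liftQ _ g hg ((TensorProduct.quotTensorEquivQuotSMul (Ω[P⁄A]) I)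
        (Ideal.Quotient.mk I 1 ⊗ₜ D A P (f i))) = _
      rw [TensorProduct.quotTensorEquivQuotSMul_mk_tmul, one_smul, Submodule.liftQ_apply,
        ← hb, Module.Basis.constr_basis]
    | zero =>
      intro h'
      exact (congrArg _ (map_zero (Ideal.toCotangent _))).trans
        ((map_zero _).trans (map_zero (Ideal.toCotangent _)).symm)
    | add x y hx hy ex ey =>
      intro h'
      have e : (⟨x + y, h'⟩ : RingHom.ker (algebraMap P (P ⧸ I))) =
        ⟨x, hk.ge hx⟩ + ⟨y, hk.ge hy⟩ := rfl
      rw [e, map_add, map_add, ex, ey]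
    | smul a x hx ex =>
      intro h'
      have e : (⟨a • x, h'⟩ : RingHom.ker (algebraMap P (P ⧸ I))) =
        a • ⟨x, hk.ge hx⟩ := rfl
      rw [e, map_smul, map_smul, ex]
  refine LinearMap.ext fun z => ?_
  obtain ⟨x, rfl⟩ := Ideal.toCotangent_surjective _ z
  exact key x.1 (hk.le x.2) x.2

lemma formallyUnramified_quotient_of_span
    (hb : ⊤ ≤ Submodule.span P (Set.range fun i => D A P (f i))) :
    Algebra.FormallyUnramified A (P ⧸ Ideal.span (Set.range f)) := by
  set I := Ideal.span (Set.range f) with hI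
  have hs : Function.Surjective (algebraMap P (P ⧸ I)) := Ideal.Quotient.mk_surjective
  refine ⟨⟨fun x y => ?_⟩⟩
  suffices h : ∀ m : Ω[P⁄A], KaehlerDifferential.map A A P (P ⧸ I) m = 0 by
    have hsurj := KaehlerDifferential.map_surjective_of_surjective A A P (P ⧸ I) hs
    obtain ⟨x, rfl⟩ := hsurj x
    obtain ⟨y, rfl⟩ := hsurj y
    rw [h, h]
  intro m
  have hm : m ∈ Submodule.span P (Set.range fun i => D A P (f i)) := hb trivial
  induction hm using Submodule.span_induction with
  | mem x hx =>
    obtain ⟨i, rfl⟩ := hx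
    rw [KaehlerDifferential.map_D]
    have : algebraMap P (P ⧸ I) (f i) = 0 :=
      Ideal.Quotient.eq_zero_iff_mem.2 (Ideal.subset_span ⟨i, rfl⟩)
    rw [this, map_zero]
  | zero => exact map_zero _
  | add x y _ _ ex ey => rw [map_add, ex, ey, add_zero]
  | smul a x _ ex => rw [map_smul, ex, smul_zero]

/-- If the differentials of the functions `f i` form a basis of the module of differentials of a
smooth algebra, then these functions cut out an étale algebra. -/
lemma etale_quotient_of_basis [Algebra.Smooth A P] (hb : ∀ i, b i = D A P (f i)) :
    Algebra.Etale A (P ⧸ Ideal.span (Set.range f)) := by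
  have h1 := formallySmooth_quotient_of_basis f b hb
  have h2 : Algebra.FormallyUnramified A (P ⧸ Ideal.span (Set.range f)) := by
    apply formallyUnramified_quotient_of_span
    rw [← funext hb]
    exact b.span_eq.ge
  have h3 : Algebra.FinitePresentation A (P ⧸ Ideal.span (Set.range f)) :=
    Algebra.FinitePresentation.quotient ⟨(Set.finite_range f).toFinset, by simp⟩
  exact ⟨Algebra.FormallyEtale.of_formallyUnramified_and_formallySmooth, h3⟩

end EtaleQuotient

section Avoidance

/-- A group is not the union of two proper subgroups. -/
lemma exists_notMem_of_ne_top {J : Type*} [AddGroup J] {H K : AddSubgroup J} (hH : H ≠ ⊤)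
    (hK : K ≠ ⊤) : ∃ x, x ∉ H ∧ x ∉ K := by
  have h1 : ∃ x, x ∉ H := by
    by_contra! h
    exact hH (eq_top_iff.2 fun x _ => h x)
  have h2 : ∃ x, x ∉ K := by
    by_contra! h
    exact hK (eq_top_iff.2 fun x _ => h x)
  obtain ⟨x, hx⟩ := h1
  obtain ⟨y, hy⟩ := h2
  by_cases hx' : x ∈ K
  · by_cases hy' : y ∈ H
    · refine ⟨x + y, fun h => hx ?_, fun h => hy ?_⟩
      · exact (H.add_mem_cancel_right hy').1 h
      · exact (K.add_mem_cancel_left hx').1 h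
    · exact ⟨y, hy', hy⟩
  · exact ⟨x, hx, hx'⟩

/-- If the values of two additive maps both span a vector space of dimension at least `n`, then some
`n` elements have linearly independent values under both maps. As additive subgroups are avoided
instead of subspaces, the field may be finite and the maps need not be linear. -/
lemma exists_linearIndependent_pair {J κ V : Type*} [AddGroup J] [Field κ] [AddCommGroup V]
    [Module κ V] (φ ψ : J →+ V) (hφ : Submodule.span κ (Set.range φ) = ⊤)
    (hψ : Submodule.span κ (Set.range ψ) = ⊤)
    {n : ℕ} (hV : n ≤ Module.finrank κ V) :
    ∃ f : Fin n → J, LinearIndependent κ (φ ∘ f) ∧ LinearIndependent κ (ψ ∘ f) := by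
  induction n with
  | zero => exact ⟨Fin.elim0, linearIndependent_empty_type, linearIndependent_empty_type⟩
  | succ n ih =>
    obtain ⟨f, hf, hf'⟩ := ih (n.le_succ.trans hV)
    have key : ∀ θ : J →+ V, Submodule.span κ (Set.range θ) = ⊤ →
        AddSubgroup.comap θ (Submodule.span κ (Set.range (θ ∘ f))).toAddSubgroup ≠ ⊤ := by
      intro θ hθ h
      have : Submodule.span κ (Set.range (θ ∘ f)) = ⊤ := by
        rw [eq_top_iff, ← hθ, Submodule.span_le]
        rintro _ ⟨x, rfl⟩
        exact h.ge (AddSubgroup.mem_top x)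
      have h2 := finrank_range_le_card (R := κ) (θ ∘ f)
      rw [Set.finrank, this, finrank_top, Fintype.card_fin] at h2
      omega
    obtain ⟨x, hx, hx'⟩ := exists_notMem_of_ne_top (key φ hφ) (key ψ hψ)
    refine ⟨Fin.snoc f x, ?_, ?_⟩
    · have e : φ ∘ (Fin.snoc f x : Fin (n + 1) → J) = Fin.snoc (φ ∘ f) (φ x) :=
        Fin.comp_snoc _ _ _
      rw [e, linearIndependent_finSnoc]
      exact ⟨hf, hx⟩
    · have e : ψ ∘ (Fin.snoc f x : Fin (n + 1) → J) = Fin.snoc (ψ ∘ f) (ψ x) :=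
        Fin.comp_snoc _ _ _
      rw [e, linearIndependent_finSnoc]
      exact ⟨hf', hx'⟩

end Avoidance

end MotivicPairs

end

noncomputable section

namespace MotivicPairs

/-! ### Étale correspondences between smooth algebras -/

section EtaleCorrespondence

open KaehlerDifferential

variable {A C : Type*} [CommRing A] [CommRing C] [Algebra A C] {n : ℕ}
  (b : Module.Basis (Fin n) C (Ω[C⁄A]))

/-- The differential of a function at a `κ`-valued point, in the coordinates given by a basis of
the module of differentials. -/
def differentialAt (κ : Type*) [Field κ] [Algebra C κ] : C →+ (Fin n → κ) :=
  (b.constr C fun i => (Pi.single i 1 : Fin n → κ)).toAddMonoidHom.comp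
    (D A C).toLinearMap.toAddMonoidHom

variable {κ : Type*} [Field κ] [Algebra C κ]

lemma differentialAt_apply (x : C) :
    differentialAt b κ x = b.constr C (fun i => (Pi.single i 1 : Fin n → κ)) (D A C x) := rfl

lemma differentialAt_eq (x : C) (i : Fin n) :
    differentialAt b κ x i = algebraMap C κ (b.repr (D A C x) i) := by
  rw [differentialAt_apply, Module.Basis.constr_apply_fintype, Finset.sum_apply,
    Finset.sum_eq_single i]
  · rw [Pi.smul_apply, Pi.single_eq_same, Algebra.smul_def, mul_one]
    rfl
  · intro j _ hj
    rw [Pi.smul_apply, Pi.single_eq_of_ne hj.symm, smul_zero]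
  · simp

lemma differentialAt_smul_sub (a s : A) (x : C) :
    differentialAt b κ (s • x - algebraMap A C a) =
      algebraMap C κ (algebraMap A C s) • differentialAt b κ x := by
  rw [differentialAt_apply, map_sub, Derivation.map_smul, Derivation.map_algebraMap, sub_zero,
    ← algebraMap_smul C s (D A C x), map_smul]
  exact (algebraMap_smul κ (algebraMap A C s) _).symm

/-- Let `J` be an ideal such that every function is, up to functions coming from the base which are
invertible at the given point, congruent to one coming from the base. Then the differentials of
the elements of `J` generate all of the cotangent space at the point. -/
lemma span_differentialAt (J : Ideal C)
    (hJ : ∀ x : C, ∃ a s : A, algebraMap C κ (algebraMap A C s) ≠ 0 ∧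
      s • x - algebraMap A C a ∈ J) :
    Submodule.span κ (Set.range
      ((differentialAt b κ).comp J.toAddSubgroup.subtype)) = ⊤ := by
  set W := Submodule.span κ (Set.range
      ((differentialAt b κ).comp J.toAddSubgroup.subtype)) with hW
  have h1 : ∀ x, differentialAt b κ x ∈ W := by
    intro x
    obtain ⟨a, s, hs, hx⟩ := hJ x
    have h : differentialAt b κ (s • x - algebraMap A C a) ∈ W :=
      Submodule.subset_span ⟨⟨_, hx⟩, rfl⟩
    rw [differentialAt_smul_sub] at h
    exact (W.smul_mem_iff hs).1 h
  have h2 : ∀ m : Ω[C⁄A], b.constr C (fun i => (Pi.single i 1 : Fin n → κ)) m ∈ W := by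
    intro m
    have hm : m ∈ Submodule.span C (Set.range (D A C)) := by
      rw [span_range_derivation]
      trivial
    induction hm using Submodule.span_induction with
    | mem x hx =>
      obtain ⟨y, rfl⟩ := hx
      exact h1 y
    | zero =>
      rw [map_zero]
      exact W.zero_mem
    | add x y _ _ hx hy =>
      rw [map_add]
      exact W.add_mem hx hy
    | smul a x _ hx =>
      rw [map_smul, ← algebraMap_smul κ a]
      exact W.smul_mem _ hx
  rw [eq_top_iff, ← (Pi.basisFun κ (Fin n)).span_eq, Submodule.span_le]
  rintro _ ⟨i, rfl⟩
  have := h2 (b i)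
  rw [Module.Basis.constr_basis] at this
  rw [Pi.basisFun_apply]
  exact this

/-- The Jacobian determinant does not vanish at a point at which the differentials are
independent. -/
lemma algebraMap_det_ne_zero (f : Fin n → C)
    (hf : LinearIndependent κ (differentialAt b κ ∘ f)) :
    algebraMap C κ (b.det fun i => D A C (f i)) ≠ 0 := by
  rw [Module.Basis.det_apply, RingHom.map_det]
  have h : ((algebraMap C κ).mapMatrix (b.toMatrix fun i => D A C (f i))).transpose =
      Matrix.of (differentialAt b κ ∘ f) := by
    ext i j
    exact (differentialAt_eq b (f i) j).symm
  rw [← Matrix.det_transpose, h]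
  refine IsUnit.ne_zero ?_
  rw [← Matrix.isUnit_iff_isUnit_det]
  exact Matrix.linearIndependent_rows_iff_isUnit.1 hf

/-- The closed subscheme defined by functions `f i`, in the open subscheme where `g` is
invertible. -/
abbrev LocalizedQuotient (f : Fin n → C) (g : C) : Type _ :=
  Localization.Away g ⧸ Ideal.span (Set.range fun i => algebraMap C (Localization.Away g) (f i))

/-- Functions cut out an étale scheme where their Jacobian determinant is invertible. -/
lemma etale_localizedQuotient [Algebra.Smooth A C] (f : Fin n → C) (g : C)
    (hg : (b.det fun i => D A C (f i)) ∣ g) : Algebra.Etale A (LocalizedQuotient f g) := by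
  let P := Localization.Away g
  have : Algebra.Etale C P := Algebra.Etale.of_isLocalizationAway g
  have : Algebra.Smooth A P := Algebra.Smooth.comp A C P
  let e : Module.Basis (Fin n) P (Ω[P⁄A]) :=
    b.ofIsLocalizedModule P (Submonoid.powers g) (KaehlerDifferential.map A A C P)
  have hm : e.toMatrix (fun i => D A P (algebraMap C P (f i))) =
      (algebraMap C P).mapMatrix (b.toMatrix fun i => D A C (f i)) := by
    ext i j
    rw [Module.Basis.toMatrix_apply, ← KaehlerDifferential.map_D A A C P,
      Module.Basis.ofIsLocalizedModule_repr_apply]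
    rfl
  have hu : IsUnit (e.det fun i => D A P (algebraMap C P (f i))) := by
    rw [Module.Basis.det_apply, hm, ← RingHom.map_det, ← Module.Basis.det_apply]
    exact isUnit_of_dvd_unit (map_dvd _ hg) (IsLocalization.Away.algebraMap_isUnit g)
  obtain ⟨hli, hsp⟩ := (Module.Basis.is_basis_iff_det e).2 hu
  exact etale_quotient_of_basis _ (Module.Basis.mk hli hsp.ge) fun i =>
    Module.Basis.mk_apply hli hsp.ge i

end EtaleCorrespondence

/-- Let `C` be smooth of the same relative dimension over two rings, and `c : C →+* O` a
homomorphism to a local ring, such that `Spec O` is a pro-open subscheme of a closed subscheme of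
the spectra of both base rings. Then `c` factors through an algebra which is étale over both
base rings. -/
lemma exists_etale_factorization {A A' C O : Type u} [CommRing A] [CommRing A'] [CommRing C]
    [CommRing O] [IsLocalRing O] [Algebra A C] [Algebra A' C] [Algebra.Smooth A C]
    [Algebra.Smooth A' C] {n : ℕ} (b : Module.Basis (Fin n) C (Ω[C⁄A]))
    (b' : Module.Basis (Fin n) C (Ω[C⁄A'])) (c : C →+* O)
    (h : ∀ o : O, ∃ a s : A, IsUnit (c (algebraMap A C s)) ∧
      c (algebraMap A C s) * o = c (algebraMap A C a))
    (h' : ∀ o : O, ∃ a s : A', IsUnit (c (algebraMap A' C s)) ∧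
      c (algebraMap A' C s) * o = c (algebraMap A' C a)) :
    ∃ (S : Type u) (_ : CommRing S) (i : C →+* S) (σ : S →+* O), σ.comp i = c ∧
      (i.comp (algebraMap A C)).Etale ∧ (i.comp (algebraMap A' C)).Etale := by
  let κ := IsLocalRing.ResidueField O
  let _ : Algebra C κ := ((IsLocalRing.residue O).comp c).toAlgebra
  let J := RingHom.ker c
  have hu : ∀ x : C, algebraMap C κ x ≠ 0 ↔ IsUnit (c x) := fun x =>
    IsLocalRing.residue_ne_zero_iff_isUnit _
  have hJ : ∀ x : C, ∃ a s : A, algebraMap C κ (algebraMap A C s) ≠ 0 ∧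
      s • x - algebraMap A C a ∈ J := by
    intro x
    obtain ⟨a, s, hs, e⟩ := h (c x)
    refine ⟨a, s, (hu _).2 hs, ?_⟩
    rw [RingHom.mem_ker, map_sub, Algebra.smul_def, map_mul, e, sub_self]
  have hJ' : ∀ x : C, ∃ a s : A', algebraMap C κ (algebraMap A' C s) ≠ 0 ∧
      s • x - algebraMap A' C a ∈ J := by
    intro x
    obtain ⟨a, s, hs, e⟩ := h' (c x)
    refine ⟨a, s, (hu _).2 hs, ?_⟩
    rw [RingHom.mem_ker, map_sub, Algebra.smul_def, map_mul, e, sub_self]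
  obtain ⟨f, hf, hf'⟩ := exists_linearIndependent_pair _ _ (span_differentialAt b J hJ)
    (span_differentialAt b' J hJ') (n := n) (by rw [Module.finrank_fin_fun])
  let F : Fin n → C := fun i => (f i).1
  have hg := algebraMap_det_ne_zero b F hf
  have hg' := algebraMap_det_ne_zero b' F hf'
  -- the open subscheme on which the differentials are a basis over both base rings
  let g := (b.det fun i => KaehlerDifferential.D A C (F i)) *
    (b'.det fun i => KaehlerDifferential.D A' C (F i))
  have hcg : IsUnit (c g) := by
    rw [← hu, map_mul]
    exact mul_ne_zero hg hg'
  have e1 := etale_localizedQuotient b F g (Dvd.intro _ rfl)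
  have e2 := etale_localizedQuotient b' F g (Dvd.intro_left _ rfl)
  let σ₀ : Localization.Away g →+* O := IsLocalization.Away.lift g hcg
  have hσ₀ : ∀ x, σ₀ (algebraMap C _ x) = c x := fun x => IsLocalization.Away.lift_eq g hcg x
  refine ⟨LocalizedQuotient F g, inferInstance,
    (Ideal.Quotient.mk _).comp (algebraMap C (Localization.Away g)),
    Ideal.Quotient.lift _ σ₀ ?_, ?_, ?_, ?_⟩
  · intro x hx
    have : Ideal.span (Set.range fun i => algebraMap C (Localization.Away g) (F i)) ≤
        RingHom.ker σ₀ := by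
      rw [Ideal.span_le]
      rintro _ ⟨i, rfl⟩
      change σ₀ _ = 0
      rw [hσ₀]
      exact (f i).2
    exact this hx
  · ext x
    exact hσ₀ x
  · rw [← RingHom.etale_algebraMap] at e1
    exact e1
  · rw [← RingHom.etale_algebraMap] at e2
    exact e2

end MotivicPairs

end

noncomputable section

namespace MotivicPairs

/-! ### Isolating a section of an étale algebra -/

section Isolating

open TensorProduct

/-- The kernel of a section of an étale algebra is generated by an idempotent. -/
lemma exists_idempotent_of_section {D T : Type*} [CommRing D] [CommRing T] [Algebra D T]
    [Algebra.Etale D T] (τ : T →ₐ[D] D) :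
    ∃ e : T, IsIdempotentElem e ∧ RingHom.ker τ = Ideal.span {e} := by
  let _ : Algebra T D := τ.toRingHom.toAlgebra
  have : IsScalarTower D T D := IsScalarTower.of_algebraMap_eq fun d => (τ.commutes d).symm
  have h1 : Algebra.Etale T D := Algebra.Etale.of_restrictScalars D T D
  have hs : Function.Surjective (algebraMap T D) := fun d => ⟨algebraMap D T d, τ.commutes d⟩
  have h2 := (Algebra.FormallyEtale.iff_of_surjective hs).1 h1.formallyEtale
  have h3 : (RingHom.ker (algebraMap T D)).FG :=
    Algebra.FinitePresentation.ker_fG_of_surjective (Algebra.ofId T D) hs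
  exact (Ideal.isIdempotentElem_iff_of_fg _ h3).1 h2

variable {A S O : Type*} [CommRing A] [CommRing S] [CommRing O] [Algebra A S] [Algebra A O]

lemma exists_common_denominator
    (h : ∀ o : O, ∃ a s : A, IsUnit (algebraMap A O s) ∧ algebraMap A O s * o = algebraMap A O a)
    (s : Finset O) : ∃ t : A, IsUnit (algebraMap A O t) ∧
      ∀ o ∈ s, ∃ a, algebraMap A O t * o = algebraMap A O a := by
  classical
  induction s using Finset.induction_on with
  | empty => exact ⟨1, by simp, by simp⟩
  | insert o s _ ih =>
    obtain ⟨t, ht, ht'⟩ := ih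
    obtain ⟨a, r, hr, e⟩ := h o
    refine ⟨t * r, by rw [map_mul]; exact ht.mul hr, fun o' ho' => ?_⟩
    rcases Finset.mem_insert.1 ho' with rfl | ho'
    · exact ⟨t * a, by rw [map_mul, map_mul, mul_assoc, e]⟩
    · obtain ⟨a', e'⟩ := ht' o' ho'
      exact ⟨r * a', by rw [map_mul, map_mul, mul_comm (algebraMap A O t), mul_assoc, e']⟩

/-- The localization at `t` of the image of `A` in `O`: the functions on the locus where `t` is
invertible in the closure of the image of `Spec O` in `Spec A`. -/
abbrev LocalizedImage (O : Type*) [CommRing O] [Algebra A O] (t : A) : Type _ :=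
  Localization.Away (Ideal.Quotient.mk (RingHom.ker (algebraMap A O)) t)

lemma LocalizedImage.exists_pow_smul (t : A) (d : LocalizedImage O t) :
    ∃ (k : ℕ) (a : A), t ^ k • d = algebraMap A _ a := by
  obtain ⟨k, y, e⟩ := IsLocalization.Away.surj
    (Ideal.Quotient.mk (RingHom.ker (algebraMap A O)) t) d
  obtain ⟨a, rfl⟩ := Ideal.Quotient.mk_surjective y
  refine ⟨k, a, ?_⟩
  rw [Algebra.smul_def, mul_comm, map_pow]
  exact e

lemma LocalizedImage.exists_pow_smul_tmul (t : A) (x : LocalizedImage O t ⊗[A] S) :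
    ∃ (k : ℕ) (s : S), t ^ k • x = 1 ⊗ₜ s := by
  induction x with
  | zero => exact ⟨0, 0, by simp⟩
  | tmul d s =>
    obtain ⟨k, a, e⟩ := exists_pow_smul t d
    refine ⟨k, a • s, ?_⟩
    rw [smul_tmul', e, Algebra.algebraMap_eq_smul_one, smul_tmul]
  | add x y hx hy =>
    obtain ⟨k, s, e⟩ := hx
    obtain ⟨l, r, e'⟩ := hy
    refine ⟨k + l, t ^ l • s + t ^ k • r, ?_⟩
    rw [smul_add, tmul_add, tmul_smul, tmul_smul, ← e, ← e', smul_smul, smul_smul, pow_add,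
      mul_comm (t ^ l)]

/-- The structure map of an algebra `K`, as a homomorphism out of the localized image of `A` in
`O`. -/
def LocalizedImage.lift {K : Type*} [CommRing K] [Algebra A K] (t : A)
    (hK : ∀ a, algebraMap A O a = 0 → algebraMap A K a = 0) (ht : IsUnit (algebraMap A K t)) :
    LocalizedImage O t →ₐ[A] K :=
  { IsLocalization.Away.lift (S := LocalizedImage O t)
      (Ideal.Quotient.mk (RingHom.ker (algebraMap A O)) t)
      (g := Ideal.Quotient.lift (RingHom.ker (algebraMap A O)) (algebraMap A K) hK) ht with
    commutes' := fun a => IsLocalization.Away.lift_eq (S := LocalizedImage O t)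
      (Ideal.Quotient.mk (RingHom.ker (algebraMap A O)) t)
      (g := Ideal.Quotient.lift (RingHom.ker (algebraMap A O)) (algebraMap A K) hK) ht
      (Ideal.Quotient.mk _ a) }

lemma LocalizedImage.lift_injective (t : A) (ht : IsUnit (algebraMap A O t)) :
    Function.Injective (LocalizedImage.lift (O := O) t (fun _ h => h) ht) := by
  rw [injective_iff_map_eq_zero]
  intro d hd
  obtain ⟨k, a, e⟩ := exists_pow_smul t d
  have h := congrArg (LocalizedImage.lift (O := O) t (fun _ h => h) ht) e
  rw [map_smul, hd, smul_zero, AlgHom.commutes] at h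
  have h2 : algebraMap A (LocalizedImage O t) a = 0 := by
    have h3 : Ideal.Quotient.mk (RingHom.ker (algebraMap A O)) a = 0 :=
      Ideal.Quotient.eq_zero_iff_mem.2 h.symm
    exact (congrArg (algebraMap (A ⧸ RingHom.ker (algebraMap A O)) (LocalizedImage O t)) h3).trans
      (map_zero _)
  rw [h2, Algebra.smul_def, map_pow] at e
  have hu : IsUnit (algebraMap A (LocalizedImage O t) t) :=
    IsLocalization.Away.algebraMap_isUnit (Ideal.Quotient.mk (RingHom.ker (algebraMap A O)) t)
  exact (hu.pow k).mul_right_eq_zero.1 e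

/-- Let `S` be an étale `A`-algebra with a homomorphism to `O`, where `Spec O` is a pro-open
subscheme of a closed subscheme `Z` of `Spec A`. Then `Spec S` has a neighbourhood of the image of
`Spec O` in which the points over `Z` are determined by their images, and lift uniquely. -/
lemma exists_isolating_element [Algebra.Etale A S] (σ : S →ₐ[A] O)
    (h : ∀ o : O, ∃ a s : A, IsUnit (algebraMap A O s) ∧
      algebraMap A O s * o = algebraMap A O a) :
    ∃ s : S, IsUnit (σ s) ∧ ∀ (K : Type u) [Field K] [Algebra A K],
      (∀ a, algebraMap A O a = 0 → algebraMap A K a = 0) →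
      (∀ β β' : S →ₐ[A] K, β s ≠ 0 → β' s ≠ 0 → β = β') ∧
      ∀ q : Ideal S, q.IsPrime → s ∉ q → q.comap (algebraMap A S) = RingHom.ker (algebraMap A K) →
        ∃ β : S →ₐ[A] K, β s ≠ 0 := by
  classical
  obtain ⟨gen, hgen⟩ := (inferInstance : Algebra.FiniteType A S).out
  obtain ⟨t, ht, hd⟩ := exists_common_denominator h (gen.image σ)
  -- `σ` factors through a homomorphism `σ'` to `D`, which is a section over `Spec D` of the étale
  -- algebra `D ⊗[A] S`; the element `s` is a lift to `S` of a power of `t` times `1 - e`, where the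
  -- idempotent `e` vanishes exactly on this section
  let D := LocalizedImage O t
  let j : D →ₐ[A] O := LocalizedImage.lift t (fun _ h => h) ht
  have hj : Function.Injective j := LocalizedImage.lift_injective t ht
  have htD : IsUnit (algebraMap A D t) :=
    IsLocalization.Away.algebraMap_isUnit (Ideal.Quotient.mk (RingHom.ker (algebraMap A O)) t)
  have hrange : ∀ x, σ x ∈ j.range := by
    have : (⊤ : Subalgebra A S) ≤ j.range.comap σ := by
      rw [← hgen, Algebra.adjoin_le_iff]
      intro x hx
      obtain ⟨a, e⟩ := hd (σ x) (Finset.mem_image_of_mem σ hx)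
      obtain ⟨r, hr⟩ := htD.exists_right_inv
      refine ⟨r * algebraMap A D a, ?_⟩
      change j _ = σ x
      rw [map_mul, AlgHom.commutes, ← e, ← AlgHom.commutes j t, ← mul_assoc, ← map_mul, mul_comm r,
        hr, map_one, one_mul]
    exact fun x => this trivial
  let σ' : S →ₐ[A] D := (AlgEquiv.ofInjective j hj).symm.toAlgHom.comp (σ.codRestrict _ hrange)
  have hσ' : ∀ x, j (σ' x) = σ x := fun x =>
    congrArg Subtype.val ((AlgEquiv.ofInjective j hj).apply_symm_apply ⟨σ x, hrange x⟩)
  let τ : D ⊗[A] S →ₐ[D] D := Algebra.TensorProduct.lift (AlgHom.id D D) σ' fun _ _ => mul_comm _ _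
  have hτ : ∀ d x, τ (d ⊗ₜ x) = d * σ' x := fun d x =>
    Algebra.TensorProduct.lift_tmul _ _ _ _ _
  obtain ⟨e, he, hker⟩ := exists_idempotent_of_section τ
  have hτe : τ e = 0 := by
    have : e ∈ RingHom.ker τ := hker ▸ Ideal.mem_span_singleton_self e
    exact this
  obtain ⟨k, s, hs⟩ := LocalizedImage.exists_pow_smul_tmul t (1 - e)
  have hσs : σ' s = algebraMap A D (t ^ k) := by
    have := congrArg τ hs
    rw [hτ, one_mul, ← IsScalarTower.algebraMap_smul D, map_smul, map_sub, hτe, map_one, sub_zero,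
      smul_eq_mul, mul_one] at this
    exact this.symm
  have hσs' : σ' (algebraMap A S t * s) = algebraMap A D (t ^ (k + 1)) := by
    rw [map_mul, hσs, AlgHom.commutes, ← map_mul, pow_succ']
  refine ⟨algebraMap A S t * s, ?_, ?_⟩
  · rw [← hσ', hσs', AlgHom.commutes, map_pow]
    exact ht.pow _
  intro K _ _ hK
  constructor
  · have key : ∀ (htK : IsUnit (algebraMap A K t)) (β : S →ₐ[A] K), β (algebraMap A S t * s) ≠ 0 →
        ∀ x, β x = LocalizedImage.lift t hK htK (σ' x) := by
      intro htK β hβ x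
      let Θ : D ⊗[A] S →ₐ[A] K := Algebra.TensorProduct.lift (LocalizedImage.lift t hK htK) β
        fun _ _ => mul_comm _ _
      have hΘ : ∀ d x, Θ (d ⊗ₜ x) = LocalizedImage.lift t hK htK d * β x := fun d x =>
        Algebra.TensorProduct.lift_tmul _ _ _ _ _
      have h1 : Θ (1 - e) ≠ 0 := by
        intro h0
        have := congrArg Θ hs
        rw [map_smul, h0, smul_zero, hΘ, map_one, one_mul] at this
        rw [map_mul, ← this, mul_zero] at hβ
        exact hβ rfl
      have h2 : Θ e = 0 := by
        have : Θ e * Θ (1 - e) = 0 := by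
          rw [← map_mul, mul_sub, mul_one, he.eq, sub_self, map_zero]
        exact (mul_eq_zero.1 this).resolve_right h1
      have h3 : (1 : D) ⊗ₜ[A] x - σ' x ⊗ₜ 1 ∈ RingHom.ker τ := by
        rw [RingHom.mem_ker, map_sub, hτ, hτ, map_one, one_mul, mul_one, sub_self]
      rw [hker, Ideal.mem_span_singleton] at h3
      obtain ⟨z, hz⟩ := h3
      have h4 := congrArg Θ hz
      rw [map_mul, h2, zero_mul, map_sub, hΘ, hΘ, map_one, map_one, one_mul, mul_one] at h4
      exact sub_eq_zero.1 h4
    intro β β' hβ hβ'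
    have htK : IsUnit (algebraMap A K t) := by
      rw [isUnit_iff_ne_zero]
      intro h0
      rw [map_mul, AlgHom.commutes, h0, zero_mul] at hβ
      exact hβ rfl
    ext x
    rw [key htK β hβ, key htK β' hβ']
  · intro q _ hq hqK
    have htK : algebraMap A K t ≠ 0 := by
      intro h0
      have : t ∈ q.comap (algebraMap A S) := hqK ▸ h0
      exact hq (q.mul_mem_right _ this)
    refine ⟨(LocalizedImage.lift t hK (isUnit_iff_ne_zero.2 htK)).comp σ', ?_⟩
    rw [AlgHom.comp_apply, hσs', AlgHom.commutes, map_pow]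
    exact pow_ne_zero _ htK

end Isolating

end MotivicPairs

end

noncomputable section

namespace MotivicPairs

open AlgebraicGeometry TopologicalSpace

/-! ### Nisnevich neighbourhoods of local schemes, and standard smooth charts -/

section NisnevichNbhd

variable {V X : Scheme.{u}} {π : V ⟶ X} {y : X}

lemma IsNisnevichNbhd.isOpenImmersion_comp (hN : IsNisnevichNbhd π y) {U : Scheme.{u}} (k : U ⟶ V)
    [IsOpenImmersion k] : IsNisnevichNbhd (k ≫ π) y where
  etale := by
    have := hN.etale
    infer_instance
  uniq K _ b b' h e := by
    rw [← cancel_mono k]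
    exact hN.uniq K _ _ (by simpa only [Category.assoc] using h)
      (by simpa only [Category.assoc] using e)
  exists_lift K _ a v ha h := by
    rw [Scheme.Hom.comp_apply] at h
    obtain ⟨b, hb⟩ := hN.exists_lift K a (k v) (fun t => by rw [ha, Scheme.Hom.comp_apply]) h
    have hr : Set.range b ⊆ Set.range k := by
      rintro _ ⟨t, rfl⟩
      refine ⟨v, hN.eq_of_apply_eq ?_ h⟩
      rw [← Scheme.Hom.comp_apply b π, hb, ha, Scheme.Hom.comp_apply]
    refine ⟨IsOpenImmersion.lift k b hr, ?_⟩
    rw [IsOpenImmersion.lift_fac_assoc, hb]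

lemma IsNisnevichNbhd.comp_isOpenImmersion {Y : Scheme.{u}} (hN : IsNisnevichNbhd π y)
    (i : X ⟶ Y) [IsOpenImmersion i] : IsNisnevichNbhd (π ≫ i) (i y) where
  etale := by
    have := hN.etale
    infer_instance
  uniq K _ b b' h e := by
    refine hN.uniq K b b' (fun t => ?_) ?_
    · refine i.isOpenEmbedding.isInducing.specializes_iff.1 ?_
      have := h t
      rwa [← Category.assoc, Scheme.Hom.comp_apply] at this
    · rw [← cancel_mono i, Category.assoc, Category.assoc, e]
  exists_lift K _ a v ha h := by
    have hr : Set.range a ⊆ Set.range i := by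
      rintro _ ⟨t, rfl⟩
      rw [ha, Scheme.Hom.comp_apply]
      exact ⟨_, rfl⟩
    obtain ⟨b, hb⟩ := hN.exists_lift K (IsOpenImmersion.lift i a hr) v (fun t => by
      apply i.isOpenEmbedding.injective
      rw [← Scheme.Hom.comp_apply, IsOpenImmersion.lift_fac, ha, Scheme.Hom.comp_apply])
      (i.isOpenEmbedding.isInducing.specializes_iff.1 (by rwa [Scheme.Hom.comp_apply] at h))
    refine ⟨b, ?_⟩
    rw [← Category.assoc, hb, IsOpenImmersion.lift_fac]

/-- If `Spec O` is a pro-open subscheme of a closed subscheme of `Spec A`, and lifts to an étale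
scheme `Spec S` over `Spec A`, then some open neighbourhood of it in `Spec S` is a Nisnevich
neighbourhood. -/
lemma exists_isNisnevichNbhd_specMap {A S O : CommRingCat.{u}} [IsDomain O] (f : A ⟶ S)
    (hf : f.hom.Etale) (σ : S ⟶ O)
    (h : ∀ o : O, ∃ a s : A, IsUnit ((f ≫ σ).hom s) ∧ (f ≫ σ).hom s * o = (f ≫ σ).hom a) :
    ∃ U : (Spec S).Opens, Set.range (Spec.map σ) ⊆ U ∧
      IsNisnevichNbhd (U.ι ≫ Spec.map f) (Spec.map (f ≫ σ) (⊥ : PrimeSpectrum O)) := by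
  let _ : Algebra A S := f.hom.toAlgebra
  let _ : Algebra A O := (f ≫ σ).hom.toAlgebra
  have : Algebra.Etale A S := hf
  let σ' : S →ₐ[A] O := { σ.hom with commutes' := fun _ => rfl }
  obtain ⟨s, hs, H⟩ := exists_isolating_element σ' h
  obtain ⟨U, hU⟩ : ∃ U : (Spec S).Opens, ∀ t : PrimeSpectrum S, t ∈ U ↔ s ∉ t.asIdeal :=
    ⟨PrimeSpectrum.basicOpen s, fun _ => Iff.rfl⟩
  refine ⟨U, ?_, ?_, ?_, ?_⟩
  · rintro _ ⟨t, rfl⟩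
    exact (hU _).2 fun h0 => (show PrimeSpectrum O from t).2.ne_top
      (Ideal.eq_top_of_isUnit_mem _ h0 hs)
  · have : Etale (Spec.map f) := (HasRingHomProperty.Spec_iff (P := @Etale)).2 hf
    infer_instance
  · intro K _ b b' hb e
    obtain ⟨β, hβ⟩ := Spec.map_surjective (b ≫ U.ι)
    obtain ⟨β', hβ'⟩ := Spec.map_surjective (b' ≫ U.ι)
    have e1 : f ≫ β = f ≫ β' := by
      apply Spec.map_injective
      rw [Spec.map_comp, Spec.map_comp, hβ, hβ']
      simpa only [Category.assoc] using e
    let _ : Algebra A K := (f ≫ β).hom.toAlgebra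
    have hK : ∀ a, algebraMap A O a = 0 → algebraMap A K a = 0 := by
      intro a ha
      have h1 := hb (⊥ : PrimeSpectrum K)
      rw [← Category.assoc, ← hβ, ← Spec.map_comp] at h1
      have h2 := (PrimeSpectrum.le_iff_specializes _ _).2 h1
      exact h2 (show a ∈ _ from ha)
    have hs1 : ∀ (c : Spec (.of K) ⟶ U.toScheme)
        (γ : S ⟶ .of K), Spec.map γ = c ≫ U.ι → γ.hom s ≠ 0 := by
      intro c γ hc h0
      have h1 : Spec.map γ (⊥ : PrimeSpectrum K) ∈ U := by
        rw [hc]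
        exact (c (⊥ : PrimeSpectrum K)).2
      exact (hU _).1 h1 h0
    have := (H K hK).1 { β.hom with commutes' := fun _ => rfl }
      { β'.hom with commutes' := fun a => (congrArg (fun g => g.hom a) e1).symm }
      (hs1 b β hβ) (hs1 b' β' hβ')
    have e2 : β = β' := by
      ext x
      exact congrArg (fun g => g x) this
    rw [← cancel_mono (U.ι), ← hβ, ← hβ', e2]
  · intro K _ a v ha hv
    obtain ⟨α, rfl⟩ := Spec.map_surjective a
    let _ : Algebra A K := α.hom.toAlgebra
    have h0 := ha (⊥ : PrimeSpectrum K)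
    have hK : ∀ a, algebraMap A O a = 0 → algebraMap A K a = 0 := by
      intro a ha
      rw [← h0] at hv
      have h2 := (PrimeSpectrum.le_iff_specializes _ _).2 hv
      exact h2 (show a ∈ _ from ha)
    obtain ⟨β, hβ⟩ := (H K hK).2 (show PrimeSpectrum S from U.ι v).asIdeal
      (show PrimeSpectrum S from U.ι v).2 ((hU _).1 v.2) (congrArg PrimeSpectrum.asIdeal h0).symm
    let β' : S ⟶ .of K := CommRingCat.ofHom β.toRingHom
    have hr : Set.range (Spec.map β') ⊆
        Set.range (U.ι) := by
      rw [Scheme.Opens.range_ι]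
      rintro _ ⟨t, rfl⟩
      obtain rfl : t = (⊥ : PrimeSpectrum K) := Subsingleton.elim _ _
      exact (hU _).2 hβ
    refine ⟨IsOpenImmersion.lift _ (Spec.map β') hr, ?_⟩
    rw [IsOpenImmersion.lift_fac_assoc, ← Spec.map_comp]
    congr 1
    ext x
    exact β.commutes x

end NisnevichNbhd

section Charts

variable {X B : Scheme.{u}}

lemma exists_standardSmooth_chart_of_smoothOfRelativeDimension (p : X ⟶ B) (n : ℕ)
    [SmoothOfRelativeDimension n p] (x : X) {R : CommRingCat.{u}} (j : Spec R ⟶ B)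
    [IsOpenImmersion j] (hx : p x ∈ Set.range j) :
    ∃ (A : CommRingCat.{u}) (φ : R ⟶ A) (i : Spec A ⟶ X), IsOpenImmersion i ∧ x ∈ Set.range i ∧
      i ≫ p = Spec.map φ ≫ j ∧ φ.hom.IsStandardSmoothOfRelativeDimension n := by
  obtain ⟨r, hr⟩ := hx
  obtain ⟨z, hz, -⟩ := Scheme.Pullback.exists_preimage_pullback x r hr.symm
  have h1 : SmoothOfRelativeDimension n (pullback.snd p j) :=
    (smoothOfRelativeDimension_isStableUnderBaseChange n).of_isPullback
      (IsPullback.of_hasPullback p j) ‹_›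
  obtain ⟨A, k, hk, hzk⟩ : ∃ (A : CommRingCat.{u}) (k : Spec A ⟶ pullback p j),
      IsOpenImmersion k ∧ z ∈ Set.range k :=
    ⟨_, (pullback p j).affineCover.f ((pullback p j).affineCover.idx z),
      (pullback p j).affineCover.map_prop _,
      (pullback p j).affineCover.covers z⟩
  have h2 : SmoothOfRelativeDimension n (k ≫ pullback.snd p j) := by
    have := smoothOfRelativeDimension_comp (n := 0) (m := n) k (pullback.snd p j)
    rwa [zero_add] at this
  obtain ⟨φ, hφ⟩ := Spec.map_surjective (k ≫ pullback.snd p j)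
  rw [← hφ, HasRingHomProperty.Spec_iff (P := @SmoothOfRelativeDimension n)] at h2
  obtain ⟨s, hs, H⟩ := h2
  obtain ⟨w, hw⟩ := hzk
  obtain ⟨t, ht, hwt⟩ : ∃ t ∈ s, t ∉ (show PrimeSpectrum A from w).asIdeal := by
    by_contra! hc
    refine (show PrimeSpectrum A from w).2.ne_top ?_
    rw [← top_le_iff, ← hs, Ideal.span_le]
    exact hc
  let l : A ⟶ .of (Localization.Away t) := CommRingCat.ofHom (algebraMap A _)
  have hl : IsOpenImmersion (Spec.map l) :=
    inferInstanceAs (IsOpenImmersion (Spec.map (CommRingCat.ofHom (algebraMap A _))))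
  refine ⟨.of (Localization.Away t), φ ≫ l, Spec.map l ≫ k ≫ pullback.fst p j, inferInstance,
    ?_, ?_, H t ht⟩
  · have : w ∈ Set.range (Spec.map l) := by
      have := PrimeSpectrum.localization_away_comap_range (Localization.Away t) t
      exact this.ge hwt
    obtain ⟨w', rfl⟩ := this
    refine ⟨w', ?_⟩
    rw [Scheme.Hom.comp_apply, Scheme.Hom.comp_apply, hw, hz]
  · rw [Spec.map_comp, hφ, Category.assoc, Category.assoc, Category.assoc, Category.assoc,
      pullback.condition]

/-- A smooth `B`-scheme of relative dimension `n` at `x` has a chart around `x` which is standard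
smooth of relative dimension `n` over a given chart of `B`. -/
lemma exists_standardSmooth_chart (p : X ⟶ B) {x : X} {n : ℕ} (hn : HasRelativeDimensionAt p x n)
    {R : CommRingCat.{u}} (j : Spec R ⟶ B) [IsOpenImmersion j] (hx : p x ∈ Set.range j) :
    ∃ (A : CommRingCat.{u}) (φ : R ⟶ A) (i : Spec A ⟶ X), IsOpenImmersion i ∧ x ∈ Set.range i ∧
      i ≫ p = Spec.map φ ≫ j ∧ φ.hom.IsStandardSmoothOfRelativeDimension n := by
  obtain ⟨U, hxU, hU⟩ := hn
  obtain ⟨A, φ, i, hi, ⟨w, hw⟩, e, hφ⟩ :=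
    exists_standardSmooth_chart_of_smoothOfRelativeDimension (U.ι ≫ p) n ⟨x, hxU⟩ j hx
  refine ⟨A, φ, i ≫ U.ι, inferInstance, ⟨w, ?_⟩, by rw [Category.assoc, e], hφ⟩
  rw [Scheme.Hom.comp_apply, hw]
  rfl

end Charts

end MotivicPairs

end

noncomputable section

namespace MotivicPairs

open AlgebraicGeometry TopologicalSpace

/-! ### Common Nisnevich neighbourhoods -/

section Roof

/-- A morphism from a local scheme factors through any affine chart containing the image of the
closed point. -/
lemma exists_specMap_comp_eq {X : Scheme.{u}} {A O : CommRingCat.{u}} [IsLocalRing O]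
    (γ : Spec O ⟶ X) (i : Spec A ⟶ X) [IsOpenImmersion i]
    (h : γ (IsLocalRing.closedPoint O) ∈ Set.range i) : ∃ α : A ⟶ O, Spec.map α ≫ i = γ := by
  have hr : Set.range γ ⊆ Set.range i := by
    rintro _ ⟨t, rfl⟩
    exact ((IsLocalRing.specializes_closedPoint (R := O) t).map γ.continuous).mem_open
      i.isOpenEmbedding.isOpen_range h
  obtain ⟨α, hα⟩ := Spec.map_surjective (IsOpenImmersion.lift i γ hr)
  exact ⟨α, by rw [hα, IsOpenImmersion.lift_fac]⟩

/-- If `Spec O ⟶ Spec A` is surjective on stalks, every element of the local ring `O` is a fraction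
of elements of `A`. -/
lemma exists_fraction_of_surjectiveOnStalks {A O : Type*} [CommRing A] [CommRing O]
    [IsLocalRing O] {α : A →+* O} (h : α.SurjectiveOnStalks) (o : O) :
    ∃ a s : A, IsUnit (α s) ∧ α s * o = α a := by
  obtain ⟨x, r, c, hc, hr, e⟩ := (RingHom.surjective_localRingHom_iff _).1
    (h (IsLocalRing.maximalIdeal O) inferInstance) o
  rw [IsLocalRing.mem_maximalIdeal, mem_nonunits_iff, not_not] at hc hr
  exact ⟨x, r, hr, hc.mul_right_injective (by simpa only [mul_assoc] using e)⟩

lemma nonempty_basis_kaehlerDifferential {A C : Type*} [CommRing A] [CommRing C] [Nontrivial C]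
    [Algebra A C] (n : ℕ) [Algebra.IsStandardSmoothOfRelativeDimension n A C] :
    Nonempty (Module.Basis (Fin n) C (Ω[C⁄A])) := by
  have := Algebra.IsStandardSmoothOfRelativeDimension.isStandardSmooth (R := A) (S := C) n
  refine ⟨Module.finBasisOfFinrankEq C (Ω[C⁄A]) ?_⟩
  have := Algebra.IsStandardSmoothOfRelativeDimension.rank_kaehlerDifferential (R := A) (S := C) n
  exact Module.finrank_eq_of_rank_eq this

/-- Two smooth `B`-schemes of the same relative dimension at the image of the closed point of
`Spec O`, which both contain the local scheme `Spec O` as a pro-open subscheme of a closed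
subscheme, have a common Nisnevich neighbourhood of this subscheme. -/
lemma exists_common_nisnevichNbhd {B X X' : Scheme.{u}} (p : X ⟶ B) (p' : X' ⟶ B)
    {O : CommRingCat.{u}} [IsDomain O] [IsLocalRing O] (γ : Spec O ⟶ X) (γ' : Spec O ⟶ X')
    [SurjectiveOnStalks γ] [SurjectiveOnStalks γ'] (e : γ ≫ p = γ' ≫ p') {n : ℕ}
    (hn : HasRelativeDimensionAt p (γ (IsLocalRing.closedPoint O)) n)
    (hn' : HasRelativeDimensionAt p' (γ' (IsLocalRing.closedPoint O)) n) :
    ∃ (V : Scheme.{u}) (π : V ⟶ X) (π' : V ⟶ X') (ζ : Spec O ⟶ V), ζ ≫ π = γ ∧ ζ ≫ π' = γ' ∧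
      π ≫ p = π' ≫ p' ∧ IsNisnevichNbhd π (γ (⊥ : PrimeSpectrum O)) ∧
      IsNisnevichNbhd π' (γ' (⊥ : PrimeSpectrum O)) := by
  let z : B := p (γ (IsLocalRing.closedPoint O))
  have hz : p' (γ' (IsLocalRing.closedPoint O)) = z :=
    congrArg (fun g : Spec O ⟶ B => g (IsLocalRing.closedPoint O)) e.symm
  obtain ⟨R, j, hj, hzj⟩ : ∃ (R : CommRingCat.{u}) (j : Spec R ⟶ B),
      IsOpenImmersion j ∧ z ∈ Set.range j :=
    ⟨_, B.affineCover.f (B.affineCover.idx z), B.affineCover.map_prop _, B.affineCover.covers z⟩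
  obtain ⟨A, φ, i, hi, hxi, hip, hφ⟩ := exists_standardSmooth_chart p hn j hzj
  obtain ⟨A', φ', i', hi', hxi', hip', hφ'⟩ := exists_standardSmooth_chart p' hn' j (hz ▸ hzj)
  obtain ⟨α, hα⟩ := exists_specMap_comp_eq γ i hxi
  obtain ⟨α', hα'⟩ := exists_specMap_comp_eq γ' i' hxi'
  have hαα' : φ ≫ α = φ' ≫ α' := by
    apply Spec.map_injective
    rw [← cancel_mono j, Spec.map_comp, Spec.map_comp, Category.assoc, Category.assoc, ← hip,
      ← hip', ← Category.assoc, ← Category.assoc, hα, hα', e]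
  have hsα : α.hom.SurjectiveOnStalks := by
    have : SurjectiveOnStalks (Spec.map α ≫ i) := by rwa [hα]
    exact SurjectiveOnStalks.Spec_iff.1 (SurjectiveOnStalks.of_comp (Spec.map α) i)
  have hsα' : α'.hom.SurjectiveOnStalks := by
    have : SurjectiveOnStalks (Spec.map α' ≫ i') := by rwa [hα']
    exact SurjectiveOnStalks.Spec_iff.1 (SurjectiveOnStalks.of_comp (Spec.map α') i')
  -- The fibre product of the two charts is smooth of relative dimension `n` over both of them.
  let C := pushout φ φ'
  let c : C ⟶ O := pushout.desc α α' hαα'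
  let l : A ⟶ C := pushout.inl φ φ'
  let r : A' ⟶ C := pushout.inr φ φ'
  have hl : l.hom.IsStandardSmoothOfRelativeDimension n :=
    (RingHom.isStandardSmoothOfRelativeDimension_isStableUnderBaseChange n).pushout_inl
      RingHom.isStandardSmoothOfRelativeDimension_respectsIso φ φ' hφ'
  have hr : r.hom.IsStandardSmoothOfRelativeDimension n := by
    have h1 := (RingHom.isStandardSmoothOfRelativeDimension_isStableUnderBaseChange n).pushout_inl
      RingHom.isStandardSmoothOfRelativeDimension_respectsIso φ' φ hφ
    have h2 := RingHom.isStandardSmoothOfRelativeDimension_respectsIso.1 _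
      (pushoutSymmetry φ' φ).commRingCatIsoToRingEquiv h1
    have h3 : pushout.inl φ' φ ≫ (pushoutSymmetry φ' φ).hom = r := inl_comp_pushoutSymmetry_hom ..
    rw [← h3]
    exact h2
  have hlc : l ≫ c = α := pushout.inl_desc _ _ _
  have hrc : r ≫ c = α' := pushout.inr_desc _ _ _
  let _ : Algebra A C := l.hom.toAlgebra
  let _ : Algebra A' C := r.hom.toAlgebra
  have : Algebra.IsStandardSmoothOfRelativeDimension n A C := hl
  have : Algebra.IsStandardSmoothOfRelativeDimension n A' C := hr
  have := Algebra.IsStandardSmoothOfRelativeDimension.isStandardSmooth (R := A) (S := C) n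
  have := Algebra.IsStandardSmoothOfRelativeDimension.isStandardSmooth (R := A') (S := C) n
  have : Nontrivial C := c.hom.domain_nontrivial
  obtain ⟨b⟩ := nonempty_basis_kaehlerDifferential (A := A) (C := C) n
  obtain ⟨b'⟩ := nonempty_basis_kaehlerDifferential (A := A') (C := C) n
  obtain ⟨S, _, ι, σ, hσ, hf, hf'⟩ := exists_etale_factorization b b' c.hom
    (by
      have := exists_fraction_of_surjectiveOnStalks hsα
      rw [← hlc] at this
      exact this)
    (by
      have := exists_fraction_of_surjectiveOnStalks hsα'
      rw [← hrc] at this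
      exact this)
  let f : A ⟶ .of S := CommRingCat.ofHom (ι.comp (algebraMap A C))
  let f' : A' ⟶ .of S := CommRingCat.ofHom (ι.comp (algebraMap A' C))
  let σ' : .of S ⟶ O := CommRingCat.ofHom σ
  have hfσ : f ≫ σ' = α := by
    rw [← hlc]
    ext a
    exact congrArg (fun g : C →+* O => g (l.hom a)) hσ
  have hfσ' : f' ≫ σ' = α' := by
    rw [← hrc]
    ext a
    exact congrArg (fun g : C →+* O => g (r.hom a)) hσ
  have hff' : φ ≫ f = φ' ≫ f' := by
    ext a
    exact congrArg (fun g : R ⟶ C => ι (g.hom a)) (pushout.condition (f := φ) (g := φ'))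
  obtain ⟨U, hσU, hU⟩ := exists_isNisnevichNbhd_specMap f hf σ'
    (by rw [hfσ]; exact exists_fraction_of_surjectiveOnStalks hsα)
  obtain ⟨U', hσU', hU'⟩ := exists_isNisnevichNbhd_specMap f' hf' σ'
    (by rw [hfσ']; exact exists_fraction_of_surjectiveOnStalks hsα')
  have hσV : Set.range (Spec.map σ') ⊆ Set.range (U ⊓ U').ι := by
    rw [Scheme.Opens.range_ι]
    exact Set.subset_inter hσU hσU'
  refine ⟨(U ⊓ U').toScheme, (U ⊓ U').ι ≫ Spec.map f ≫ i, (U ⊓ U').ι ≫ Spec.map f' ≫ i',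
    IsOpenImmersion.lift _ _ hσV, ?_, ?_, ?_, ?_, ?_⟩
  · rw [IsOpenImmersion.lift_fac_assoc, ← Category.assoc, ← Spec.map_comp, hfσ, hα]
  · rw [IsOpenImmersion.lift_fac_assoc, ← Category.assoc, ← Spec.map_comp, hfσ', hα']
  · rw [Category.assoc, Category.assoc, Category.assoc, Category.assoc, hip, hip',
      ← Spec.map_comp_assoc, hff', Spec.map_comp_assoc]
  · have := (hU.comp_isOpenImmersion i).isOpenImmersion_comp
      ((Spec (.of S)).homOfLE (inf_le_left : U ⊓ U' ≤ U))
    have h0 : i (Spec.map (f ≫ σ') (⊥ : PrimeSpectrum O)) = γ (⊥ : PrimeSpectrum O) :=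
      congrArg (fun g : Spec O ⟶ X => g (⊥ : PrimeSpectrum O))
        (show Spec.map (f ≫ σ') ≫ i = γ by rw [hfσ, hα])
    rwa [h0, Category.assoc, Scheme.homOfLE_ι_assoc] at this
  · have := (hU'.comp_isOpenImmersion i').isOpenImmersion_comp
      ((Spec (.of S)).homOfLE (inf_le_right : U ⊓ U' ≤ U'))
    have h0 : i' (Spec.map (f' ≫ σ') (⊥ : PrimeSpectrum O)) = γ' (⊥ : PrimeSpectrum O) :=
      congrArg (fun g : Spec O ⟶ X' => g (⊥ : PrimeSpectrum O))
        (show Spec.map (f' ≫ σ') ≫ i' = γ' by rw [hfσ', hα'])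
    rwa [h0, Category.assoc, Scheme.homOfLE_ι_assoc] at this

end Roof

end MotivicPairs

end

noncomputable section

namespace MotivicPairs

open AlgebraicGeometry TopologicalSpace

/-! ### Excision over a locally noetherian base -/

section LocallyNoetherian

/-- A point with a noetherian open neighbourhood has a neighbourhood all of whose points in a given
closed subset `Z` lie on an irreducible closed subset of `Z` through the given point. -/
lemma exists_open_forall_exists_specializes {X : Type*} [TopologicalSpace X] [QuasiSober X]
    (U₀ : Opens X) (hU₀ : NoetherianSpace U₀) {Z : Set X} (hZ : IsClosed Z) {x : X} (hx : x ∈ U₀) :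
    ∃ U : Opens X, x ∈ U ∧ ∀ w ∈ U, w ∈ Z → ∃ z ∈ Z, z ⤳ w ∧ z ⤳ x := by
  have : QuasiSober U₀ := U₀.isOpen.isOpenEmbedding_subtypeVal.quasiSober
  obtain ⟨S, hS, hc, hirr, hZS⟩ := NoetherianSpace.exists_finite_set_isClosed_irreducible
    (hZ.preimage (continuous_subtype_val (p := (· ∈ U₀))))
  -- remove the irreducible components of `Z` which do not contain `x`
  let T : Set U₀ := ⋃₀ {t | t ∈ S ∧ (⟨x, hx⟩ : U₀) ∉ t}
  have hT : IsClosed T := by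
    rw [show T = _ from Set.sUnion_eq_biUnion]
    exact (hS.subset fun _ ht => ht.1).isClosed_biUnion fun t ht => hc t ht.1
  refine ⟨⟨Subtype.val '' Tᶜ, U₀.isOpen.isOpenMap_subtype_val _ hT.isOpen_compl⟩,
    ⟨⟨x, hx⟩, fun ⟨t, ht, hxt⟩ => ht.2 hxt, rfl⟩, ?_⟩
  rintro _ ⟨w, hw, rfl⟩ hwZ
  have hw' : w ∈ ⋃₀ S := hZS ▸ hwZ
  obtain ⟨t, ht, hwt⟩ := hw'
  have hxt : ⟨x, hx⟩ ∈ t := by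
    by_contra hxt
    exact hw ⟨t, ⟨ht, hxt⟩, hwt⟩
  obtain ⟨z, hz⟩ := QuasiSober.sober (hirr t ht) (hc t ht)
  have hzt : z ∈ Subtype.val ⁻¹' Z := hZS.symm ▸ ⟨t, ht, hz.mem⟩
  exact ⟨z.1, hzt, (hz.specializes hwt).map continuous_subtype_val,
    (hz.specializes hxt).map continuous_subtype_val⟩

lemma ringKrullDim_stalk_add_one_le {X : Scheme.{u}} {x y : X} (h : y ⤳ x) (hne : y ≠ x) :
    ringKrullDim (X.presheaf.stalk y) + 1 ≤ ringKrullDim (X.presheaf.stalk x) := by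
  rw [ringKrullDim_stalk_eq_coheight, ringKrullDim_stalk_eq_coheight]
  have hlt : x < y := lt_of_le_not_ge h fun h' => hne (h.antisymm h').eq
  exact_mod_cast Order.coheight_add_one_le hlt

/-- Over a locally noetherian base, the excision morphism of an immediate specialization is an
isomorphism. -/
lemma isIso_excision {B X : Scheme.{u}} (p : X ⟶ B) [Smooth p] [IsLocallyNoetherian B] {x y : X}
    (h : y ⤳ x) (hne : y ≠ x)
    (hdim : ringKrullDim (X.presheaf.stalk x) = ringKrullDim (X.presheaf.stalk y) + 1) :
    IsIso (excision p h hne) := by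
  have : IsLocallyNoetherian X := LocallyOfFiniteType.isLocallyNoetherian p
  -- no point lies strictly between `y` and `x`
  have key : ∀ z : X, y ⤳ z → y ≠ z → z ⤳ x → z = x := by
    intro z hyz hne' hzx
    by_contra hzne
    have h1 := ringKrullDim_stalk_add_one_le hyz hne'
    have h2 := ringKrullDim_stalk_add_one_le hzx hzne
    have h3 : ringKrullDim (X.presheaf.stalk x) < ⊤ := ringKrullDim_lt_top
    rw [hdim] at h2 h3
    rw [ringKrullDim_stalk_eq_coheight] at h1 h2 h3
    rw [ringKrullDim_stalk_eq_coheight] at h1 h2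
    norm_cast at h1 h2 h3
    have h4 := h1.trans ((ENat.add_le_add_iff_right ENat.one_ne_top).1 h2)
    have h5 : Order.coheight y ≠ ⊤ := fun h6 => by simp [h6] at h3
    exact absurd h4 (not_le.2 (ENat.lt_add_one_iff h5 |>.2 le_rfl))
  refine Pro.isIso_reindex (punctured h hne) (OpenNhds.inclusion y ⋙ quot p y ⋙ toMotivicHo B)
    fun W => ?_
  obtain ⟨U₀, hU₀, hxU₀, -⟩ := exists_isAffineOpen_mem_and_subset (x := x) (U := ⊤) trivial
  have : IsNoetherianRing Γ(X, U₀) := IsLocallyNoetherian.component_noetherian ⟨U₀, hU₀⟩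
  obtain ⟨U, hxU, hU⟩ := exists_open_forall_exists_specializes U₀
    (noetherianSpace_of_isAffineOpen U₀ hU₀)
    (isClosed_closure (s := {y}) |>.inter W.1.isOpen.isClosed_compl) hxU₀
  refine ⟨⟨U, hxU⟩, fun U₂ hU₂ => ?_⟩
  refine ⟨W ⊓ (punctured h hne).obj U₂, homOfLE inf_le_left, homOfLE inf_le_right, ?_⟩
  refine isIso_quot_map p y (U := W.1 ⊓ (minus x).obj U₂.1) (U' := (minus x).obj U₂.1)
    (homOfLE inf_le_right) fun w hw hyw => ⟨?_, hw⟩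
  by_contra hwW
  obtain ⟨hwU, hxw⟩ := mem_minus.1 hw
  obtain ⟨z, ⟨hyz, hzW⟩, hzw, hzx⟩ := hU w (hU₂.le hwU) ⟨specializes_iff_mem_closure.1 hyw, hwW⟩
  have hzy : y ≠ z := fun e => hzW (e ▸ W.2)
  exact hxw (key z (specializes_iff_mem_closure.2 hyz) hzy hzx ▸ hzw)

end LocallyNoetherian

end MotivicPairs

end

noncomputable section

namespace MotivicPairs

open AlgebraicGeometry TopologicalSpace

/-! ### Comparison isomorphisms -/

section Comparison

/-- Isomorphisms preserve closed points of local schemes. -/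
lemma apply_eq_of_forall_specializes {Y Z : Scheme.{u}} (f : Y ⟶ Z) [IsIso f] {a : Y} {b : Z}
    (ha : ∀ t, t ⤳ a) (hb : ∀ t, t ⤳ b) : f a = b := by
  refine ((hb (f a)).antisymm ?_).eq
  have h : f (inv f b) = b := congrArg (fun g : Z ⟶ Z => g b) (IsIso.inv_hom_id f)
  rw [← h]
  exact (ha _).map f.continuous

/-- Isomorphisms preserve generic points. -/
lemma apply_eq_of_specializes_forall {Y Z : Scheme.{u}} (f : Y ⟶ Z) [IsIso f] {a : Y} {b : Z}
    (ha : ∀ t, a ⤳ t) (hb : ∀ t, b ⤳ t) : f a = b := by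
  refine (Specializes.antisymm ?_ (hb (f a))).eq
  have h : f (inv f b) = b := congrArg (fun g : Z ⟶ Z => g b) (IsIso.inv_hom_id f)
  rw [← h]
  exact (ha _).map f.continuous

lemma bot_specializes (O : CommRingCat.{u}) [IsDomain O] (t : Spec O) :
    (show Spec O from (⊥ : PrimeSpectrum O)) ⤳ t :=
  (PrimeSpectrum.le_iff_specializes _ _).1 (bot_le (a := (show PrimeSpectrum O from t)))

instance {X : Scheme.{u}} {x y : X} (h : y ⤳ x) : (generizationIdeal h).IsPrime :=
  RingHom.ker_isPrime _

/-- The local ring at `x` of the closure of `y` with its reduced structure. -/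
abbrev closureStalk {X : Scheme.{u}} {x y : X} (h : y ⤳ x) : CommRingCat.{u} :=
  .of (X.presheaf.stalk x ⧸ generizationIdeal h)

instance {X : Scheme.{u}} {x y : X} (h : y ⤳ x) : IsDomain (closureStalk h) :=
  inferInstanceAs (IsDomain (X.presheaf.stalk x ⧸ generizationIdeal h))

instance {X : Scheme.{u}} {x y : X} (h : y ⤳ x) : IsLocalRing (closureStalk h) :=
  IsLocalRing.of_surjective' (Ideal.Quotient.mk (generizationIdeal h)) Ideal.Quotient.mk_surjective

/-- The canonical morphism to `X` from the local scheme at `x` of the closure of `y`. -/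
def fromClosureStalk {X : Scheme.{u}} {x y : X} (h : y ⤳ x) : Spec (closureStalk h) ⟶ X :=
  Spec.map (CommRingCat.ofHom (Ideal.Quotient.mk (generizationIdeal h))) ≫ X.fromSpecStalk x

variable {B X X' : Scheme.{u}}

instance {x y : X} (h : y ⤳ x) : SurjectiveOnStalks (fromClosureStalk h) := by
  have : SurjectiveOnStalks
      (Spec.map (CommRingCat.ofHom (Ideal.Quotient.mk (generizationIdeal h)))) :=
    SurjectiveOnStalks.Spec_iff.2
      (RingHom.surjectiveOnStalks_of_surjective Ideal.Quotient.mk_surjective)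
  exact inferInstanceAs (SurjectiveOnStalks (_ ≫ _))

lemma fromClosureStalk_closedPoint {x y : X} (h : y ⤳ x) :
    fromClosureStalk h (IsLocalRing.closedPoint (closureStalk h)) = x := by
  have e : Spec.map (CommRingCat.ofHom (Ideal.Quotient.mk (generizationIdeal h)))
      (IsLocalRing.closedPoint (closureStalk h)) =
        IsLocalRing.closedPoint (X.presheaf.stalk x) :=
    have : IsLocalHom (Ideal.Quotient.mk (generizationIdeal h)) :=
      IsLocalHom.of_surjective _ Ideal.Quotient.mk_surjective
    IsLocalRing.comap_closedPoint (Ideal.Quotient.mk (generizationIdeal h))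
  exact (congrArg (X.fromSpecStalk x) e).trans Scheme.fromSpecStalk_closedPoint

lemma fromClosureStalk_bot {x y : X} (h : y ⤳ x) :
    fromClosureStalk h (⊥ : PrimeSpectrum (closureStalk h)) = y := by
  let g := X.presheaf.stalkSpecializes h ≫ X.residue y
  have e : Spec.map (CommRingCat.ofHom (Ideal.Quotient.mk (generizationIdeal h)))
      (⊥ : PrimeSpectrum (closureStalk h)) = Spec.map g (⊥ : PrimeSpectrum (X.residueField y)) := by
    apply PrimeSpectrum.ext
    exact Ideal.mk_ker
  have e2 : Spec.map g ≫ X.fromSpecStalk x = X.fromSpecResidueField y := by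
    rw [Spec.map_comp, Category.assoc, Scheme.SpecMap_stalkSpecializes_fromSpecStalk]
    rfl
  refine (congrArg (X.fromSpecStalk x) e).trans ?_
  refine (congrArg (fun k : Spec (X.residueField y) ⟶ X =>
    k (⊥ : PrimeSpectrum (X.residueField y))) e2).trans ?_
  exact X.fromSpecResidueField_apply y _

variable (p : X ⟶ B) (p' : X' ⟶ B) [Smooth p] [Smooth p'] {x : X} {x' : X'} {n : ℕ}

/-- The pro-object at `x` only depends on the residue field and the relative dimension at `x`: the
points `x` and `x'` have a common Nisnevich neighbourhood. -/
lemma nonempty_localQuot_iso_of_pointScheme_iso (hn : HasRelativeDimensionAt p x n)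
    (hn' : HasRelativeDimensionAt p' x' n) (e : pointScheme p x ≅ pointScheme p' x') :
    Nonempty (localQuot p x ≅ localQuot p' x') := by
  let γ : Spec (X.residueField x) ⟶ X := X.fromSpecResidueField x
  let i : Spec (X.residueField x) ⟶ Spec (X'.residueField x') := e.hom.left
  let γ' : Spec (X.residueField x) ⟶ X' := i ≫ X'.fromSpecResidueField x'
  have : IsIso i := inferInstanceAs (IsIso ((Over.forget B).map e.hom))
  have hγ : ∀ t, γ t = x := fun t => X.fromSpecResidueField_apply x t
  have hγ' : ∀ t, γ' t = x' := fun t => X'.fromSpecResidueField_apply x' (i t)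
  have hi : i ≫ X'.fromSpecResidueField x' ≫ p' = γ ≫ p := Over.w e.hom
  obtain ⟨V, π, π', ζ, hζ, hζ', hπ, hN, hN'⟩ := exists_common_nisnevichNbhd p p' γ γ'
    (by rw [Category.assoc, hi]) (n := n) ((hγ _).symm ▸ hn) ((hγ' _).symm ▸ hn')
  let η : Spec (X.residueField x) := (⊥ : PrimeSpectrum (X.residueField x))
  change IsNisnevichNbhd π (γ η) at hN
  change IsNisnevichNbhd π' (γ' η) at hN'
  rw [hγ] at hN
  rw [hγ'] at hN'
  have := hN.etale
  have hv : π (ζ η) = x :=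
    (congrArg (fun g : Spec (X.residueField x) ⟶ X => g η) hζ).trans (hγ η)
  have hv' : π' (ζ η) = x' :=
    (congrArg (fun g : Spec (X.residueField x) ⟶ X' => g η) hζ').trans (hγ' η)
  obtain ⟨φ⟩ := hN.nonempty_localQuot_iso (q := π ≫ p) rfl specializes_rfl hv
  obtain ⟨φ'⟩ := hN'.nonempty_localQuot_iso (q := π ≫ p) hπ.symm specializes_rfl hv'
  exact ⟨φ ≪≫ φ'.symm⟩

/-- The pro-objects at `x` and `y`, with their excision and connecting morphisms, only depend on the
local scheme of the closure of `y` at `x` and on the relative dimension. -/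
lemma exists_isos_of_closureLocalScheme_iso (hn : HasRelativeDimensionAt p x n)
    (hn' : HasRelativeDimensionAt p' x' n) {y : X} {y' : X'} (hy : y ⤳ x) (hy' : y' ⤳ x')
    (hne : y ≠ x) (hne' : y' ≠ x') (e : closureLocalScheme p hy ≅ closureLocalScheme p' hy') :
    ∃ (φx : localQuot p x ≅ localQuot p' x') (φy : localQuot p y ≅ localQuot p' y')
      (ψ : puncturedQuot p x y ≅ puncturedQuot p' x' y'),
      excision p hy hne ≫ ψ.hom = φy.hom ≫ excision p' hy' hne' ∧
      connecting p x y ≫ (Pro.map (motivicSusp B)).map ψ.hom =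
        φx.hom ≫ connecting p' x' y' := by
  let O := closureStalk hy
  let γ : Spec O ⟶ X := fromClosureStalk hy
  let i : Spec O ⟶ Spec (closureStalk hy') := e.hom.left
  let γ' : Spec O ⟶ X' := i ≫ fromClosureStalk hy'
  have : IsIso i := inferInstanceAs (IsIso ((Over.forget B).map e.hom))
  let c : Spec O := IsLocalRing.closedPoint O
  let η : Spec O := (⊥ : PrimeSpectrum O)
  have hγc : γ c = x := fromClosureStalk_closedPoint hy
  have hγη : γ η = y := fromClosureStalk_bot hy
  have hγc' : γ' c = x' :=
    (congrArg (fromClosureStalk hy') (apply_eq_of_forall_specializes i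
      (IsLocalRing.specializes_closedPoint (R := O))
      (IsLocalRing.specializes_closedPoint (R := closureStalk hy')))).trans
        (fromClosureStalk_closedPoint hy')
  have hγη' : γ' η = y' :=
    (congrArg (fromClosureStalk hy') (apply_eq_of_specializes_forall i
      (bot_specializes O) (bot_specializes (closureStalk hy')))).trans (fromClosureStalk_bot hy')
  have hi : i ≫ Spec.map (CommRingCat.ofHom (Ideal.Quotient.mk (generizationIdeal hy'))) ≫
      X'.fromSpecStalk x' ≫ p' = Spec.map (CommRingCat.ofHom
        (Ideal.Quotient.mk (generizationIdeal hy))) ≫ X.fromSpecStalk x ≫ p := Over.w e.hom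
  obtain ⟨V, π, π', ζ, hζ, hζ', hπ, hN, hN'⟩ := exists_common_nisnevichNbhd p p' γ γ'
    (by simpa only [γ, γ', fromClosureStalk, Category.assoc] using hi.symm) (n := n)
    (hγc.symm ▸ hn) (hγc'.symm ▸ hn')
  change IsNisnevichNbhd π (γ η) at hN
  change IsNisnevichNbhd π' (γ' η) at hN'
  rw [hγη] at hN
  rw [hγη'] at hN'
  have := hN.etale
  have hvx : π (ζ c) = x := (congrArg (fun g : Spec O ⟶ X => g c) hζ).trans hγc
  have hvy : π (ζ η) = y := (congrArg (fun g : Spec O ⟶ X => g η) hζ).trans hγη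
  have hvx' : π' (ζ c) = x' := (congrArg (fun g : Spec O ⟶ X' => g c) hζ').trans hγc'
  have hvy' : π' (ζ η) = y' := (congrArg (fun g : Spec O ⟶ X' => g η) hζ').trans hγη'
  have hV : ζ η ⤳ ζ c := (bot_specializes O c).map ζ.continuous
  have hneV : ζ η ≠ ζ c := fun h => hne (by rw [← hvy, ← hvx, h])
  obtain ⟨φx, φy, ψ, h1, h2⟩ := hN.exists_isos (q := π ≫ p) rfl hvx hvy hy hne hV hneV
  obtain ⟨φx', φy', ψ', h1', h2'⟩ :=
    hN'.exists_isos (q := π ≫ p) hπ.symm hvx' hvy' hy' hne' hV hneV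
  exact exists_isos_of_cospans (Pro.map (motivicSusp B)) h1.symm h1'.symm h2.symm h2'.symm

end Comparison

/-- Isomorphisms compatible with the excision and connecting morphisms are compatible with the
boundary morphisms. -/
lemma boundary_comp {B X X' : Scheme.{u}} (p : X ⟶ B) (p' : X' ⟶ B) [Smooth p] [Smooth p']
    {x y : X} {x' y' : X'} (hy : y ⤳ x) (hy' : y' ⤳ x') (hne : y ≠ x) (hne' : y' ≠ x')
    {φx : localQuot p x ≅ localQuot p' x'} {φy : localQuot p y ≅ localQuot p' y'}
    {ψ : puncturedQuot p x y ≅ puncturedQuot p' x' y'}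
    (h₁ : excision p hy hne ≫ ψ.hom = φy.hom ≫ excision p' hy' hne')
    (h₂ : connecting p x y ≫ (Pro.map (motivicSusp B)).map ψ.hom = φx.hom ≫ connecting p' x' y')
    [IsIso (excision p hy hne)] [IsIso (excision p' hy' hne')] :
    boundary p hy hne ≫ (Pro.map (motivicSusp B)).map φy.hom =
      φx.hom ≫ boundary p' hy' hne' := by
  have e : inv (excision p hy hne) ≫ φy.hom = ψ.hom ≫ inv (excision p' hy' hne') := by
    rw [IsIso.inv_comp_eq, ← Category.assoc, h₁, Category.assoc, IsIso.hom_inv_id,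
      Category.comp_id]
  rw [boundary, boundary, Category.assoc, ← Functor.map_comp, e, Functor.map_comp,
    ← Category.assoc, h₂, Category.assoc]

end MotivicPairs

end

theorem corollary3p2 {B X X' : AlgebraicGeometry.Scheme.{u}} (p : X ⟶ B) (p' : X' ⟶ B)
    [AlgebraicGeometry.Smooth p] [AlgebraicGeometry.Smooth p'] (x : X) (x' : X') (n : ℕ)
    (hn : MotivicPairs.HasRelativeDimensionAt p x n)
    (hn' : MotivicPairs.HasRelativeDimensionAt p' x' n)
    (hx : Nonempty (MotivicPairs.pointScheme p x ≅ MotivicPairs.pointScheme p' x')) :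
    Nonempty (MotivicPairs.localQuot p x ≅ MotivicPairs.localQuot p' x') ∧
    ∀ (y : X) (y' : X') (hy : y ⤳ x) (hy' : y' ⤳ x') (hne : y ≠ x) (hne' : y' ≠ x'),
      ringKrullDim (X.presheaf.stalk x) = ringKrullDim (X.presheaf.stalk y) + 1 →
      ringKrullDim (X'.presheaf.stalk x') = ringKrullDim (X'.presheaf.stalk y') + 1 →
      Nonempty (MotivicPairs.closureLocalScheme p hy ≅ MotivicPairs.closureLocalScheme p' hy') →
      (AlgebraicGeometry.IsLocallyNoetherian B →
        IsIso (MotivicPairs.excision p hy hne) ∧ IsIso (MotivicPairs.excision p' hy' hne')) ∧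
      ∃ (φx : MotivicPairs.localQuot p x ≅ MotivicPairs.localQuot p' x')
        (φy : MotivicPairs.localQuot p y ≅ MotivicPairs.localQuot p' y')
        (ψ : MotivicPairs.puncturedQuot p x y ≅ MotivicPairs.puncturedQuot p' x' y'),
        MotivicPairs.excision p hy hne ≫ ψ.hom =
          φy.hom ≫ MotivicPairs.excision p' hy' hne' ∧
        MotivicPairs.connecting p x y ≫
            (MotivicPairs.Pro.map (MotivicPairs.motivicSusp B)).map ψ.hom =
          φx.hom ≫ MotivicPairs.connecting p' x' y' ∧
        ∀ [IsIso (MotivicPairs.excision p hy hne)] [IsIso (MotivicPairs.excision p' hy' hne')],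
          MotivicPairs.boundary p hy hne ≫
              (MotivicPairs.Pro.map (MotivicPairs.motivicSusp B)).map φy.hom =
            φx.hom ≫ MotivicPairs.boundary p' hy' hne' := by
  obtain ⟨e⟩ := hx
  refine ⟨MotivicPairs.nonempty_localQuot_iso_of_pointScheme_iso p p' hn hn' e, ?_⟩
  rintro y y' hy hy' hne hne' hdim hdim' ⟨e'⟩
  refine ⟨fun _ => ⟨MotivicPairs.isIso_excision p hy hne hdim,
    MotivicPairs.isIso_excision p' hy' hne' hdim'⟩, ?_⟩
  obtain ⟨φx, φy, ψ, h₁, h₂⟩ :=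
    MotivicPairs.exists_isos_of_closureLocalScheme_iso p p' hn hn' hy hy' hne hne' e'
  exact ⟨φx, φy, ψ, h₁, h₂, MotivicPairs.boundary_comp p p' hy hy' hne hne' h₁ h₂⟩
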